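/- Let $O$ be an excellent reduced (commutative, Noetherian) ring of Krull dimension one that is not regular, with total ring of fractions $K$ and normalization $\widetilde O$ (the integral closure of $O$ in $K$). Put $O_1 = O$ and, for $i \ge 1$, let $O_{i+1} = O_i^\sharp = \operatorname{End}_{O_i}(\mathfrak I_i)$, identified with $\{x \in K \mid x\mathfrak I_i \subseteq \mathfrak I_i\}$, where $\mathfrak I_i \subseteq O_i$ is the vanishing ideal of the singular locus of $\operatorname{Spec}(O_i)$. Then $O_{n+1} = \widetilde O$ for some $n$; let $n$ be the smallest such integer, called the level of $O$ (so $n \ge 1$). Let $$A = \operatorname{End}_O(O_1 \oplus O_2 \oplus \dots \oplus O_{n+1})^{\mathrm{op}}$$ be König's order of $O$, let $e_i \in A$ be the idempotent given by the projection onto the direct summand $O_i$, and put $e = e_{n+1}$, $J = AeA$, $Q = A/J$ and $J_k = A(e_{k+1} + \dots + e_{n+1})A$ for $0 \le k \le n$, so that $J_0 = A$ and $J_n = J$. Then: 1. $\operatorname{gl.dim}(A) \le 2n$. 2. The ring $Q$ is (left and right) artinian and quasi-hereditary, with heredity chain $$0 = J_n/J \subsetneq J_{n-1}/J \subsetneq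 \dots \subsetneq J_1/J \subsetneq J_0/J = Q.$$ That is, for $1 \le k \le n$ the ideal $L = J_{k-1}/J_k$ of the ring $Q_k = A/J_k$ satisfies $L^2 = L$ and $L\operatorname{rad}(Q_k)L = 0$, and is projective both as a left and as a right $Q_k$-module. 3. $\operatorname{gl.dim}(Q) < \infty$. -/

import Mathlib

open scoped TensorProduct nonZeroDivisors

universe u

namespace Koenig

/-! ### Excellent rings -/

/-- A commutative ring is catenary if, for primes `p ≤ q`, any two saturated chains of primes
from `p` to `q` have the same length. -/
def IsCatenary (B : Type u) [CommRing B] : Prop :=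
  ∀ c d : RelSeries {(p, q) : PrimeSpectrum B × PrimeSpectrum B | p ⋖ q},
    c.head = d.head → c.last = d.last → c.length = d.length

/-- The regular locus of `Spec B`. -/
def regularLocus (B : Type u) [CommRing B] : Set (PrimeSpectrum B) :=
  {p | IsRegularLocalRing (Localization.AtPrime p.asIdeal)}

/-- The singular locus of `Spec B`. -/
def singularLocus (B : Type u) [CommRing B] : Set (PrimeSpectrum B) :=
  {p | ¬ IsRegularLocalRing (Localization.AtPrime p.asIdeal)}

/-- A `k`-algebra `S` is geometrically regular if `L ⊗ S` is a (Noetherian) regular ring for every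
finite field extension `L` of `k`. -/
def IsGeometricallyRegular (k : Type u) [Field k] (S : Type u) [CommRing S] [Algebra k S] : Prop :=
  ∀ (L : Type u) [Field L] [Algebra k L], FiniteDimensional k L → IsRegularRing (L ⊗[k] S)

/-- The completion of a local ring with respect to its maximal ideal. -/
abbrev completion (R : Type u) [CommRing R] [IsLocalRing R] : Type u :=
  AdicCompletion (IsLocalRing.maximalIdeal R) R

/-- Excellent rings: Noetherian, universally catenary, with geometrically regular formal fibres,
and such that every algebra of finite type has open regular locus. -/
structure IsExcellentRing (R : Type u) [CommRing R] : Prop where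
  isNoetherianRing : IsNoetherianRing R
  universallyCatenary : ∀ (B : Type u) [CommRing B] [Algebra R B],
    Algebra.FiniteType R B → IsCatenary B
  formalFibres : ∀ (p : Ideal R) [p.IsPrime] (q : Ideal (Localization.AtPrime p)) [q.IsPrime],
    IsGeometricallyRegular q.ResidueField (q.Fiber (completion (Localization.AtPrime p)))
  isOpen_regularLocus : ∀ (B : Type u) [CommRing B] [Algebra R B],
    Algebra.FiniteType R B → IsOpen (regularLocus B)

/-! ### Global dimension -/

/-- The (left) global dimension of a ring: the supremum of the projective dimensions of all left
modules. It takes the value `⊥` for the zero ring. -/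
noncomputable def globalDimension (R : Type u) [Ring R] : WithBot ℕ∞ :=
  ⨆ M : ModuleCat.{u} R, CategoryTheory.projectiveDimension M

/-! ### Quasi-hereditary rings -/

/-- A two-sided ideal `J` of a ring `R` with Jacobson radical `N` is a heredity ideal if
`J² = J`, `J N J = 0`, and `J` is projective both as a left and as a right `R`-module. -/
structure IsHeredityIdeal {R : Type u} [Ring R] (J : TwoSidedIdeal R) : Prop where
  idempotent : TwoSidedIdeal.span {z : R | ∃ x ∈ J, ∃ y ∈ J, z = x * y} = J
  mul_jacobson_mul : ∀ x ∈ J, ∀ r ∈ Ring.jacobson R, ∀ y ∈ J, x * r * y = 0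
  projective_left : Module.Projective R J
  projective_right : Module.Projective Rᵐᵒᵖ J

/-- The image of a two-sided ideal `I` in the quotient ring `R / J`. -/
def imageInQuotient {R : Type u} [Ring R] (J I : TwoSidedIdeal R) :
    TwoSidedIdeal J.ringCon.Quotient :=
  I.map J.ringCon.mk'

/-- A heredity chain of length `m`: a chain `0 = H 0 ⊊ H 1 ⊊ … ⊊ H m = R` of two-sided ideals such
that `H (t + 1) / H t` is a heredity ideal of `R / H t` for all `t < m`. -/
structure IsHeredityChain {R : Type u} [Ring R] {m : ℕ}
    (H : Fin (m + 1) → TwoSidedIdeal R) : Prop where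
  zero : H 0 = ⊥
  last : H (Fin.last m) = ⊤
  strictMono : StrictMono H
  heredity : ∀ t : Fin m, IsHeredityIdeal (imageInQuotient (H t.castSucc) (H t.succ))

/-- A ring is quasi-hereditary if it is semiprimary and has a heredity chain. -/
structure IsQuasiHereditary (R : Type u) [Ring R] : Prop where
  isSemiprimaryRing : IsSemiprimaryRing R
  exists_chain : ∃ (m : ℕ) (H : Fin (m + 1) → TwoSidedIdeal R), IsHeredityChain H

/-! ### The chain of overrings -/

section Overrings

variable {O : Type u} [CommRing O]

/-- For a ring `R` between `O` and its total ring of fractions `K`, the vanishing ideal of the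
singular locus of `Spec R`. It is the unit ideal if `R` is regular. -/
def singularIdeal (R : Subalgebra O (FractionRing O)) : Ideal R :=
  PrimeSpectrum.vanishingIdeal (singularLocus R)

/-- The ring `R♯ = End_R(I)`, where `I` is the vanishing ideal of the singular locus of `Spec R`,
realized inside the total ring of fractions `K` as `{x ∈ K | x I ⊆ I}`;
see `sharpToEnd_bijective`. -/
def sharp (R : Subalgebra O (FractionRing O)) : Subalgebra O (FractionRing O) where
  carrier := {x | ∀ a ∈ singularIdeal R, ∃ b ∈ singularIdeal R, x * (a : FractionRing O) = b}
  mul_mem' := by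
    intro x y hx hy a ha
    obtain ⟨b, hb, hab⟩ := hy a ha
    obtain ⟨c, hc, hbc⟩ := hx b hb
    exact ⟨c, hc, by rw [mul_assoc, hab, hbc]⟩
  add_mem' := by
    intro x y hx hy a ha
    obtain ⟨b, hb, hab⟩ := hx a ha
    obtain ⟨c, hc, hac⟩ := hy a ha
    exact ⟨b + c, add_mem hb hc, by rw [add_mul, hab, hac]; rfl⟩
  algebraMap_mem' := by
    intro r a ha
    exact ⟨algebraMap O R r * a, Ideal.mul_mem_left _ _ ha, rfl⟩

/-- Multiplication by elements of `R♯`, as endomorphisms of the `R`-module `I`. -/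
noncomputable def sharpToEnd (R : Subalgebra O (FractionRing O)) :
    sharp R →+* Module.End R (singularIdeal R) where
  toFun x :=
    { toFun := fun a => ⟨(x.2 a.1 a.2).choose, (x.2 a.1 a.2).choose_spec.1⟩
      map_add' := by
        intro a b
        apply Subtype.ext
        apply Subtype.ext
        simp only [Submodule.coe_add, Subalgebra.coe_add]
        rw [← (x.2 _ (a + b).2).choose_spec.2, ← (x.2 a.1 a.2).choose_spec.2,
          ← (x.2 b.1 b.2).choose_spec.2]
        simp [mul_add]
      map_smul' := by
        intro r a
        apply Subtype.ext
        apply Subtype.ext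
        simp only [Submodule.coe_smul, RingHom.id_apply, smul_eq_mul, Subalgebra.coe_mul]
        rw [← (x.2 _ (r • a).2).choose_spec.2, ← (x.2 a.1 a.2).choose_spec.2]
        simp only [Submodule.coe_smul, smul_eq_mul, Subalgebra.coe_mul]
        ring }
  map_one' := by
    ext a
    exact ((Subtype.property (1 : sharp R) a.1 a.2).choose_spec.2).symm.trans (one_mul _)
  map_zero' := by
    ext a
    exact ((Subtype.property (0 : sharp R) a.1 a.2).choose_spec.2).symm.trans (zero_mul _)
  map_add' x y := by
    ext a
    refine ((x + y).2 a.1 a.2).choose_spec.2.symm.trans ?_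
    refine (add_mul (x : FractionRing O) y _).trans ?_
    exact congrArg₂ (· + ·) (x.2 a.1 a.2).choose_spec.2 (y.2 a.1 a.2).choose_spec.2
  map_mul' x y := by
    ext a
    refine ((x * y).2 a.1 a.2).choose_spec.2.symm.trans ?_
    refine (mul_assoc (x : FractionRing O) y _).trans ?_
    refine (congrArg (fun z => (x : FractionRing O) * z) (y.2 a.1 a.2).choose_spec.2).trans ?_
    exact (x.2 _ (y.2 a.1 a.2).choose_spec.1).choose_spec.2

theorem sharpToEnd_apply (R : Subalgebra O (FractionRing O)) (x : sharp R) (a : singularIdeal R) :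
    ((sharpToEnd R x a : R) : FractionRing O) = x * ((a : R) : FractionRing O) :=
  ((x.2 a.1 a.2).choose_spec.2).symm

set_option synthInstance.maxHeartbeats 200000 in
/-- `R♯` is the endomorphism ring of the `R`-module `I` as soon as `I` contains an element that is
invertible in the total ring of fractions. -/
theorem sharpToEnd_bijective (R : Subalgebra O (FractionRing O))
    (h : ∃ a ∈ singularIdeal R, IsUnit (a : FractionRing O)) :
    Function.Bijective (sharpToEnd R) := by
  obtain ⟨a, ha, u, hu⟩ := h
  constructor
  · intro x y hxy
    have := congrArg (fun f : Module.End R (singularIdeal R) =>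
      ((f ⟨a, ha⟩ : R) : FractionRing O)) hxy
    simp only [sharpToEnd_apply, ← hu] at this
    exact Subtype.ext (u.isUnit.mul_right_cancel this)
  · intro f
    have key : ∀ b : singularIdeal R, (((f ⟨a, ha⟩ : R) : FractionRing O) * ↑u⁻¹) *
        ((b : R) : FractionRing O) = ((f b : R) : FractionRing O) := by
      intro b
      have h1 : f (a • b) = f ((b : R) • (⟨a, ha⟩ : singularIdeal R)) :=
        congrArg f (Subtype.ext (mul_comm _ _))
      rw [f.map_smul, f.map_smul] at h1
      have h2 := congrArg (fun z : singularIdeal R => ((z : R) : FractionRing O)) h1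
      simp only [Submodule.coe_smul, smul_eq_mul, Subalgebra.coe_mul, ← hu] at h2
      rw [mul_right_comm, mul_comm ((f ⟨a, ha⟩ : R) : FractionRing O), ← h2, mul_right_comm,
        Units.mul_inv, one_mul]
    refine ⟨⟨((f ⟨a, ha⟩ : R) : FractionRing O) * ↑u⁻¹, fun b hb =>
      ⟨f ⟨b, hb⟩, (f ⟨b, hb⟩).2, key ⟨b, hb⟩⟩⟩, ?_⟩
    ext b
    rw [sharpToEnd_apply]
    exact key b

variable (O)

/-- The chain of overrings of `O` in its total ring of fractions; indices start at `0`, so that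
`overring O i` is `O_{i + 1}`: it is `O` for `i = 0`, and `O_{i + 2} = (O_{i + 1})♯`. -/
def overring : ℕ → Subalgebra O (FractionRing O)
  | 0 => ⊥
  | i + 1 => sharp (overring i)

/-- The normalization of `O`: its integral closure in the total ring of fractions. -/
abbrev normalization : Subalgebra O (FractionRing O) :=
  integralClosure O (FractionRing O)

/-- The level of `O`: the least `n` such that `O_{n + 1}` is the normalization of `O`. -/
noncomputable def level : ℕ :=
  sInf {n | overring O n = normalization O}

/-! ### König's order -/

/-- König's order `End_O(O_1 ⊕ … ⊕ O_{n + 1})ᵒᵖ`, to be used with `n` the level of `O`. -/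
def KoenigOrder (n : ℕ) : Type u :=
  (Module.End O ((i : Fin (n + 1)) → overring O i))ᵐᵒᵖ

noncomputable instance (n : ℕ) : Ring (KoenigOrder O n) :=
  inferInstanceAs (Ring (Module.End O ((i : Fin (n + 1)) → overring O i))ᵐᵒᵖ)

/-- The standard idempotent of König's order given by the projection of `O_1 ⊕ … ⊕ O_{n + 1}` onto
its direct summand number `i`; indices start at `0`, so this is `e_{i + 1}`. -/
noncomputable def stdIdempotent (n : ℕ) (i : Fin (n + 1)) : KoenigOrder O n :=
  MulOpposite.op (LinearMap.single O (fun j : Fin (n + 1) => overring O j) i ∘ₗ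
    LinearMap.proj i)

/-- The two-sided ideal `J_k = A ε_k A`, where `ε_k = e_{k + 1} + … + e_{n + 1}`. For `k = 0` this
is `A`, as `ε_0 = 1`. -/
noncomputable def koenigIdeal (n k : ℕ) : TwoSidedIdeal (KoenigOrder O n) :=
  TwoSidedIdeal.span {∑ i ∈ Finset.univ.filter (fun i : Fin (n + 1) => k ≤ (i : ℕ)), stdIdempotent O n i}

/-- The two-sided ideal `J = A e A`, where `e = e_{n + 1}`. -/
noncomputable def koenigKernel (n : ℕ) : TwoSidedIdeal (KoenigOrder O n) :=
  TwoSidedIdeal.span {stdIdempotent O n (Fin.last n)}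

/-- The quotient ring `Q = A / J`. -/
abbrev KoenigQuotient (n : ℕ) : Type u :=
  (koenigKernel O n).ringCon.Quotient

end Overrings

end Koenig

/-! Write R_i for `overring O i`, with indices from 0 as in the code, and S for the normalization of
O.

An O-linear map between two of the R_i is multiplication by a fraction (`linearMap_apply_eq_mul`).
So A is a ring of matrices whose (i, j) entry runs through the conductor (R_j : R_i), which is R_j
when i ≤ j. A matrix lies in J_k exactly when the maps in its rows i < k extend from R_i to R_k
(`mem_koenigIdeal`). Put B = A/J_{k+1} with k < n, and let e be its idempotent of index k. Only the
rows i ≤ k survive in B, and eBe is R_k/(R_k : R_{k+1}). The inclusions u_i of R_i into R_k, for i ≤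
k, form a basis of Be over eBe, and BeB, the image of J_k, is the direct sum of the u_i eB
(`CornerQuotient.isCornerBasis`).

The singular ideal of R_k is radical and contains a nonzerodivisor, so in dimension one its quotient
is reduced and artinian, hence semisimple. It lies in (R_k : R_{k+1}), so eBe is semisimple too.
Therefore BeB is a heredity ideal (`IsCornerBasis.isHeredityIdeal`).

For global dimension, suppose that eBe is hereditary and eB is projective over it. If Z is a
submodule of a free B-module, then eZ is projective, hence so is BeZ, and Z/BeZ is a module over
B/BeB. Thus B costs at most two more than B/BeB (`IsCornerBasis.pdLT_add_two`). Since A/J_1 is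
semisimple, A/J_n has global dimension at most 2(n - 1). One more step, at the corner S, which is
hereditary because it is regular of dimension at most one, gives 2n for A.

The chain of rings increases strictly until it reaches S, because sharp R ≤ R makes R regular at
every prime containing a nonzerodivisor (`isRegularLocalRing_of_sharp_le`). That it does reach S,
and that Q is artinian, rests on finiteness of S over O (`IsExcellentRing.finite_normalization`).
Take a nonzerodivisor a in the singular ideal of O. Every element of S is carried into O by some
power of a, and a uniform exponent follows from a^n S ∩ O ⊆ aO for some n. This inclusion is proved
in the completions of the local rings. There the extensions of the ideals a^n S ∩ O have zero
intersection because the formal fibres over minimal primes are reduced of dimension zero, and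
Chevalley's theorem applies. -/

namespace Koenig

open CategoryTheory

/-! ### Hereditary rings -/

/-- A ring is left hereditary if submodules of projective left modules are projective. -/
def IsLeftHereditary (E : Type u) [Ring E] : Prop :=
  ∀ (P : Type u) [AddCommGroup P] [Module E P] [Module.Projective E P] (N : Submodule E P),
    Module.Projective E N

theorem exists_injective_extension (E : Type u) [Ring E] (M : Type u) [AddCommGroup M]
    [Module E M] : ∃ (I : Type u) (_ : AddCommGroup I) (_ : Module E I) (f : M →ₗ[E] I),
      Module.Injective E I ∧ Function.Injective f := by
  have h : Injective (Injective.under (ModuleCat.of E M)) := inferInstance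
  let W : ModuleCat.{u} E := Injective.under (ModuleCat.of E M)
  refine ⟨W, inferInstance, inferInstance, (Injective.ι (ModuleCat.of E M)).hom, ?_, ?_⟩
  · exact Module.injective_module_of_injective_object (inj := h)
  · exact (ModuleCat.mono_iff_injective _).mp inferInstance

/-- Over a ring all of whose left ideals are projective, quotients of injectives are injective. -/
theorem injective_of_surjective {E : Type u} [Ring E] (hE : ∀ I : Ideal E, Module.Projective E I)
    {W V : Type u} [AddCommGroup W] [Module E W] [AddCommGroup V] [Module E V]
    [Module.Injective E W] (q : W →ₗ[E] V) (hq : Function.Surjective q) : Module.Injective E V := by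
  apply Module.Baer.injective
  intro I g
  have := hE I
  obtain ⟨g', hg'⟩ := Module.projective_lifting_property q g hq
  obtain ⟨h, hh⟩ := Module.Injective.extension_property E W I E I.subtype
    Subtype.val_injective g'
  refine ⟨q ∘ₗ h, fun x hx => ?_⟩
  rw [← hg', ← hh]
  rfl

/-- The Cartan–Eilenberg argument: embed a free cover of N in an injective W. The quotient of W by
the relations of N is again injective, so the map from N to it extends to P and then lifts to W,
since P is projective. -/
theorem IsLeftHereditary.of_ideals {E : Type u} [Ring E]
    (hE : ∀ I : Ideal E, Module.Projective E I) : IsLeftHereditary E := by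
  intro P _ _ _ N
  refine Module.Projective.of_lifting_property'' fun f hf => ?_
  obtain ⟨W, _, _, j, hW, hj⟩ := exists_injective_extension E (N →₀ E)
  let Kf : Submodule E W := (LinearMap.ker f).map j
  have hinj : Module.Injective E (W ⧸ Kf) := injective_of_surjective hE Kf.mkQ Kf.mkQ_surjective
  obtain ⟨s, hs⟩ := Function.Surjective.hasRightInverse hf
  -- Additive and linear although s is only a set-theoretic section: the defects of s lie in the
  -- kernel of f, which Kf absorbs.
  let ψ : N →ₗ[E] W ⧸ Kf :=
    { toFun := fun x => Kf.mkQ (j (s x))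
      map_add' := fun x y => by
        rw [← map_add, ← map_add, ← sub_eq_zero, ← map_sub, ← map_sub, ← LinearMap.mem_ker,
          Submodule.ker_mkQ]
        exact Submodule.mem_map_of_mem (by simp [hs _])
      map_smul' := fun r x => by
        rw [RingHom.id_apply, ← map_smul, ← map_smul, ← sub_eq_zero, ← map_sub, ← map_sub,
          ← LinearMap.mem_ker, Submodule.ker_mkQ]
        exact Submodule.mem_map_of_mem (by simp [hs _]) }
  obtain ⟨Ψ, hΨ⟩ := Module.Injective.extension_property E (W ⧸ Kf) N P N.subtype
    Subtype.val_injective ψ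
  obtain ⟨Θ, hΘ⟩ := Module.projective_lifting_property Kf.mkQ Ψ Kf.mkQ_surjective
  -- On N the lift Θ takes values in the image of the free module, since modulo Kf it agrees with j
  -- (s x). Reading it there gives a linear section of f.
  have key : ∀ x : N, ∃ y, j y = Θ x ∧ f y = x := by
    intro x
    have h1 : Kf.mkQ (Θ x) = Kf.mkQ (j (s x)) := by
      rw [← LinearMap.comp_apply, hΘ]
      exact LinearMap.congr_fun hΨ x
    rw [← sub_eq_zero, ← map_sub, ← LinearMap.mem_ker, Submodule.ker_mkQ] at h1
    obtain ⟨k, hk, hk'⟩ := h1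
    refine ⟨k + s x, by rw [map_add, hk']; abel, ?_⟩
    rw [map_add, hs, LinearMap.mem_ker.mp hk, zero_add]
  choose t ht ht' using key
  refine ⟨{ toFun := t, map_add' := fun x y => hj ?_, map_smul' := fun r x => hj ?_ }, ?_⟩
  · simp [ht]
  · simp [ht]
  · ext x
    simp [ht']

theorem isLeftHereditary_of_isSemisimpleRing (E : Type u) [Ring E] [IsSemisimpleRing E] :
    IsLeftHereditary E := fun _ _ _ _ _ => Module.projective_of_isSemisimpleRing E _

theorem projective_finsupp {E : Type u} [Ring E] {P : Type u} [AddCommGroup P] [Module E P]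
    [Module.Projective E P] (S : Type u) : Module.Projective E (S →₀ P) := by
  classical
  exact Module.Projective.of_equiv' (finsuppLequivDFinsupp (M := P) E).symm

/-! ### Projective dimension -/

section ProjectiveDimension

variable {B : Type u} [Ring B] {M N : Type u} [AddCommGroup M] [Module B M] [AddCommGroup N]
  [Module B N]

variable (B M) in
/-- The projective dimension of `M` is smaller than `n`. -/
abbrev PdLT (n : ℕ) : Prop := HasProjectiveDimensionLT (ModuleCat.of B M) n

theorem PdLT.mono {m n : ℕ} (h : PdLT B M m) (hmn : m ≤ n) : PdLT B M n :=
  hasProjectiveDimensionLT_of_ge _ m n hmn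

theorem pdLT_zero_of_subsingleton [Subsingleton M] : PdLT B M 0 :=
  (ModuleCat.isZero_of_subsingleton _).hasProjectiveDimensionLT_zero

theorem subsingleton_of_pdLT_zero (h : PdLT B M 0) : Subsingleton M :=
  ModuleCat.isZero_iff_subsingleton (M := ModuleCat.of B M) |>.mp
    (isZero_of_hasProjectiveDimensionLT_zero _)

theorem pdLT_one_of_projective [Module.Projective B M] : PdLT B M 1 :=
  projective_iff_hasProjectiveDimensionLT_one.mp
    (ModuleCat.projective_of_categoryTheory_projective (ModuleCat.of B M))

theorem PdLT.of_equiv {n : ℕ} (e : M ≃ₗ[B] N) (h : PdLT B M n) : PdLT B N n :=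
  hasProjectiveDimensionLT_of_iso e.toModuleIso n

theorem PdLT.of_surjective {n : ℕ} (f : M →ₗ[B] N) (hf : Function.Surjective f)
    (h₁ : PdLT B (LinearMap.ker f) n) (h₂ : PdLT B M (n + 1)) : PdLT B N (n + 1) :=
  (LinearMap.shortExact_shortComplexKer hf).hasProjectiveDimensionLT_X₃ n h₁ h₂

theorem PdLT.ker_of_surjective {n : ℕ} (f : M →ₗ[B] N) (hf : Function.Surjective f)
    (h₂ : PdLT B M n) (h₃ : PdLT B N (n + 1)) : PdLT B (LinearMap.ker f) n :=
  (LinearMap.shortExact_shortComplexKer hf).hasProjectiveDimensionLT_X₁ n h₂ h₃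

theorem PdLT.of_submodule {n : ℕ} (S : Submodule B M) (h₁ : PdLT B S n) (h₂ : PdLT B (M ⧸ S) n) :
    PdLT B M n :=
  (LinearMap.shortExact_shortComplexKer S.mkQ_surjective).hasProjectiveDimensionLT_X₂ n
    (h₁.of_equiv (LinearEquiv.ofEq _ _ S.ker_mkQ.symm)) h₂

theorem globalDimension_le_of_pdLT {n : ℕ}
    (h : ∀ (M : Type u) [AddCommGroup M] [Module B M], PdLT B M (n + 1)) :
    globalDimension B ≤ (n : WithBot ℕ∞) :=
  iSup_le fun M => (projectiveDimension_le_iff M n).mpr (h M)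

/-- Change of rings along a surjection whose kernel is a projective left module. -/
theorem PdLT.restrictScalars {B' : Type u} [Ring B'] (φ : B →+* B') (hφ : Function.Surjective φ)
    (hker : Module.Projective B (RingHom.ker φ)) (m : ℕ) :
    ∀ (X : Type u) [AddCommGroup X] [Module B X] [Module B' X],
      (∀ (b : B) (x : X), b • x = φ b • x) → PdLT B' X m → PdLT B X (m + 1) := by
  induction m with
  | zero =>
    intro X _ _ _ _ h
    have := subsingleton_of_pdLT_zero h
    exact pdLT_zero_of_subsingleton.mono (Nat.zero_le _)
  | succ m ih =>
    intro X _ _ _ hX h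
    let p : (X →₀ B') →ₗ[B'] X := Finsupp.linearCombination B' id
    have hp : Function.Surjective p := Finsupp.linearCombination_id_surjective B' X
    let : Module B B' := Module.compHom B' φ
    have hB' : ∀ (b : B) (x : B'), b • x = φ b * x := fun _ _ => rfl
    have hfin : ∀ (b : B) (f : X →₀ B'), b • f = φ b • f := fun b f => by ext x; simp [hB']
    have toB : ∀ {Y Z : Type u} [AddCommGroup Y] [Module B Y] [Module B' Y] [AddCommGroup Z]
        [Module B Z] [Module B' Z] (_ : ∀ (b : B) (y : Y), b • y = φ b • y)
        (_ : ∀ (b : B) (z : Z), b • z = φ b • z) (f : Y →ₗ[B'] Z), ∃ g : Y →ₗ[B] Z, ∀ y, g y = f y :=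
      fun hY hZ f => ⟨{ f with map_smul' := fun b y => by simp [hY, hZ] }, fun _ => rfl⟩
    -- A direct sum of copies of 0 → ker φ → B → B' → 0 is a projective resolution of length one.
    have hfree : PdLT B (X →₀ B') 2 := by
      let φl : B →ₗ[B] B' := { φ with map_smul' := fun b x => by simp [hB'] }
      let Φ : (X →₀ B) →ₗ[B] (X →₀ B') := Finsupp.mapRange.linearMap φl
      refine PdLT.of_surjective Φ (Finsupp.mapRange_surjective _ (map_zero φl) hφ) ?_
        (pdLT_one_of_projective.mono (by omega))
      have e : (X →₀ RingHom.ker φ) ≃ₗ[B] LinearMap.ker Φ :=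
        LinearEquiv.ofBijective
          (LinearMap.codRestrict _ (Finsupp.mapRange.linearMap (RingHom.ker φ).subtype) fun f => by
            ext x
            exact (f x).2) (by
          constructor
          · intro f g hfg
            ext x
            exact DFunLike.congr_fun (congrArg Subtype.val hfg) x
          · intro f
            have hf : ∀ x, f.1 x ∈ RingHom.ker φ := fun x => DFunLike.congr_fun f.2 x
            refine ⟨Finsupp.onFinset f.1.support (fun x => ⟨f.1 x, hf x⟩) fun x hx => ?_, ?_⟩
            · rw [Finsupp.mem_support_iff]
              exact fun h0 => hx (Subtype.ext h0)
            · ext x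
              rfl)
      have : Module.Projective B (X →₀ RingHom.ker φ) := projective_finsupp X
      exact (pdLT_one_of_projective (M := X →₀ RingHom.ker φ)).of_equiv e
    -- For a projective X passing to the kernel of p gains nothing; X is instead a retract of the
    -- free module. Otherwise the kernel has smaller dimension over B' and the induction applies to
    -- it.
    cases m with
    | zero =>
      have : Projective (ModuleCat.of B' X) := projective_iff_hasProjectiveDimensionLT_one.mpr h
      have : Module.Projective B' X := ModuleCat.projective_of_module_projective (ModuleCat.of B' X)
      obtain ⟨s, hs⟩ := Module.projective_lifting_property p LinearMap.id hp
      obtain ⟨pB, hpB⟩ := toB hfin hX p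
      obtain ⟨sB, hsB⟩ := toB hX hfin s
      have r : Retract (ModuleCat.of B X) (ModuleCat.of B (X →₀ B')) :=
        { i := ModuleCat.ofHom sB
          r := ModuleCat.ofHom pB
          retract := by
            ext x
            simpa [hsB, hpB] using LinearMap.congr_fun hs x }
      have : HasProjectiveDimensionLT (ModuleCat.of B (X →₀ B')) 2 := hfree
      exact r.hasProjectiveDimensionLT 2
    | succ m =>
      obtain ⟨pB, hpB⟩ := toB hfin hX p
      let : Module B (LinearMap.ker p) := Module.compHom _ φ
      have hkerp : PdLT B (LinearMap.ker p) (m + 1 + 1) :=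
        ih _ (fun _ _ => rfl)
          (PdLT.ker_of_surjective p hp (pdLT_one_of_projective.mono (by omega)) h)
      refine PdLT.of_surjective pB (fun x => (hp x).imp fun y hy => (hpB y).trans hy) ?_
        (hfree.mono (by omega))
      refine hkerp.of_equiv
        { toFun := fun y => ⟨y.1, (hpB y.1).trans y.2⟩
          invFun := fun y => ⟨y.1, (hpB y.1).symm.trans y.2⟩
          map_add' := fun _ _ => rfl
          map_smul' := fun b y => Subtype.ext (hfin b y.1).symm
          left_inv := fun _ => rfl
          right_inv := fun _ => rfl }

end ProjectiveDimension

end Koenig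

namespace Koenig

open CategoryTheory

/-! ### Corner modules and trace submodules -/

section Corner

variable {E B : Type u} [Ring E] [Ring B] (θ : E →ₙ+* B)

theorem map_one_mul (r : E) : θ 1 * θ r = θ r := by rw [← map_mul, one_mul]

/-- For an idempotent `e = θ 1` of `B`, the subgroup `e M` of a `B`-module `M`. -/
def corner (M : Type u) [AddCommGroup M] [Module B M] : AddSubgroup M where
  carrier := {x | θ 1 • x = x}
  add_mem' {x y} hx hy := by
    rw [Set.mem_ofPred_eq] at *
    rw [smul_add, hx, hy]
  zero_mem' := smul_zero _
  neg_mem' {x} hx := by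
    rw [Set.mem_ofPred_eq] at *
    rw [smul_neg, hx]

variable {M : Type u} [AddCommGroup M] [Module B M]

theorem smul_mem_corner (r : E) (x : M) : θ r • x ∈ corner θ M := by
  change θ 1 • θ r • x = θ r • x
  rw [smul_smul, map_one_mul]

instance : SMul E (corner θ M) where
  smul r x := ⟨θ r • (x : M), smul_mem_corner θ r (x : M)⟩

instance : Module E (corner θ M) where
  one_smul x := Subtype.ext x.2
  mul_smul r s x := Subtype.ext (by
    change θ (r * s) • (x : M) = θ r • θ s • (x : M)
    rw [map_mul, mul_smul])
  smul_zero r := Subtype.ext (smul_zero _)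
  smul_add r x y := Subtype.ext (smul_add _ _ _)
  add_smul r s x := Subtype.ext (by
    change θ (r + s) • (x : M) = θ r • (x : M) + θ s • (x : M)
    rw [map_add, add_smul])
  zero_smul x := Subtype.ext (by
    change θ 0 • (x : M) = 0
    rw [map_zero, zero_smul])

theorem coe_smul_corner (r : E) (x : corner θ M) : ((r • x : corner θ M) : M) = θ r • (x : M) := rfl

/-- A finite family `u` in `B e`, for the idempotent `e = θ 1`, that is a basis of `B e` as a right
module over `e B e`, and such that `B e B` is the direct sum of the `u i * (e B)`. -/
structure IsCornerBasis (θ : E →ₙ+* B) {ι : Type} [Fintype ι] (u : ι → B) : Prop where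
  mul_idem (i : ι) : u i * θ 1 = u i
  exists_eq_one : ∃ i, u i = θ 1
  mul_mem (b : B) (i : ι) : ∃ c : ι → E, b * u i = ∑ j, u j * θ (c j)
  indep (y : ι → B) : ∑ i, u i * (θ 1 * y i) = 0 → ∀ i, θ 1 * y i = 0
  corner_mem (b : B) : ∃ r, θ 1 * b * θ 1 = θ r

namespace IsCornerBasis

variable {θ} {ι : Type} [Fintype ι] {u : ι → B} (h : IsCornerBasis θ u)

include h

theorem smul_sum (b : B) : ∃ c : ι → ι → E, ∀ {M : Type u} [AddCommGroup M] [Module B M]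
    (x : ι → corner θ M), b • ∑ i, u i • (x i : M) = ∑ j, u j • ((∑ i, c i j • x i : corner θ M) : M) := by
  choose c hc using h.mul_mem b
  refine ⟨c, fun x => ?_⟩
  simp only [AddSubgroup.val_finsetSum, coe_smul_corner, Finset.smul_sum, smul_smul, hc,
    Finset.sum_smul]
  exact Finset.sum_comm

/-- The submodule `B e M` of `M`. -/
def trace (M : Type u) [AddCommGroup M] [Module B M] : Submodule B M where
  carrier := {m | ∃ x : ι → corner θ M, ∑ i, u i • (x i : M) = m}
  add_mem' := by
    rintro _ _ ⟨x, rfl⟩ ⟨y, rfl⟩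
    exact ⟨x + y, by simp [smul_add, Finset.sum_add_distrib]⟩
  zero_mem' := ⟨0, by simp⟩
  smul_mem' := by
    rintro b _ ⟨x, rfl⟩
    obtain ⟨c, hc⟩ := h.smul_sum b
    exact ⟨_, (hc x).symm⟩

theorem smul_mem_trace (r : E) (m : M) : θ r • m ∈ h.trace M := by
  classical
  obtain ⟨i, hi⟩ := h.exists_eq_one
  refine ⟨Pi.single i ⟨θ r • m, smul_mem_corner θ r m⟩, ?_⟩
  rw [Finset.sum_eq_single i]
  · rw [Pi.single_eq_same, hi, smul_smul, map_one_mul]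
  · intro j _ hj
    rw [Pi.single_eq_of_ne hj]
    exact smul_zero _
  · simp

/-- By independence BeM is the direct sum of the u i • eM, that is, Be ⊗ eM over E, and this functor
preserves projectivity. Concretely, a section of the free cover of eM over E is pushed through θ and
extended along the basis u. -/
theorem projective_trace [Module.Projective E (corner θ M)]
    (hM : ∀ x : ι → corner θ M, ∑ i, u i • (x i : M) = 0 → x = 0) :
    Module.Projective B (h.trace M) := by
  obtain ⟨s, hs⟩ := Module.projective_def.mp ‹Module.Projective E (corner θ M)›
  let S : corner θ M →+ (corner θ M →₀ B) :=
    (Finsupp.mapRange.addMonoidHom (θ : E →+ B)).comp s.toAddMonoidHom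
  have hSapp : ∀ x y, S x y = θ (s x y) := fun _ _ => rfl
  have hS : ∀ (r : E) (x : corner θ M), S (r • x) = θ r • S x := by
    intro r x
    ext y
    rw [hSapp, map_smul, Finsupp.smul_apply, Finsupp.smul_apply, hSapp, smul_eq_mul, map_mul,
      smul_eq_mul]
  have hlin : ∀ x : corner θ M, Finsupp.linearCombination B ((↑) : corner θ M → M) (S x) = x := by
    intro x
    have h1 := congrArg (Subtype.val) (hs x)
    rw [Finsupp.linearCombination_apply, Finsupp.sum, AddSubgroup.val_finsetSum] at h1
    rw [show S x = Finsupp.mapRange θ (map_zero θ) (s x) from rfl, Finsupp.linearCombination_apply,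
      Finsupp.sum_mapRange_index (h := fun (y : corner θ M) a => a • (y : M)) (fun y => zero_smul _ _)]
    exact h1
  have hmem : ∀ y : corner θ M, (y : M) ∈ h.trace M := fun y => by
    have := h.smul_mem_trace 1 (y : M)
    rwa [show θ 1 • (y : M) = y from y.2] at this
  choose x hx using fun m : h.trace M => m.2
  -- Coordinates along u are unique, so the chosen ones are additive and transform under B by the
  -- matrices of `mul_mem`.
  have huniq : ∀ (m : h.trace M) (y : ι → corner θ M), ∑ i, u i • (y i : M) = m → x m = y := by
    intro m y hy
    rw [← sub_eq_zero]
    apply hM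
    simp only [Pi.sub_apply, AddSubgroup.coe_sub, smul_sub, Finset.sum_sub_distrib, hx, hy, sub_self]
  let σ : h.trace M →ₗ[B] (corner θ M →₀ B) :=
    { toFun := fun m => ∑ i, u i • S (x m i)
      map_add' := fun m m' => by
        rw [huniq (m + m') (x m + x m') (by
          simp [smul_add, Finset.sum_add_distrib, hx])]
        simp [smul_add, Finset.sum_add_distrib]
      map_smul' := fun b m => by
        choose c hc using h.mul_mem b
        rw [huniq (b • m) (fun j => ∑ i, c i j • x m i) (by
          simp only [AddSubgroup.val_finsetSum, coe_smul_corner, Finset.smul_sum, smul_smul]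
          rw [Finset.sum_comm]
          change _ = b • (m : M)
          rw [← hx m, Finset.smul_sum]
          simp only [smul_smul, hc, Finset.sum_smul])]
        simp only [map_sum, hS, Finset.smul_sum, smul_smul, RingHom.id_apply, hc, Finset.sum_smul]
        rw [Finset.sum_comm] }
  refine Module.Projective.of_split σ
    (Finsupp.linearCombination B fun y : corner θ M => (⟨y, hmem y⟩ : h.trace M)) ?_
  ext m
  rw [← Submodule.subtype_apply, LinearMap.comp_apply, ← LinearMap.comp_apply,
    ← Finsupp.linearCombination_linear_comp]
  change Finsupp.linearCombination B ((↑) : corner θ M → M) (∑ i, u i • S (x m i)) = m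
  simp only [map_sum, map_smul, hlin, hx]

theorem indep_finsupp (S : Type u) (x : ι → corner θ (S →₀ B))
    (hx : ∑ i, u i • (x i : S →₀ B) = 0) : x = 0 := by
  have key : ∀ i s, θ 1 * (x i : S →₀ B) s = (x i : S →₀ B) s := fun i s =>
    DFunLike.congr_fun (x i).2 s
  funext i
  ext s
  rw [← key i s]
  refine h.indep (fun i => (x i : S →₀ B) s) ?_ i
  have := DFunLike.congr_fun hx s
  simpa [Finsupp.finsetSum_apply, key] using this

theorem indep_self (x : ι → corner θ B) (hx : ∑ i, u i • (x i : B) = 0) : x = 0 := by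
  have key : ∀ i, θ 1 * (x i : B) = x i := fun i => (x i).2
  funext i
  ext
  rw [← key i]
  refine h.indep (fun i => (x i : B)) ?_ i
  simpa [key] using hx

omit [Fintype ι] h in
theorem projective_corner_finsupp [Module.Projective E (corner θ B)] (S : Type u) :
    Module.Projective E (corner θ (S →₀ B)) := by
  have := projective_finsupp (E := E) (P := corner θ B) S
  have key : ∀ (f : corner θ (S →₀ B)) s, θ 1 * (f : S →₀ B) s = (f : S →₀ B) s := fun f s =>
    DFunLike.congr_fun f.2 s
  let T : (S →₀ corner θ B) →ₗ[E] corner θ (S →₀ B) :=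
    { toFun := fun f => ⟨f.mapRange Subtype.val rfl, by
        ext s
        exact (f s).2⟩
      map_add' := fun f g => by
        ext s
        rfl
      map_smul' := fun r f => by
        ext s
        rfl }
  refine Module.Projective.of_equiv' (LinearEquiv.ofBijective T ⟨fun f g hfg => ?_, fun f => ?_⟩)
  · ext s
    exact DFunLike.congr_fun (congrArg Subtype.val hfg) s
  · refine ⟨Finsupp.onFinset f.1.support (fun s => ⟨f.1 s, key f s⟩) fun s hs => ?_, ?_⟩
    · rw [Finsupp.mem_support_iff]
      exact fun h0 => hs (Subtype.ext h0)
    · ext s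
      rfl

/-- A module killed by e is killed by BeB = ker φ, so it is a module over B'. Since BeB is
projective, restriction along φ costs one dimension. -/
theorem pdLT_add_one_of_annihilated [Module.Projective E (corner θ B)]
    {B' : Type u} [Ring B'] (φ : B →+* B') (hφ : Function.Surjective φ)
    (hker : ∀ b, φ b = 0 ↔ b ∈ h.trace B) {m : ℕ}
    (hB' : ∀ (X : Type u) [AddCommGroup X] [Module B' X], PdLT B' X m)
    (X : Type u) [AddCommGroup X] [Module B X] (hX : ∀ x : X, θ 1 • x = 0) :
    PdLT B X (m + 1) := by
  have hL : Module.Projective B (RingHom.ker φ) := by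
    have := h.projective_trace h.indep_self
    exact Module.Projective.of_equiv' (LinearEquiv.ofEq (h.trace B) (RingHom.ker φ)
      (Submodule.ext fun b => (hker b).symm))
  have hann : ∀ b : B, φ b = 0 → ∀ x : X, b • x = 0 := by
    intro b hb x
    obtain ⟨y, rfl⟩ := (hker b).mp hb
    rw [Finset.sum_smul]
    refine Finset.sum_eq_zero fun i _ => ?_
    rw [smul_eq_mul, mul_smul, ← (show θ 1 • (y i : B) = y i from (y i).2), smul_eq_mul, mul_smul,
      hX, smul_zero]
  let g : B' →+* AddMonoid.End X :=
    RingHom.liftOfRightInverse φ (Function.surjInv hφ) (Function.rightInverse_surjInv hφ)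
      ⟨Module.toAddMonoidEnd B X, fun b hb => by
        ext x
        exact hann b hb x⟩
  let : Module B' X := Module.compHom _ g
  refine PdLT.restrictScalars φ hφ hL m _ (fun b x => ?_) (hB' _)
  change b • x = g (φ b) x
  rw [RingHom.liftOfRightInverse_comp_apply]
  rfl

/-- In 0 → BeZ → Z → Z/BeZ → 0 the submodule is projective and the quotient is killed by e. -/
theorem pdLT_add_one_of_projective_corner [Module.Projective E (corner θ B)]
    {B' : Type u} [Ring B'] (φ : B →+* B') (hφ : Function.Surjective φ)
    (hker : ∀ b, φ b = 0 ↔ b ∈ h.trace B) {m : ℕ}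
    (hB' : ∀ (X : Type u) [AddCommGroup X] [Module B' X], PdLT B' X m)
    (Z : Type u) [AddCommGroup Z] [Module B Z] [Module.Projective E (corner θ Z)]
    (hZ : ∀ x : ι → corner θ Z, ∑ i, u i • (x i : Z) = 0 → x = 0) : PdLT B Z (m + 1) := by
  have := h.projective_trace hZ
  refine PdLT.of_submodule (h.trace Z) (pdLT_one_of_projective.mono (by omega)) ?_
  refine h.pdLT_add_one_of_annihilated φ hφ hker hB' _ fun x => ?_
  induction x using Submodule.Quotient.induction_on with
  | _ z =>
    rw [← Submodule.Quotient.mk_smul, Submodule.Quotient.mk_eq_zero]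
    exact h.smul_mem_trace 1 z

/-- The passage from `B / B e B` to `B` raises the global dimension by at most two. -/
theorem pdLT_add_two (hE : IsLeftHereditary E) [Module.Projective E (corner θ B)]
    {B' : Type u} [Ring B'] (φ : B →+* B') (hφ : Function.Surjective φ)
    (hker : ∀ b, φ b = 0 ↔ b ∈ h.trace B) {m : ℕ}
    (hB' : ∀ (X : Type u) [AddCommGroup X] [Module B' X], PdLT B' X m)
    (M : Type u) [AddCommGroup M] [Module B M] : PdLT B M (m + 2) := by
  let p : (M →₀ B) →ₗ[B] M := Finsupp.linearCombination B id
  have hp : Function.Surjective p := Finsupp.linearCombination_id_surjective B M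
  refine PdLT.of_surjective p hp ?_ (pdLT_one_of_projective.mono (by omega))
  generalize LinearMap.ker p = Z
  have := projective_corner_finsupp (θ := θ) M
  -- The corner of the syzygy embeds in the projective corner of the free module; heredity of E
  -- makes it projective, and independence along u is inherited.
  let ψ : corner θ Z →ₗ[E] corner θ (M →₀ B) :=
    { toFun := fun z => ⟨z.1.1, congrArg Subtype.val z.2⟩
      map_add' := fun _ _ => rfl
      map_smul' := fun _ _ => rfl }
  have hψ : Function.Injective ψ := fun z w hzw =>
    Subtype.ext (Subtype.ext (congrArg (fun t : corner θ (M →₀ B) => (t : M →₀ B)) hzw))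
  have hZ : Module.Projective E (corner θ Z) := by
    have := hE _ (LinearMap.range ψ)
    exact Module.Projective.of_equiv' (LinearEquiv.ofInjective ψ hψ).symm
  refine h.pdLT_add_one_of_projective_corner φ hφ hker hB' Z fun x hx => ?_
  have h0 := h.indep_finsupp M (fun i => ψ (x i)) (by
    have := congrArg Z.subtype hx
    rw [map_sum, map_zero] at this
    exact this)
  funext i
  exact hψ ((congrFun h0 i).trans (map_zero ψ).symm)

theorem mem_trace_self {b : B} : b ∈ h.trace B ↔ ∃ y : ι → B, ∑ i, u i * (θ 1 * y i) = b := by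
  constructor
  · rintro ⟨x, rfl⟩
    exact ⟨fun i => x i, Finset.sum_congr rfl fun i _ => congrArg (u i * ·) (x i).2⟩
  · rintro ⟨y, rfl⟩
    exact ⟨fun i => ⟨θ 1 * y i, smul_mem_corner θ 1 (y i)⟩, rfl⟩

omit h [Fintype ι] in
-- If r s r = r, then θ (s r) is an idempotent in the radical, hence zero, and it determines θ r.
theorem eq_zero_of_mem_jacobson (hE : ∀ r : E, ∃ s, r * s * r = r) {r : E}
    (hr : θ r ∈ Ring.jacobson B) : θ r = 0 := by
  obtain ⟨s, hs⟩ := hE r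
  have hf : θ s * θ r ∈ Ring.jacobson B := Ideal.mul_mem_left _ _ hr
  rw [← Ideal.jacobson_bot, Ideal.mem_jacobson_iff] at hf
  -- With f = θ s * θ r this says z (1 - f) = 1; multiplying by the idempotent f on the right kills
  -- the left side.
  obtain ⟨z, hz⟩ := hf (-1)
  have hidem : θ s * θ r * (θ s * θ r) = θ s * θ r := by
    rw [← map_mul, ← map_mul, mul_assoc, ← mul_assoc r, hs]
  have h0 : (z * -1 * (θ s * θ r) + z - 1) * (θ s * θ r) = 0 := by
    rw [Ideal.mem_bot.mp hz, zero_mul]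
  rw [sub_mul, add_mul, mul_assoc _ _ (θ s * θ r), hidem, one_mul, mul_neg_one, neg_mul,
    neg_add_cancel, zero_sub, neg_eq_zero] at h0
  rw [← hs, map_mul, map_mul, mul_assoc, h0, mul_zero]

/-- All four properties come from BeB = ⊕ u i * eB. For the radical N, eNe is the part of N in the
corner, which vanishes because E is von Neumann regular. -/
theorem isHeredityIdeal [Module.Projective E (corner θ B)] (hE : ∀ r : E, ∃ s, r * s * r = r)
    (L : TwoSidedIdeal B) (hL : ∀ b, b ∈ L ↔ b ∈ h.trace B) : IsHeredityIdeal L := by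
  have hone : θ 1 ∈ L := (hL _).mpr (by
    have := h.smul_mem_trace 1 (1 : B)
    rwa [smul_eq_mul, mul_one] at this)
  have hu : ∀ i, u i ∈ L := fun i => by
    rw [← h.mul_idem i]
    exact L.mul_mem_left _ _ hone
  refine ⟨?_, ?_, ?_, ?_⟩
  · apply le_antisymm
    · rw [TwoSidedIdeal.span_le]
      rintro _ ⟨x, hx, y, -, rfl⟩
      exact L.mul_mem_right _ _ hx
    · intro x hx
      obtain ⟨y, rfl⟩ := h.mem_trace_self.mp ((hL x).mp hx)
      exact sum_mem fun i _ => TwoSidedIdeal.subset_span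
        ⟨u i, hu i, θ 1 * y i, L.mul_mem_right _ _ hone, rfl⟩
  · intro x hx r hr y hy
    obtain ⟨a, rfl⟩ := h.mem_trace_self.mp ((hL x).mp hx)
    obtain ⟨b, rfl⟩ := h.mem_trace_self.mp ((hL y).mp hy)
    rw [Finset.sum_mul, Finset.sum_mul]
    refine Finset.sum_eq_zero fun i _ => ?_
    rw [Finset.mul_sum]
    refine Finset.sum_eq_zero fun j _ => ?_
    have hz : θ 1 * (a i * r * u j) * θ 1 = 0 := by
      obtain ⟨s, hs⟩ := h.corner_mem (a i * r * u j)
      rw [hs]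
      apply eq_zero_of_mem_jacobson hE
      rw [← hs]
      exact Ideal.mul_mem_right _ _ (Ideal.mul_mem_left _ _
        (Ideal.mul_mem_right _ _ (Ideal.mul_mem_left _ _ hr)))
    calc u i * (θ 1 * a i) * r * (u j * (θ 1 * b j))
        = u i * (θ 1 * (a i * r * u j) * θ 1) * b j := by simp only [mul_assoc]
      _ = 0 := by rw [hz, mul_zero, zero_mul]
  · have := h.projective_trace h.indep_self
    exact Module.Projective.of_equiv' (M := h.trace B)
      { toFun := fun x => ⟨x.1, (hL x.1).mpr x.2⟩
        invFun := fun x => ⟨x.1, (hL x.1).mp x.2⟩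
        map_add' := fun _ _ => rfl
        map_smul' := fun _ _ => rfl
        left_inv := fun _ => rfl
        right_inv := fun _ => rfl }
  · choose y hy using fun x : L => h.mem_trace_self.mp ((hL x).mp x.2)
    have huniq : ∀ (x : L) (z : ι → B), ∑ i, u i * (θ 1 * z i) = x →
        ∀ i, θ 1 * y x i = θ 1 * z i := by
      intro x z hz i
      rw [← sub_eq_zero, ← mul_sub]
      exact h.indep (fun i => y x i - z i) (by
        simp only [mul_sub, Finset.sum_sub_distrib, hy, hz, sub_self]) i
    -- As a right module L is a sum of copies of eB, each a direct summand of B: σ takes coordinates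
    -- and τ multiplies back by the basis.
    let σ : L →ₗ[Bᵐᵒᵖ] (ι → Bᵐᵒᵖ) :=
      { toFun := fun x i => MulOpposite.op (θ 1 * y x i)
        map_add' := fun x x' => by
          funext i
          rw [huniq (x + x') (fun i => y x i + y x' i) (by
            simp only [mul_add, Finset.sum_add_distrib, hy]
            rfl)]
          simp [mul_add]
        map_smul' := fun b x => by
          funext i
          rw [huniq (b • x) (fun i => y x i * b.unop) (by
            simp only [← mul_assoc, ← Finset.sum_mul]
            simp only [mul_assoc, hy]
            rfl)]
          simp [mul_assoc] }
    let τ : (ι → Bᵐᵒᵖ) →ₗ[Bᵐᵒᵖ] L :=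
      { toFun := fun z => ⟨∑ i, u i * (z i).unop, sum_mem fun i _ => L.mul_mem_right _ _ (hu i)⟩
        map_add' := fun z w => by
          apply Subtype.ext
          change _ = (∑ i, u i * (z i).unop) + ∑ i, u i * (w i).unop
          simp [mul_add, Finset.sum_add_distrib]
        map_smul' := fun b z => by
          apply Subtype.ext
          change _ = (∑ i, u i * (z i).unop) * b.unop
          simp [Finset.sum_mul, mul_assoc] }
    refine Module.Projective.of_split σ τ ?_
    ext x
    exact hy x

end IsCornerBasis

end Corner

end Koenig

namespace Koenig

/-! ### König's order as a ring of matrices over the fraction ring -/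

section Order

variable {O : Type u} [CommRing O]

/-- The condition `c R ⊆ S`. -/
def Conducts (R S : Subalgebra O (FractionRing O)) (c : FractionRing O) : Prop :=
  ∀ x ∈ R, c * x ∈ S

theorem Conducts.mem {R S : Subalgebra O (FractionRing O)} {c : FractionRing O}
    (h : Conducts R S c) : c ∈ S := by
  simpa using h 1 R.one_mem

theorem Conducts.zero (R S : Subalgebra O (FractionRing O)) : Conducts R S 0 := fun x _ => by
  rw [zero_mul]
  exact S.zero_mem

theorem Conducts.add {R S : Subalgebra O (FractionRing O)} {c d : FractionRing O}
    (hc : Conducts R S c) (hd : Conducts R S d) : Conducts R S (c + d) := fun x hx => by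
  rw [add_mul]
  exact S.add_mem (hc x hx) (hd x hx)

theorem Conducts.mul {R S T : Subalgebra O (FractionRing O)} {c d : FractionRing O}
    (hc : Conducts R S c) (hd : Conducts S T d) : Conducts R T (c * d) := fun x hx => by
  rw [mul_comm c, mul_assoc]
  exact hd _ (hc x hx)

theorem Conducts.of_le_of_mem {R S : Subalgebra O (FractionRing O)} (h : R ≤ S) {c : FractionRing O}
    (hc : c ∈ S) : Conducts R S c := fun _ hx => S.mul_mem hc (h hx)

theorem Conducts.sum {R S : Subalgebra O (FractionRing O)} {ι : Type*} {s : Finset ι}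
    {c : ι → FractionRing O} (hc : ∀ i ∈ s, Conducts R S (c i)) : Conducts R S (∑ i ∈ s, c i) :=
  fun x hx => by
    rw [Finset.sum_mul]
    exact sum_mem fun i hi => hc i hi x hx

theorem le_sharp (R : Subalgebra O (FractionRing O)) : R ≤ sharp R := fun x hx a ha =>
  ⟨⟨x, hx⟩ * a, Ideal.mul_mem_left _ _ ha, rfl⟩

variable (O) in
theorem overring_mono : Monotone (overring O) :=
  monotone_nat_of_le_succ fun i => le_sharp (overring O i)

/-- Clear the denominator of x: s x = y · 1 with s, y in O and s invertible in K, so linearity over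
O determines f x. -/
theorem linearMap_apply_eq_mul {R : Subalgebra O (FractionRing O)} (f : R →ₗ[O] FractionRing O)
    (x : R) : f x = x * f 1 := by
  obtain ⟨⟨y, s⟩, hs⟩ := IsLocalization.surj (nonZeroDivisors O) (x : FractionRing O)
  have hu := IsLocalization.map_units (FractionRing O) s
  apply hu.mul_left_cancel
  have h1 : (s : O) • x = y • (1 : R) := Subtype.ext (by
    simpa [Algebra.smul_def, mul_comm] using hs)
  have h2 := congrArg f h1
  rw [map_smul, map_smul, Algebra.smul_def, Algebra.smul_def] at h2
  rw [h2, ← mul_assoc, mul_comm (algebraMap O (FractionRing O) s), hs]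

variable {n : ℕ}

/-- The endomorphism underlying an element of König's order. -/
def KoenigOrder.toEnd (a : KoenigOrder O n) :
    Module.End O ((i : Fin (n + 1)) → overring O i) :=
  MulOpposite.unop (α := Module.End O ((i : Fin (n + 1)) → overring O i)) a

/-- The entry of an element of König's order in position `(i, j)`: the element of the total ring of
fractions by which its component from `O_i` to `O_j` multiplies. -/
def KoenigOrder.entry (a : KoenigOrder O n) (i j : Fin (n + 1)) : FractionRing O :=
  ((a.toEnd (Pi.single i 1)) j : FractionRing O)

theorem KoenigOrder.toEnd_single (a : KoenigOrder O n) (i j : Fin (n + 1)) (x : overring O i) :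
    ((a.toEnd (Pi.single i x) j : overring O j) : FractionRing O) = x * a.entry i j :=
  linearMap_apply_eq_mul ((overring O j).val.toLinearMap ∘ₗ LinearMap.proj j ∘ₗ a.toEnd ∘ₗ
    LinearMap.single O (fun j : Fin (n + 1) => overring O j) i) x

theorem KoenigOrder.toEnd_apply (a : KoenigOrder O n) (v : (i : Fin (n + 1)) → overring O i)
    (j : Fin (n + 1)) :
    ((a.toEnd v j : overring O j) : FractionRing O) = ∑ i, (v i : FractionRing O) * a.entry i j := by
  conv_lhs => rw [← Finset.univ_sum_single v]
  rw [map_sum, Finset.sum_apply, AddSubmonoidClass.coe_finsetSum]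
  exact Finset.sum_congr rfl fun i _ => a.toEnd_single i j (v i)

theorem KoenigOrder.conducts_entry (a : KoenigOrder O n) (i j : Fin (n + 1)) :
    Conducts (overring O i) (overring O j) (a.entry i j) := fun x hx => by
  rw [mul_comm, ← a.toEnd_single i j ⟨x, hx⟩]
  exact Subtype.property _

theorem KoenigOrder.ext {a b : KoenigOrder O n} (h : ∀ i j, a.entry i j = b.entry i j) : a = b := by
  apply MulOpposite.unop_injective
  refine LinearMap.ext fun v => funext fun j => Subtype.ext ?_
  refine (a.toEnd_apply v j).trans (Eq.trans ?_ (b.toEnd_apply v j).symm)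
  simp only [h]

/-- The product is that of the opposite ring, a first and then b, which is why entries multiply in
the usual matrix order. -/
theorem KoenigOrder.entry_mul (a b : KoenigOrder O n) (i j : Fin (n + 1)) :
    (a * b).entry i j = ∑ l, a.entry i l * b.entry l j :=
  b.toEnd_apply (a.toEnd (Pi.single i 1)) j

theorem KoenigOrder.entry_add (a b : KoenigOrder O n) (i j : Fin (n + 1)) :
    (a + b).entry i j = a.entry i j + b.entry i j := rfl

theorem KoenigOrder.entry_zero (i j : Fin (n + 1)) :
    (0 : KoenigOrder O n).entry i j = 0 := rfl

theorem KoenigOrder.entry_neg (a : KoenigOrder O n) (i j : Fin (n + 1)) :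
    (-a).entry i j = -a.entry i j := rfl

theorem KoenigOrder.entry_sub (a b : KoenigOrder O n) (i j : Fin (n + 1)) :
    (a - b).entry i j = a.entry i j - b.entry i j := rfl

theorem KoenigOrder.entry_one (i j : Fin (n + 1)) :
    (1 : KoenigOrder O n).entry i j = if i = j then 1 else 0 := by
  change (((Pi.single i 1 : (i : Fin (n + 1)) → overring O i) j : overring O j) : FractionRing O) = _
  rcases eq_or_ne i j with rfl | h
  · simp
  · rw [Pi.single_eq_of_ne h.symm, if_neg h]
    rfl

theorem KoenigOrder.entry_sum {ι : Type*} (s : Finset ι) (a : ι → KoenigOrder O n)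
    (i j : Fin (n + 1)) : (∑ t ∈ s, a t).entry i j = ∑ t ∈ s, (a t).entry i j :=
  map_sum (⟨⟨fun a => a.entry i j, rfl⟩, fun _ _ => rfl⟩ : KoenigOrder O n →+ FractionRing O) a s

/-- The element of König's order with prescribed entries. -/
noncomputable def KoenigOrder.mk (X : Fin (n + 1) → Fin (n + 1) → FractionRing O)
    (hX : ∀ i j : Fin (n + 1), Conducts (overring O i) (overring O j) (X i j)) : KoenigOrder O n :=
  MulOpposite.op (α := Module.End O ((i : Fin (n + 1)) → overring O i))
    { toFun := fun v j => ⟨∑ i, X i j * v i, sum_mem fun i _ => hX i j _ (v i).2⟩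
      map_add' := fun v w => by
        funext j
        apply Subtype.ext
        simp [mul_add, Finset.sum_add_distrib]
      map_smul' := fun r v => by
        funext j
        apply Subtype.ext
        simp [Finset.smul_sum] }

theorem KoenigOrder.entry_mk (X : Fin (n + 1) → Fin (n + 1) → FractionRing O)
    (hX : ∀ i j : Fin (n + 1), Conducts (overring O i) (overring O j) (X i j)) (i j : Fin (n + 1)) :
    (KoenigOrder.mk X hX).entry i j = X i j := by
  change ∑ l, X l j * (((Pi.single i 1 : (i : Fin (n + 1)) → overring O i) l : overring O l) :
    FractionRing O) = _
  rw [Finset.sum_eq_single i]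
  · simp
  · intro l _ hl
    rw [Pi.single_eq_of_ne hl]
    exact mul_zero _
  · simp

/-- The element of König's order with a single nonzero entry. -/
noncomputable def KoenigOrder.unit (i j : Fin (n + 1)) (c : FractionRing O)
    (hc : Conducts (overring O i) (overring O j) c) : KoenigOrder O n :=
  KoenigOrder.mk (fun i' j' => if i = i' ∧ j = j' then c else 0) fun i' j' => by
    split_ifs with h
    · obtain ⟨rfl, rfl⟩ := h
      exact hc
    · exact Conducts.zero _ _

theorem KoenigOrder.entry_unit (i j : Fin (n + 1)) (c : FractionRing O)
    (hc : Conducts (overring O i) (overring O j) c) (i' j' : Fin (n + 1)) :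
    (KoenigOrder.unit i j c hc).entry i' j' = if i = i' ∧ j = j' then c else 0 :=
  KoenigOrder.entry_mk _ _ i' j'

theorem KoenigOrder.entry_unit_mul (i j : Fin (n + 1)) (c : FractionRing O)
    (hc : Conducts (overring O i) (overring O j) c) (a : KoenigOrder O n) (i' j' : Fin (n + 1)) :
    (KoenigOrder.unit i j c hc * a).entry i' j' = if i = i' then c * a.entry j j' else 0 := by
  rw [KoenigOrder.entry_mul]
  simp only [KoenigOrder.entry_unit, ite_and]
  split_ifs with h
  · simp
  · simp

theorem KoenigOrder.entry_mul_unit (i j : Fin (n + 1)) (c : FractionRing O)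
    (hc : Conducts (overring O i) (overring O j) c) (a : KoenigOrder O n) (i' j' : Fin (n + 1)) :
    (a * KoenigOrder.unit i j c hc).entry i' j' = if j = j' then a.entry i' i * c else 0 := by
  rw [KoenigOrder.entry_mul]
  simp only [KoenigOrder.entry_unit, ite_and]
  simp

theorem KoenigOrder.entry_stdIdempotent (l i j : Fin (n + 1)) :
    (stdIdempotent O n l).entry i j = if l = i ∧ l = j then 1 else 0 := by
  change (((Pi.single l ((Pi.single i 1 : (i : Fin (n + 1)) → overring O i) l) :
    (i : Fin (n + 1)) → overring O i) j : overring O j) : FractionRing O) = _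
  rcases eq_or_ne l i with rfl | hi
  · rcases eq_or_ne l j with rfl | hj
    · simp
    · rw [Pi.single_eq_of_ne hj.symm, if_neg fun h => hj h.2]
      rfl
  · rw [Pi.single_eq_of_ne hi, if_neg fun h => hi h.1, Pi.single_zero]
    rfl

theorem entry_sum_stdIdempotent (k : ℕ) (i j : Fin (n + 1)) :
    (∑ l ∈ Finset.univ.filter (fun i : Fin (n + 1) => k ≤ (i : ℕ)), stdIdempotent O n l).entry i j =
      if k ≤ (i : ℕ) ∧ i = j then 1 else 0 := by
  rw [KoenigOrder.entry_sum]
  simp only [KoenigOrder.entry_stdIdempotent, ite_and]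
  rw [Finset.sum_ite_eq']
  simp

/-- The ideal `J_k` in terms of entries. -/
theorem mem_koenigIdeal {k : ℕ} (hk : k ≤ n) {a : KoenigOrder O n} :
    a ∈ koenigIdeal O n k ↔
      ∀ i : Fin (n + 1), (i : ℕ) < k → ∀ j : Fin (n + 1),
        Conducts (overring O k) (overring O j) (a.entry i j) := by
  constructor
  · let J : TwoSidedIdeal (KoenigOrder O n) := TwoSidedIdeal.mk'
      {a | ∀ i : Fin (n + 1), (i : ℕ) < k → ∀ j : Fin (n + 1),
        Conducts (overring O k) (overring O j) (a.entry i j)}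
      (fun i _ j => Conducts.zero _ _) (fun ha hb i hi j => (ha i hi j).add (hb i hi j))
      (fun {a} ha i hi j x hx => by
        rw [KoenigOrder.entry_neg, neg_mul]
        exact neg_mem (ha i hi j x hx))
      (fun {a b} hb i hi j => by
        rw [KoenigOrder.entry_mul]
        refine Conducts.sum fun l _ => ?_
        -- For l < k the entry of a lies in O_l ⊆ O_k and the condition on b applies. For l ≥ k the
        -- entry of a already maps O_k into O_l.
        rcases lt_or_ge (l : ℕ) k with hl | hl
        · exact (Conducts.of_le_of_mem le_rfl
            (overring_mono O hl.le (a.conducts_entry i l).mem)).mul (hb l hl j)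
        · exact (Conducts.of_le_of_mem (overring_mono O hl) (a.conducts_entry i l).mem).mul
            (b.conducts_entry l j))
      (fun {a b} ha i hi j => by
        rw [KoenigOrder.entry_mul]
        exact Conducts.sum fun l _ => (ha i hi l).mul (b.conducts_entry l j))
    have hJ : koenigIdeal O n k ≤ J := by
      rw [koenigIdeal, TwoSidedIdeal.span_le]
      rintro _ rfl
      refine (TwoSidedIdeal.mem_mk' _ _ _ _ _ _ _).mpr fun i hi j => ?_
      rw [entry_sum_stdIdempotent, if_neg fun h => absurd h.1 (not_le.mpr hi)]
      exact Conducts.zero _ _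
    intro ha
    exact (TwoSidedIdeal.mem_mk' _ _ _ _ _ _ a).mp (hJ ha)
  · intro ha
    let ε : KoenigOrder O n :=
      ∑ l ∈ Finset.univ.filter (fun i : Fin (n + 1) => k ≤ (i : ℕ)), stdIdempotent O n l
    have hε : ε ∈ koenigIdeal O n k := TwoSidedIdeal.subset_span rfl
    let κ : Fin (n + 1) := ⟨k, Nat.lt_succ_of_le hk⟩
    have hrow : ∀ i : Fin (n + 1), ∀ j : Fin (n + 1), Conducts (overring O κ) (overring O j)
        (if (i : ℕ) < k then a.entry i j else 0) := fun i j => by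
      split_ifs with h
      · exact ha i h j
      · exact Conducts.zero _ _
    have hunit : ∀ i : Fin (n + 1), Conducts (overring O i) (overring O κ)
        (if (i : ℕ) < k then 1 else 0) := fun i => by
      split_ifs with h
      · exact Conducts.of_le_of_mem (overring_mono O h.le) (one_mem _)
      · exact Conducts.zero _ _
    -- The rows from k on form ε * a. Each row i < k factors as the inclusion of O_i into O_k
    -- followed by the extended row, which starts at k and is therefore fixed by ε.
    have hdec : a = ε * a + ∑ i, KoenigOrder.unit i κ _ (hunit i) * (ε *
        KoenigOrder.mk (fun i' j => if i' = κ then (if (i : ℕ) < k then a.entry i j else 0) else 0)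
          (fun i' (j : Fin (n + 1)) => by
            split_ifs with h h'
            · rw [h]
              exact ha i h' j
            · exact Conducts.zero _ _
            · exact Conducts.zero _ _)) := by
      apply KoenigOrder.ext
      intro i j
      have hεmul : ∀ (b : KoenigOrder O n) i j,
          (ε * b).entry i j = if k ≤ (i : ℕ) then b.entry i j else 0 := by
        intro b i j
        rw [KoenigOrder.entry_mul]
        simp only [ε, entry_sum_stdIdempotent, ite_and]
        split_ifs <;> simp
      rw [KoenigOrder.entry_add, hεmul, KoenigOrder.entry_sum]
      simp only [KoenigOrder.entry_unit_mul, hεmul, KoenigOrder.entry_mk]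
      rcases lt_or_ge (i : ℕ) k with hi | hi
      · simp [hi, κ, not_le.mpr hi]
      · simp [hi, not_lt.mpr hi]
    rw [hdec]
    exact add_mem (TwoSidedIdeal.mul_mem_right _ _ _ hε)
      (sum_mem fun i _ => TwoSidedIdeal.mul_mem_left _ _ _ (TwoSidedIdeal.mul_mem_right _ _ _ hε))

theorem koenigIdeal_zero : koenigIdeal O n 0 = ⊤ := by
  rw [eq_top_iff]
  intro a _
  exact (mem_koenigIdeal (Nat.zero_le n)).mpr fun i hi => absurd hi (Nat.not_lt_zero _)

theorem koenigIdeal_self : koenigIdeal O n n = koenigKernel O n := by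
  rw [koenigIdeal, koenigKernel]
  congr 2
  have : Finset.univ.filter (fun i : Fin (n + 1) => n ≤ (i : ℕ)) = {Fin.last n} := by
    ext i
    rw [Finset.mem_filter_univ, Finset.mem_singleton, Fin.ext_iff, Fin.val_last]
    have := i.2
    omega
  rw [this, Finset.sum_singleton]

end Order

end Koenig

namespace Koenig

/-! ### Corner bases in the quotients of König's order -/

section Quotients

variable {O : Type u} [CommRing O] {n : ℕ}

/-- The embedding of `O_k` into the corner of König's order at the idempotent `e_k`. -/
noncomputable def KoenigOrder.diag (k : Fin (n + 1)) : overring O k →ₙ+* KoenigOrder O n where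
  toFun r := KoenigOrder.unit k k r (Conducts.of_le_of_mem le_rfl r.2)
  map_mul' r s := KoenigOrder.ext fun i j => by
    rw [KoenigOrder.entry_unit_mul]
    simp only [KoenigOrder.entry_unit]
    split_ifs <;> simp_all
  map_zero' := KoenigOrder.ext fun i j => by
    rw [KoenigOrder.entry_unit, KoenigOrder.entry_zero]
    split_ifs <;> rfl
  map_add' r s := KoenigOrder.ext fun i j => by
    rw [KoenigOrder.entry_add]
    simp only [KoenigOrder.entry_unit]
    split_ifs <;> simp

theorem KoenigOrder.entry_diag (k : Fin (n + 1)) (r : overring O k) (i j : Fin (n + 1)) :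
    (KoenigOrder.diag k r).entry i j = if k = i ∧ k = j then (r : FractionRing O) else 0 :=
  KoenigOrder.entry_unit k k _ (Conducts.of_le_of_mem le_rfl r.2) i j

theorem KoenigOrder.entry_diag_mul (k : Fin (n + 1)) (r : overring O k) (a : KoenigOrder O n)
    (i j : Fin (n + 1)) :
    (KoenigOrder.diag k r * a).entry i j = if k = i then (r : FractionRing O) * a.entry k j else 0 :=
  KoenigOrder.entry_unit_mul k k _ (Conducts.of_le_of_mem le_rfl r.2) a i j

theorem KoenigOrder.entry_mul_diag (k : Fin (n + 1)) (r : overring O k) (a : KoenigOrder O n)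
    (i j : Fin (n + 1)) :
    (a * KoenigOrder.diag k r).entry i j = if k = j then a.entry i k * (r : FractionRing O) else 0 :=
  KoenigOrder.entry_mul_unit k k _ (Conducts.of_le_of_mem le_rfl r.2) a i j

/-- The inclusion of `O_i` into `O_k`, as an element of König's order. -/
noncomputable def KoenigOrder.incl (k : Fin (n + 1)) (i : {i : Fin (n + 1) // i ≤ k}) :
    KoenigOrder O n :=
  KoenigOrder.unit i k 1 (Conducts.of_le_of_mem (overring_mono O i.2) (one_mem _))

theorem KoenigOrder.entry_incl_mul (k : Fin (n + 1)) (i : {i : Fin (n + 1) // i ≤ k})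
    (a : KoenigOrder O n) (i' j : Fin (n + 1)) :
    (KoenigOrder.incl k i * a).entry i' j = if i.1 = i' then a.entry k j else 0 := by
  rw [KoenigOrder.incl, KoenigOrder.entry_unit_mul, one_mul]

theorem KoenigOrder.entry_sum_incl_mul (k : Fin (n + 1))
    (a : {i : Fin (n + 1) // i ≤ k} → KoenigOrder O n) (i : {i : Fin (n + 1) // i ≤ k})
    (j : Fin (n + 1)) :
    (∑ l, KoenigOrder.incl k l * a l).entry i j = (a i).entry k j := by
  rw [KoenigOrder.entry_sum]
  simp only [KoenigOrder.entry_incl_mul, Subtype.coe_inj]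
  simp

/-- A quotient of König's order, with the corner at `e_k` written as a quotient `E` of `O_k`, whose
kernel consists of the elements with entries in rows `i ≤ k` satisfying a condition
independent of `i`. -/
structure CornerQuotient (k : Fin (n + 1)) {B E : Type u} [Ring B] [Ring E]
    (π : KoenigOrder O n →+* B) (ρ : overring O k →+* E)
    (P : Fin (n + 1) → FractionRing O → Prop) : Prop where
  zero (j : Fin (n + 1)) : P j 0
  surjective : Function.Surjective π
  eq_zero_iff (a : KoenigOrder O n) : π a = 0 ↔ ∀ i ≤ k, ∀ j, P j (a.entry i j)
  surjective_corner : Function.Surjective ρ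
  corner_eq_zero_iff (r : overring O k) : ρ r = 0 ↔ P k r

namespace CornerQuotient

variable {k : Fin (n + 1)} {B E : Type u} [Ring B] [Ring E] {π : KoenigOrder O n →+* B}
    {ρ : overring O k →+* E} {P : Fin (n + 1) → FractionRing O → Prop}

theorem exists_cornerHom (h : CornerQuotient k π ρ P) :
    ∃ θ : E →ₙ+* B, ∀ r, θ (ρ r) = π (KoenigOrder.diag k r) := by
  have hker : ∀ r, ρ r = 0 → π (KoenigOrder.diag k r) = 0 := by
    intro r hr
    rw [h.eq_zero_iff]
    intro i _ j
    rw [KoenigOrder.entry_diag]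
    split_ifs with hij
    · rw [← hij.2]
      exact (h.corner_eq_zero_iff r).mp hr
    · exact h.zero j
  have hwd : ∀ r s, ρ r = ρ s → π (KoenigOrder.diag k r) = π (KoenigOrder.diag k s) := by
    intro r s hrs
    rw [← sub_eq_zero, ← map_sub, ← map_sub]
    exact hker _ (by rw [map_sub, hrs, sub_self])
  choose σ hσ using h.surjective_corner
  refine ⟨{ toFun := fun x => π (KoenigOrder.diag k (σ x)), map_mul' := ?_, map_zero' := ?_,
            map_add' := ?_ }, fun r => hwd _ _ (hσ _)⟩
  · intro x y
    rw [← map_mul, ← map_mul]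
    exact hwd _ _ (by rw [map_mul, hσ, hσ, hσ])
  · exact hker _ (hσ 0)
  · intro x y
    rw [← map_add, ← map_add]
    exact hwd _ _ (by rw [map_add, hσ, hσ, hσ])

/-- For i ≤ k column i of a matrix has entries in O_i ⊆ O_k, so multiplying the inclusion of O_i by
it gives a combination of the inclusions. Left multiplication by an inclusion copies row k into row
i, and vanishing is tested by the same P in every row; this gives independence. -/
theorem isCornerBasis (h : CornerQuotient k π ρ P) {θ : E →ₙ+* B}
    (hθ : ∀ r, θ (ρ r) = π (KoenigOrder.diag k r)) :
    IsCornerBasis θ fun i => π (KoenigOrder.incl k i) := by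
  have hone : θ 1 = π (KoenigOrder.diag k 1) := by rw [← hθ, map_one ρ]
  have hincl : ∀ i, KoenigOrder.incl (O := O) k i * KoenigOrder.diag k 1 = KoenigOrder.incl k i := by
    intro i
    apply KoenigOrder.ext
    intro i' j
    rw [KoenigOrder.entry_incl_mul, KoenigOrder.entry_diag, KoenigOrder.incl,
      KoenigOrder.entry_unit]
    simp [ite_and]
  refine ⟨fun i => ?_, ⟨⟨k, le_rfl⟩, ?_⟩, fun b i => ?_, fun y hy i => ?_, fun b => ?_⟩
  · rw [hone, ← map_mul, hincl]
  · rw [hone]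
    rfl
  · obtain ⟨a, rfl⟩ := h.surjective b
    let r : {i : Fin (n + 1) // i ≤ k} → overring O k := fun j =>
      ⟨a.entry j i, overring_mono O i.2 (a.conducts_entry j i).mem⟩
    refine ⟨fun j => ρ (r j), ?_⟩
    simp only [hθ, ← map_mul, ← map_sum]
    rw [← sub_eq_zero, ← map_sub, h.eq_zero_iff]
    intro i' hi' j
    rw [KoenigOrder.entry_sub, KoenigOrder.entry_sum_incl_mul k _ ⟨i', hi'⟩, KoenigOrder.incl,
      KoenigOrder.entry_mul_unit, KoenigOrder.entry_diag]
    convert h.zero j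
    split_ifs <;> simp_all [r]
  · choose a ha using fun i => h.surjective (y i)
    simp only [hone, ← ha, ← map_mul, ← map_sum] at hy ⊢
    rw [h.eq_zero_iff] at hy ⊢
    intro i' _ j
    have h1 := hy i.1 i.2 j
    rw [KoenigOrder.entry_sum_incl_mul, KoenigOrder.entry_diag_mul, if_pos rfl] at h1
    rw [KoenigOrder.entry_diag_mul]
    split_ifs
    · exact h1
    · exact h.zero j
  · obtain ⟨a, rfl⟩ := h.surjective b
    refine ⟨ρ ⟨a.entry k k, (a.conducts_entry k k).mem⟩, ?_⟩
    rw [hone, hθ, ← map_mul, ← map_mul]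
    congr 1
    apply KoenigOrder.ext
    intro i j
    rw [KoenigOrder.entry_mul_diag, KoenigOrder.entry_diag_mul, KoenigOrder.entry_diag]
    rcases eq_or_ne k i with rfl | hi
    · rcases eq_or_ne k j with rfl | hj
      · simp
      · simp [hj]
    · simp [hi]

/-- Identifies B e B with the image of J_k, so that the successive quotients of the chain are
exactly the traces of the corners. -/
theorem mem_trace_iff (h : CornerQuotient k π ρ P) {θ : E →ₙ+* B}
    (hθ : ∀ r, θ (ρ r) = π (KoenigOrder.diag k r)) (b : B) :
    b ∈ (h.isCornerBasis hθ).trace B ↔ ∃ a ∈ koenigIdeal O n k, π a = b := by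
  have hone : θ 1 = π (KoenigOrder.diag k 1) := by rw [← hθ, map_one ρ]
  have hkn : (k : ℕ) ≤ n := Nat.le_of_lt_succ k.2
  rw [IsCornerBasis.mem_trace_self]
  constructor
  · rintro ⟨y, rfl⟩
    choose a ha using fun i => h.surjective (y i)
    refine ⟨∑ i, KoenigOrder.incl k i * (KoenigOrder.diag k 1 * a i), ?_, by simp [ha, hone]⟩
    rw [mem_koenigIdeal hkn]
    intro i hi j
    rw [KoenigOrder.entry_sum_incl_mul k _ ⟨i, hi.le⟩]
    exact KoenigOrder.conducts_entry _ k j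
  · rintro ⟨a, ha, rfl⟩
    rw [mem_koenigIdeal hkn] at ha
    -- Row i of a is moved to row k; for i < k membership in J_k is exactly what permits it to start
    -- at O_k.
    have hrow : ∀ i : Fin (n + 1), i ≤ k → ∀ i' j : Fin (n + 1), Conducts (overring O i')
        (overring O j) (if i' = k then a.entry i j else 0) := by
      intro i hi i' j
      split_ifs with hik
      · rw [hik]
        rcases eq_or_lt_of_le hi with rfl | hlt
        · exact a.conducts_entry i j
        · exact ha i hlt j
      · exact Conducts.zero _ _
    refine ⟨fun i => π (KoenigOrder.mk _ (hrow i.1 i.2)), ?_⟩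
    simp only [hone, ← map_mul, ← map_sum]
    rw [← sub_eq_zero, ← map_sub, h.eq_zero_iff]
    intro i hi j
    rw [KoenigOrder.entry_sub, KoenigOrder.entry_sum_incl_mul k _ ⟨i, hi⟩,
      KoenigOrder.entry_diag_mul, if_pos rfl, KoenigOrder.entry_mk, if_pos rfl]
    simpa using h.zero j

end CornerQuotient

/-- The quotient `A / J_{k+1}` for `k < n`. -/
theorem cornerQuotient_of_ker {k : Fin (n + 1)} (hk : (k : ℕ) < n) {B E : Type u} [Ring B] [Ring E]
    {π : KoenigOrder O n →+* B} (hπ : Function.Surjective π)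
    (hker : ∀ a, π a = 0 ↔ a ∈ koenigIdeal O n (k + 1))
    {ρ : overring O k →+* E} (hρ : Function.Surjective ρ)
    (hρker : ∀ r, ρ r = 0 ↔ Conducts (overring O (k + 1)) (overring O k) r) :
    CornerQuotient k π ρ fun j => Conducts (overring O (k + 1)) (overring O j) where
  zero j := Conducts.zero _ _
  surjective := hπ
  eq_zero_iff a := by
    rw [hker, mem_koenigIdeal hk]
    exact ⟨fun h i hi => h i (Nat.lt_succ_of_le hi), fun h i hi => h i (Nat.le_of_lt_succ hi)⟩
  surjective_corner := hρ
  corner_eq_zero_iff := hρker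

/-- Puts A itself in the same form as its quotients, with zero in the role of the next ideal: all
rows survive and the corner is the last overring. -/
theorem cornerQuotient_last :
    CornerQuotient (Fin.last n) (RingHom.id (KoenigOrder O n))
      (RingHom.id (overring O (Fin.last n))) fun _ c => c = 0 where
  zero _ := rfl
  surjective := Function.surjective_id
  eq_zero_iff a := by
    refine ⟨fun h i _ j => ?_, fun h => KoenigOrder.ext fun i j => h i (Fin.le_last i) j⟩
    rw [RingHom.id_apply] at h
    rw [h]
    rfl
  surjective_corner := Function.surjective_id
  corner_eq_zero_iff r := by
    rw [RingHom.id_apply]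
    exact ⟨fun h => by rw [h]; rfl, fun h => Subtype.ext h⟩

end Quotients

end Koenig

/-! ### Von Neumann regularity of semisimple rings, and images of ideals in quotients -/

namespace Koenig

/-- Split 1 = s r + t along a complement N of the left ideal E r. Then r t = r - r s r lies in both
E r and N. -/
theorem exists_mul_mul_eq_of_isSemisimpleRing {E : Type u} [Ring E] [IsSemisimpleRing E] (r : E) :
    ∃ s, r * s * r = r := by
  obtain ⟨N, hN⟩ := exists_isCompl (Ideal.span {r})
  have h1 : (1 : E) ∈ Ideal.span {r} ⊔ N := by
    rw [hN.sup_eq_top]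
    trivial
  obtain ⟨x, hx, t, ht, hxt⟩ := Submodule.mem_sup.mp h1
  obtain ⟨s, rfl⟩ := Ideal.mem_span_singleton'.mp hx
  refine ⟨s, ?_⟩
  have h2 : r * t = r - r * s * r := by
    rw [eq_sub_iff_add_eq, mul_assoc, ← mul_add, add_comm, hxt, mul_one]
  have h3 : r * t ∈ Ideal.span {r} ⊓ N := by
    refine ⟨?_, N.mul_mem_left r ht⟩
    rw [h2]
    exact sub_mem (Ideal.mem_span_singleton_self r)
      (Ideal.mul_mem_left _ _ (Ideal.mem_span_singleton_self r))
  rw [hN.inf_eq_bot, Ideal.mem_bot, h2, sub_eq_zero] at h3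
  exact h3.symm

section Quotient

variable {R : Type u} [Ring R]

theorem mk'_eq_zero_iff (J : TwoSidedIdeal R) (a : R) : J.ringCon.mk' a = 0 ↔ a ∈ J := by
  rw [← map_zero J.ringCon.mk', TwoSidedIdeal.mem_iff]
  exact J.ringCon.eq

theorem mk'_surjective (J : TwoSidedIdeal R) : Function.Surjective J.ringCon.mk' :=
  J.ringCon.mk'_surjective

theorem mem_imageInQuotient {J I : TwoSidedIdeal R} {x : J.ringCon.Quotient} :
    x ∈ imageInQuotient J I ↔ ∃ a ∈ I, J.ringCon.mk' a = x := by
  constructor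
  · intro hx
    refine TwoSidedIdeal.span_induction (p := fun x _ => ∃ a ∈ I, J.ringCon.mk' a = x) ?_
      ⟨0, zero_mem I, map_zero _⟩ ?_ ?_ ?_ ?_ hx
    · rintro _ ⟨a, ha, rfl⟩
      exact ⟨a, ha, rfl⟩
    · rintro _ _ _ _ ⟨a, ha, rfl⟩ ⟨b, hb, rfl⟩
      exact ⟨a + b, add_mem ha hb, map_add _ _ _⟩
    · rintro _ _ ⟨a, ha, rfl⟩
      exact ⟨-a, neg_mem ha, map_neg _ _⟩
    · rintro b _ _ ⟨a, ha, rfl⟩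
      obtain ⟨c, rfl⟩ := mk'_surjective J b
      exact ⟨c * a, I.mul_mem_left _ _ ha, map_mul _ _ _⟩
    · rintro b _ _ ⟨a, ha, rfl⟩
      obtain ⟨c, rfl⟩ := mk'_surjective J b
      exact ⟨a * c, I.mul_mem_right _ _ ha, map_mul _ _ _⟩
  · rintro ⟨a, ha, rfl⟩
    exact TwoSidedIdeal.subset_span ⟨a, ha, rfl⟩

end Quotient

/-! ### The heredity chain and the bounds on projective dimension -/

section Chain

variable {O : Type u} [CommRing O] {n : ℕ}

theorem koenigIdeal_antitone {k l : ℕ} (hkl : k ≤ l) (hl : l ≤ n) :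
    koenigIdeal O n l ≤ koenigIdeal O n k := by
  intro a ha
  rw [mem_koenigIdeal hl] at ha
  rw [mem_koenigIdeal (hkl.trans hl)]
  exact fun i hi j x hx => ha i (hi.trans_le hkl) j x (overring_mono O hkl hx)

variable (O) in
/-- The ideal `(O_k : O_{k+1})` of `O_k`. -/
def conductorIdeal (k : ℕ) : Ideal (overring O k) where
  carrier := {r | Conducts (overring O (k + 1)) (overring O k) r}
  add_mem' hr hs := hr.add hs
  zero_mem' := Conducts.zero _ _
  smul_mem' r s hs := by
    have : Conducts (overring O (k + 1)) (overring O k) ((s : FractionRing O) * r) :=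
      hs.mul (Conducts.of_le_of_mem le_rfl r.2)
    rw [mul_comm] at this
    exact this

theorem cornerQuotient_mk {k : Fin (n + 1)} (hk : (k : ℕ) < n) {B : Type u} [Ring B]
    {π : KoenigOrder O n →+* B} (hπ : Function.Surjective π)
    (hker : ∀ a, π a = 0 ↔ a ∈ koenigIdeal O n (k + 1)) :
    CornerQuotient k π (Ideal.Quotient.mk (conductorIdeal O k))
      fun j => Conducts (overring O (k + 1)) (overring O j) :=
  cornerQuotient_of_ker hk hπ hker Ideal.Quotient.mk_surjective
    fun _ => Ideal.Quotient.eq_zero_iff_mem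

/-- The layers of the chain of ideals are heredity ideals. -/
theorem isHeredityIdeal_of_ker {k : ℕ} (hk : k < n)
    [IsSemisimpleRing (overring O k ⧸ conductorIdeal O k)] {B : Type u} [Ring B]
    {π : KoenigOrder O n →+* B} (hπ : Function.Surjective π)
    (hker : ∀ a, π a = 0 ↔ a ∈ koenigIdeal O n (k + 1)) (L : TwoSidedIdeal B)
    (hL : ∀ b, b ∈ L ↔ ∃ a ∈ koenigIdeal O n k, π a = b) : IsHeredityIdeal L := by
  have h := cornerQuotient_mk (k := ⟨k, hk.trans (Nat.lt_succ_self n)⟩) hk hπ hker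
  obtain ⟨θ, hθ⟩ := h.exists_cornerHom
  have : Module.Projective (overring O k ⧸ conductorIdeal O k) (corner θ B) :=
    Module.projective_of_isSemisimpleRing _ _
  exact (h.isCornerBasis hθ).isHeredityIdeal exists_mul_mul_eq_of_isSemisimpleRing L
    fun b => (hL b).trans (h.mem_trace_iff hθ b).symm

/-- Projective dimensions over the quotients `A / J_{k+1}`. -/
theorem pdLT_of_ker (hss : ∀ k < n, IsSemisimpleRing (overring O k ⧸ conductorIdeal O k))
    (k : ℕ) : ∀ (_ : k < n) {B : Type u} [Ring B] {π : KoenigOrder O n →+* B}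
    (_ : Function.Surjective π) (_ : ∀ a, π a = 0 ↔ a ∈ koenigIdeal O n (k + 1))
    (M : Type u) [AddCommGroup M] [Module B M], PdLT B M (2 * k + 1) := by
  -- The bound is strict, so 2k + 1 stands for projective dimension at most 2k: zero for A/J_1, and
  -- two more at each step.
  induction k with
  | zero =>
    intro hk B _ π hπ hker M _ _
    have := hss 0 hk
    have h := cornerQuotient_mk (k := ⟨0, hk.trans (Nat.lt_succ_self n)⟩) hk hπ hker
    obtain ⟨θ, hθ⟩ := h.exists_cornerHom
    -- For k = 0 only row 0 survives, so the corner is all of B, which is then a quotient of a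
    -- semisimple ring.
    have hone : θ 1 = 1 := by
      rw [← map_one (Ideal.Quotient.mk (conductorIdeal O 0)), hθ, ← sub_eq_zero, ← map_one π,
        ← map_sub, h.eq_zero_iff]
      intro i hi j
      obtain rfl : i = ⟨0, hk.trans (Nat.lt_succ_self n)⟩ :=
        Fin.ext (Nat.le_zero.mp hi)
      rw [KoenigOrder.entry_sub, KoenigOrder.entry_diag, KoenigOrder.entry_one]
      convert Conducts.zero (overring O (0 + 1)) (overring O j) using 1
      rw [sub_eq_zero]
      split_ifs <;> simp_all
    let θ' : (overring O 0 ⧸ conductorIdeal O 0) →+* B :=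
      { θ with map_one' := hone }
    have hθ' : Function.Surjective θ' := fun b => by
      obtain ⟨r, hr⟩ := (h.isCornerBasis hθ).corner_mem b
      rw [hone, one_mul, mul_one] at hr
      exact ⟨r, hr.symm⟩
    have : IsSemisimpleRing B := RingHom.isSemisimpleRing_of_surjective θ' hθ'
    have : Module.Projective B M := Module.projective_of_isSemisimpleRing B M
    exact pdLT_one_of_projective
  | succ k ih =>
    intro hk B _ π hπ hker M _ _
    have := hss (k + 1) hk
    have h := cornerQuotient_mk (k := ⟨k + 1, hk.trans (Nat.lt_succ_self n)⟩) hk hπ hker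
    obtain ⟨θ, hθ⟩ := h.exists_cornerHom
    have : Module.Projective (overring O (k + 1) ⧸ conductorIdeal O (k + 1)) (corner θ B) :=
      Module.projective_of_isSemisimpleRing _ _
    let J := koenigIdeal O n (k + 1)
    have hJ : ∀ a, π a = 0 → J.ringCon.mk' a = 0 := fun a ha =>
      (mk'_eq_zero_iff J a).mpr (koenigIdeal_antitone (Nat.le_succ _) hk ((hker a).mp ha))
    let φ : B →+* J.ringCon.Quotient := RingHom.liftOfRightInverse π (Function.surjInv hπ)
      (Function.rightInverse_surjInv hπ) ⟨J.ringCon.mk', hJ⟩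
    have hφ : ∀ a, φ (π a) = J.ringCon.mk' a := RingHom.liftOfRightInverse_comp_apply _ _ _ _
    refine (h.isCornerBasis hθ).pdLT_add_two (isLeftHereditary_of_isSemisimpleRing _) φ ?_ ?_
      (ih (Nat.lt_of_succ_lt hk) (mk'_surjective J) (mk'_eq_zero_iff J)) M
    · intro c
      obtain ⟨a, rfl⟩ := mk'_surjective J c
      exact ⟨π a, hφ a⟩
    · intro b
      rw [h.mem_trace_iff hθ]
      constructor
      · intro hb
        obtain ⟨a, rfl⟩ := hπ b
        rw [hφ, mk'_eq_zero_iff] at hb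
        exact ⟨a, hb, rfl⟩
      · rintro ⟨a, ha, rfl⟩
        rw [hφ, mk'_eq_zero_iff]
        exact ha

/-- The ideal `(O_j : O_{n+1})` of `O_{n+1}`. -/
def lastConductor (j : Fin (n + 1)) : Ideal (overring O (Fin.last n)) where
  carrier := {r | Conducts (overring O (Fin.last n)) (overring O j) r}
  add_mem' hr hs := hr.add hs
  zero_mem' := Conducts.zero _ _
  smul_mem' r s hs := by
    have : Conducts (overring O (Fin.last n)) (overring O j)
        ((r : FractionRing O) * (s : FractionRing O)) :=
      (Conducts.of_le_of_mem le_rfl r.2).mul hs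
    exact this

/-- The last row of A is the direct sum of the conductors (O_j : O_{n+1}), which are ideals of
O_{n+1}. -/
theorem projective_corner_last
    (hproj : ∀ I : Ideal (overring O n), Module.Projective (overring O n) I) :
    Module.Projective (overring O (Fin.last n))
      (corner (KoenigOrder.diag (O := O) (Fin.last n)) (KoenigOrder O n)) := by
  have : ∀ j, Module.Projective (overring O (Fin.last n)) (lastConductor (O := O) (n := n) j) :=
    fun j => hproj (lastConductor j)
  have hmem : ∀ (a : KoenigOrder O n) (j : Fin (n + 1)),
      a.entry (Fin.last n) j ∈ overring O (Fin.last n) := fun a j =>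
    overring_mono O (Fin.le_last j) (a.conducts_entry (Fin.last n) j).mem
  let T : corner (KoenigOrder.diag (O := O) (Fin.last n)) (KoenigOrder O n) →ₗ[overring O (Fin.last n)]
      ((j : Fin (n + 1)) → lastConductor (O := O) (n := n) j) :=
    { toFun := fun a j => ⟨⟨a.1.entry (Fin.last n) j, hmem a.1 j⟩,
        a.1.conducts_entry (Fin.last n) j⟩
      map_add' := fun a b => rfl
      map_smul' := fun r a => by
        funext j
        apply Subtype.ext
        apply Subtype.ext
        change (KoenigOrder.diag (Fin.last n) r * a.1).entry (Fin.last n) j = _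
        rw [KoenigOrder.entry_diag_mul, if_pos rfl]
        rfl }
  have hT : Function.Bijective T := by
    constructor
    · intro a b hab
      apply Subtype.ext
      rw [← (show KoenigOrder.diag (Fin.last n) 1 * a.1 = a.1 from a.2),
        ← (show KoenigOrder.diag (Fin.last n) 1 * b.1 = b.1 from b.2)]
      apply KoenigOrder.ext
      intro i j
      rw [KoenigOrder.entry_diag_mul, KoenigOrder.entry_diag_mul]
      have := congrArg (fun x : overring O (Fin.last n) => (x : FractionRing O))
        (congrArg Subtype.val (congrFun hab j))
      rw [show a.1.entry (Fin.last n) j = b.1.entry (Fin.last n) j from this]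
    · intro c
      let a : KoenigOrder O n := KoenigOrder.mk
        (fun i j => if i = Fin.last n then ((c j).1 : FractionRing O) else 0) (fun i j => by
          split_ifs with h
          · rw [h]
            exact (c j).2
          · exact Conducts.zero _ _)
      refine ⟨⟨a, ?_⟩, ?_⟩
      · change KoenigOrder.diag (Fin.last n) 1 * a = a
        apply KoenigOrder.ext
        intro i j
        rw [KoenigOrder.entry_diag_mul, KoenigOrder.entry_mk, KoenigOrder.entry_mk, if_pos rfl]
        simp [eq_comm]
      · funext j
        apply Subtype.ext
        apply Subtype.ext
        change a.entry (Fin.last n) j = _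
        rw [KoenigOrder.entry_mk, if_pos rfl]
  have hpi : Module.Projective (overring O (Fin.last n))
      ((j : Fin (n + 1)) → lastConductor (O := O) (n := n) j) :=
    Module.Projective.of_equiv' (DFinsupp.linearEquivFunOnFintype)
  exact Module.Projective.of_equiv' (LinearEquiv.ofBijective T hT).symm

/-- The last step, from A/J_n to A, has a corner that is hereditary but need not be semisimple. -/
theorem pdLT_koenigOrder (hn : 0 < n)
    (hss : ∀ k < n, IsSemisimpleRing (overring O k ⧸ conductorIdeal O k))
    (hproj : ∀ I : Ideal (overring O n), Module.Projective (overring O n) I)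
    (M : Type u) [AddCommGroup M] [Module (KoenigOrder O n) M] :
    PdLT (KoenigOrder O n) M (2 * n + 1) := by
  obtain ⟨m, rfl⟩ := Nat.exists_eq_succ_of_ne_zero hn.ne'
  have h := cornerQuotient_last (O := O) (n := m + 1)
  have hθ : ∀ r, KoenigOrder.diag (Fin.last (m + 1)) (RingHom.id _ r) =
      (RingHom.id (KoenigOrder O (m + 1))) (KoenigOrder.diag (Fin.last (m + 1)) r) := fun _ => rfl
  have := projective_corner_last hproj
  let J := koenigIdeal O (m + 1) (m + 1)
  refine ((h.isCornerBasis hθ).pdLT_add_two (IsLeftHereditary.of_ideals hproj) J.ringCon.mk'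
    (mk'_surjective J) (fun b => ?_)
    (pdLT_of_ker hss m (Nat.lt_succ_self m) (mk'_surjective J) (mk'_eq_zero_iff J)) M).mono
    (by omega)
  rw [h.mem_trace_iff hθ, mk'_eq_zero_iff]
  exact ⟨fun hb => ⟨b, hb, rfl⟩, fun ⟨a, ha, hab⟩ => hab ▸ ha⟩

/-- The idempotent of index k separates the ideals: it lies in J_k, and its membership in J_l would
give R_l ⊆ R_k, hence R_{k+1} ⊆ R_k (indices from 0). -/
theorem koenigIdeal_strictAnti {k l : ℕ} (hkl : k < l) (hl : l ≤ n)
    (hne : ∀ k < n, ¬ overring O (k + 1) ≤ overring O k) :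
    koenigIdeal O n l < koenigIdeal O n k := by
  refine lt_of_le_of_ne (koenigIdeal_antitone hkl.le hl) fun heq => ?_
  have hk : k < n := hkl.trans_le hl
  let κ : Fin (n + 1) := ⟨k, hk.trans (Nat.lt_succ_self n)⟩
  have h1 : KoenigOrder.diag (O := O) κ 1 ∈ koenigIdeal O n k := by
    rw [mem_koenigIdeal hk.le]
    intro i hi j
    rw [KoenigOrder.entry_diag, if_neg]
    · exact Conducts.zero _ _
    · rintro ⟨rfl, -⟩
      exact lt_irrefl _ hi
  rw [← heq, mem_koenigIdeal hl] at h1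
  have h2 := h1 κ hkl κ
  rw [KoenigOrder.entry_diag, if_pos ⟨rfl, rfl⟩] at h2
  refine hne k hk fun x hx => ?_
  have := h2 x (overring_mono O hkl hx)
  rwa [OneMemClass.coe_one, one_mul] at this

theorem isHeredityChain_koenigIdeal
    (hss : ∀ k < n, IsSemisimpleRing (overring O k ⧸ conductorIdeal O k))
    (hne : ∀ k < n, ¬ overring O (k + 1) ≤ overring O k) :
    IsHeredityChain (fun t : Fin (n + 1) =>
      imageInQuotient (koenigKernel O n) (koenigIdeal O n (n - t))) := by
  have hmem : ∀ (k : ℕ), k ≤ n → ∀ a : KoenigOrder O n, (koenigKernel O n).ringCon.mk' a ∈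
      imageInQuotient (koenigKernel O n) (koenigIdeal O n k) ↔ a ∈ koenigIdeal O n k := by
    intro k hk a
    rw [mem_imageInQuotient]
    refine ⟨?_, fun h => ⟨a, h, rfl⟩⟩
    rintro ⟨b, hb, hab⟩
    have h1 : a - b ∈ koenigKernel O n := by
      rw [← mk'_eq_zero_iff, map_sub, hab, sub_self]
    rw [← koenigIdeal_self] at h1
    have := add_mem (koenigIdeal_antitone hk le_rfl h1) hb
    rwa [sub_add_cancel] at this
  refine ⟨?_, ?_, ?_, ?_⟩
  · rw [eq_bot_iff]
    intro x hx
    obtain ⟨a, ha, rfl⟩ := mem_imageInQuotient.mp hx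
    have ha' : a ∈ koenigIdeal O n n := ha
    rw [koenigIdeal_self] at ha'
    exact (TwoSidedIdeal.mem_bot _).mpr ((mk'_eq_zero_iff _ _).mpr ha')
  · rw [eq_top_iff]
    intro x _
    obtain ⟨a, rfl⟩ := mk'_surjective _ x
    refine mem_imageInQuotient.mpr ⟨a, ?_, rfl⟩
    rw [Fin.val_last, Nat.sub_self, koenigIdeal_zero]
    trivial
  · intro s t hst
    have hst' : (s : ℕ) < t := hst
    have ht := Nat.le_of_lt_succ t.2
    have hlt := koenigIdeal_strictAnti (O := O) (n := n) (k := n - t) (l := n - s) (by omega)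
      (by omega) hne
    refine lt_of_le_of_ne ?_ fun heq => ?_
    · intro x hx
      obtain ⟨a, ha, rfl⟩ := mem_imageInQuotient.mp hx
      exact mem_imageInQuotient.mpr ⟨a, hlt.le ha, rfl⟩
    · refine hlt.not_ge fun a ha => ?_
      have h1 := (hmem (n - t) (by omega) a).mpr ha
      rw [← (show imageInQuotient (koenigKernel O n) (koenigIdeal O n (n - s)) =
        imageInQuotient (koenigKernel O n) (koenigIdeal O n (n - t)) from heq)] at h1
      exact (hmem (n - s) (by omega) a).mp h1
  · intro t
    have ht := t.2
    have := hss (n - (t + 1)) (by omega)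
    -- The composite of A → Q with the quotient by J has kernel J_{n-t}; the layer above it is the
    -- image of J_{n-t-1}.
    let J := imageInQuotient (koenigKernel O n) (koenigIdeal O n (n - t))
    refine isHeredityIdeal_of_ker (k := n - (t + 1)) (by omega)
      (π := J.ringCon.mk'.comp (koenigKernel O n).ringCon.mk')
      ((mk'_surjective J).comp (mk'_surjective _)) (fun a => ?_) _ (fun b => ?_)
    · rw [RingHom.comp_apply, mk'_eq_zero_iff, hmem _ (by omega)]
      rw [show n - (t : ℕ) = n - (t + 1) + 1 by omega]
    · refine mem_imageInQuotient.trans ?_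
      constructor
      · rintro ⟨x, hx, rfl⟩
        obtain ⟨a, ha, rfl⟩ := mem_imageInQuotient.mp hx
        exact ⟨a, ha, rfl⟩
      · rintro ⟨a, ha, rfl⟩
        exact ⟨_, mem_imageInQuotient.mpr ⟨a, ha, rfl⟩, rfl⟩

end Chain

end Koenig

namespace Koenig

/-! ### Regularity, normality and invertible primes in reduced Noetherian rings of dimension at most
one -/

section DimensionOne

variable {R : Type*} [CommRing R]

/-- In a reduced ring every zero divisor lies in a minimal prime; there are finitely many of these,
so prime avoidance applies. -/
theorem exists_mem_nonZeroDivisors_of_forall_not_le [IsNoetherianRing R] [IsReduced R] {I : Ideal R}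
    (h : ∀ p ∈ minimalPrimes R, ¬ I ≤ p) : ∃ a ∈ I, a ∈ R⁰ := by
  by_contra! hI
  have hfin : (minimalPrimes R).Finite := minimalPrimes.finite_of_isNoetherianRing R
  have hsub : (I : Set R) ⊆ ⋃ p ∈ (↑hfin.toFinset : Set (Ideal R)), (p : Set R) := by
    intro x hx
    have hx' := hI x hx
    have h0 : (⊥ : Ideal R).radical = ⊥ := (Ideal.isRadical_bot (R := R)).radical
    have : x ∈ ⋃ p ∈ (⊥ : Ideal R).minimalPrimes, (p : Set R) := by
      rw [Ideal.iUnion_minimalPrimes, h0]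
      rw [mem_nonZeroDivisors_iff_right] at hx'
      push Not at hx'
      obtain ⟨y, hy, hy0⟩ := hx'
      exact ⟨y, hy0, by rw [mul_comm]; exact hy⟩
    simpa using! this
  obtain ⟨p, hp, hIp⟩ := (Ideal.subset_union_prime ⊥ ⊥
    fun p hp _ _ => (hfin.mem_toFinset.mp hp).isPrime).mp hsub
  exact h p (hfin.mem_toFinset.mp hp) hIp

theorem notMem_minimalPrimes_of_mem_nonZeroDivisors {p : Ideal R} {a : R} (ha : a ∈ p)
    (ha' : a ∈ R⁰) : p ∉ minimalPrimes R :=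
  fun hp => Set.disjoint_left.mp (Ideal.disjoint_nonZeroDivisors_of_mem_minimalPrimes hp) ha ha'

theorem exists_mem_nonZeroDivisors_of_notMem_minimalPrimes [IsNoetherianRing R] [IsReduced R]
    {p : Ideal R} [p.IsPrime]
    (hp : p ∉ minimalPrimes R) : ∃ a ∈ p, a ∈ R⁰ := by
  refine exists_mem_nonZeroDivisors_of_forall_not_le fun q hq hpq => hp ?_
  rwa [le_antisymm hpq (hq.2 ⟨inferInstance, bot_le⟩ hpq)]

theorem isMaximal_of_mem_nonZeroDivisors [Ring.KrullDimLE 1 R] {p : Ideal R} [p.IsPrime] {a : R}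
    (ha : a ∈ p) (ha' : a ∈ R⁰) : p.IsMaximal :=
  ((Ring.krullDimLE_one_iff.mp ‹_›) p inferInstance).resolve_left
    (notMem_minimalPrimes_of_mem_nonZeroDivisors ha ha')

theorem isField_localization_of_mem_minimalPrimes [IsReduced R] {p : Ideal R} [p.IsPrime]
    (hp : p ∈ minimalPrimes R) : IsField (Localization.AtPrime p) := by
  rw [← PrimeSpectrum.subsingleton_iff_isField_of_isReduced]
  exact IsLocalization.subsingleton_primeSpectrum_of_mem_minimalPrimes p hp _

theorem isRegularLocalRing_of_mem_minimalPrimes [IsReduced R] {p : Ideal R} [p.IsPrime]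
    (hp : p ∈ minimalPrimes R) : IsRegularLocalRing (Localization.AtPrime p) := by
  let := (isField_localization_of_mem_minimalPrimes hp).toField
  infer_instance

theorem mem_minimalPrimes_span_singleton [Ring.KrullDimLE 1 R] {m : Ideal R} [m.IsPrime] {a : R}
    (ha : a ∈ m) (ha' : a ∈ R⁰) : m ∈ (Ideal.span {a}).minimalPrimes := by
  refine ⟨⟨inferInstance, (Ideal.span_singleton_le_iff_mem _).mpr ha⟩, fun q hq hqm => ?_⟩
  have := hq.1
  have hmax := isMaximal_of_mem_nonZeroDivisors ((Ideal.span_singleton_le_iff_mem _).mp hq.2) ha'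
  exact (hmax.eq_of_le (Ideal.IsPrime.ne_top ‹_›) hqm).ge

variable {K : Type*} [CommRing K] [Algebra R K]

/-- The prime m is minimal over (a), hence associated to R/(a), say m = (a : b). The fraction is
b/a. -/
theorem exists_notMem_range_forall_mul_mem_range [IsNoetherianRing R] [IsFractionRing R K]
    [Ring.KrullDimLE 1 R]
    {m : Ideal R} [m.IsPrime] {a : R} (ha : a ∈ m) (ha' : a ∈ R⁰) :
    ∃ x : K, x ∉ (algebraMap R K).range ∧
      ∀ z ∈ m, x * algebraMap R K z ∈ (algebraMap R K).range := by
  have hu := IsLocalization.map_units K (⟨a, ha'⟩ : R⁰)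
  obtain ⟨b, hb⟩ : ∃ b : R, m = (Ideal.span {a} : Submodule R R).colon {b} := by
    refine Submodule.exists_eq_colon_of_mem_minimalPrimes (x := (1 : R)) ?_
    have : (Ideal.span {a} : Submodule R R).colon {(1 : R)} = Ideal.span {a} := by
      ext; simp [Submodule.mem_colon_singleton]
    rw [this]
    exact mem_minimalPrimes_span_singleton ha ha'
  refine ⟨IsLocalization.mk' K b ⟨a, ha'⟩, ?_, fun z hz => ?_⟩
  · rintro ⟨r, hr⟩
    rw [eq_comm, IsLocalization.mk'_eq_iff_eq_mul, ← map_mul] at hr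
    have hr' := IsFractionRing.injective R K hr
    refine Ideal.IsPrime.ne_top ‹m.IsPrime› ((Ideal.eq_top_iff_one _).mpr ?_)
    rw [hb, Submodule.mem_colon_singleton, one_smul, hr']
    exact Ideal.mul_mem_left _ _ (Ideal.mem_span_singleton_self a)
  · rw [hb, Submodule.mem_colon_singleton] at hz
    obtain ⟨c, hc⟩ := Ideal.mem_span_singleton'.mp hz
    refine ⟨c, hu.mul_right_cancel ?_⟩
    rw [mul_right_comm, IsLocalization.mk'_spec, ← map_mul, ← map_mul, hc, smul_eq_mul, mul_comm]

theorem isPrincipal_maximalIdeal_of_isRegularLocalRing [IsNoetherianRing R] [Ring.KrullDimLE 1 R]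
    {m : Ideal R} [m.IsPrime] {a : R} (ha : a ∈ m) (ha' : a ∈ R⁰)
    (hreg : IsRegularLocalRing (Localization.AtPrime m)) :
    (IsLocalRing.maximalIdeal (Localization.AtPrime m)).IsPrincipal := by
  set A := Localization.AtPrime m
  have hdim : ringKrullDim A ≤ 1 := by
    rw [IsLocalization.AtPrime.ringKrullDim_eq_height m A]
    exact_mod_cast Ideal.height_le_one_of_isPrincipal_of_mem_minimalPrimes _ _
      (mem_minimalPrimes_span_singleton ha ha')
  have hrank : (IsLocalRing.maximalIdeal A).spanFinrank ≤ 1 := by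
    have := hreg.spanFinrank_maximalIdeal.trans_le hdim
    exact_mod_cast this
  rcases Nat.le_one_iff_eq_zero_or_eq_one.mp hrank with h | h
  · rw [Submodule.spanFinrank_eq_zero_iff_eq_bot (IsNoetherian.noetherian _)] at h
    exact h ▸ inferInstance
  · exact ((Submodule.spanFinrank_eq_one_iff _).mp h).1

theorem exists_forall_exists_mul_eq_of_isRegularLocalRing [IsNoetherianRing R] [Ring.KrullDimLE 1 R]
    {m : Ideal R} [m.IsPrime] {a : R} (ha : a ∈ m) (ha' : a ∈ R⁰)
    (hreg : IsRegularLocalRing (Localization.AtPrime m)) :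
    ∃ π ∈ m, ∀ z ∈ m, ∃ s ∉ m, ∃ r, s * z = r * π := by
  set A := Localization.AtPrime m
  obtain ⟨g, hg⟩ := isPrincipal_maximalIdeal_of_isRegularLocalRing ha ha' hreg
  have hgm : g ∈ IsLocalRing.maximalIdeal A := by
    rw [hg]
    exact Submodule.mem_span_singleton_self g
  obtain ⟨π, t, rfl⟩ := IsLocalization.exists_mk'_eq m.primeCompl g
  refine ⟨π, (IsLocalization.AtPrime.mk'_mem_maximal_iff A m π t).mp hgm, fun z hz => ?_⟩
  have hz' : algebraMap R A z ∈ IsLocalRing.maximalIdeal A :=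
    (IsLocalization.AtPrime.to_map_mem_maximal_iff A m z).mpr hz
  rw [hg] at hz'
  obtain ⟨c, hc⟩ := Submodule.mem_span_singleton.mp hz'
  obtain ⟨d, s, rfl⟩ := IsLocalization.exists_mk'_eq m.primeCompl c
  rw [smul_eq_mul, ← IsLocalization.mk'_mul, IsLocalization.mk'_eq_iff_eq_mul, ← map_mul,
    IsLocalization.eq_iff_exists m.primeCompl] at hc
  obtain ⟨w, hw⟩ := hc
  refine ⟨w * (s * t), (w * (s * t)).2, w * d, ?_⟩
  rw [mul_assoc (w : R) d, hw]
  push_cast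
  ring

/-- A maximal ideal `m` is invertible if some fraction `x` maps `m` into the ring, but not into
`m`. -/
def IsInvertibleAt (K : Type*) [CommRing K] [Algebra R K] (m : Ideal R) : Prop :=
  ∃ x : K, (∀ z ∈ m, x * algebraMap R K z ∈ (algebraMap R K).range) ∧
    ∃ z ∈ m, ∃ r ∉ m, x * algebraMap R K z = algebraMap R K r

/-- With π a generator of m locally, x π ∈ m gives t s x ∈ R with t s ∉ m. Also x m ⊆ R, and m
together with t s generates the unit ideal. -/
theorem mem_range_of_isRegularLocalRing [IsNoetherianRing R] [IsFractionRing R K]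
    [Ring.KrullDimLE 1 R]
    {m : Ideal R} [m.IsPrime] {a : R} (ha : a ∈ m) (ha' : a ∈ R⁰)
    (hreg : IsRegularLocalRing (Localization.AtPrime m)) {x : K}
    (hx : ∀ z ∈ m, ∃ r ∈ m, x * algebraMap R K z = algebraMap R K r) :
    x ∈ (algebraMap R K).range := by
  have hmax : m.IsMaximal := isMaximal_of_mem_nonZeroDivisors ha ha'
  obtain ⟨π, hπ, hm⟩ := exists_forall_exists_mul_eq_of_isRegularLocalRing ha ha' hreg
  obtain ⟨y, hy, hxy⟩ := hx π hπ
  obtain ⟨s, hs, r, hsr⟩ := hm y hy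
  obtain ⟨t, ht, c, htc⟩ := hm a ha
  have hu := IsLocalization.map_units K (⟨a, ha'⟩ : R⁰)
  -- π itself need not be a nonzerodivisor of R, so the cancellation is made with a, through t a = c
  -- π.
  have key : algebraMap R K (t * s) * x = algebraMap R K (t * r) := by
    refine hu.mul_right_cancel ?_
    have e1 := congrArg (algebraMap R K) hsr
    have e2 := congrArg (algebraMap R K) htc
    simp only [map_mul] at e1 e2 ⊢
    linear_combination (algebraMap R K s * x - algebraMap R K r) * e2 +
      algebraMap R K s * algebraMap R K c * hxy + algebraMap R K c * e1
  have hts : t * s ∉ m := fun h => (Ideal.IsPrime.mem_or_mem ‹_› h).elim ht hs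
  obtain ⟨u, v, hv, huv⟩ := hmax.exists_inv hts
  obtain ⟨w, -, hw⟩ := hx v hv
  refine ⟨u * (t * r) + w, ?_⟩
  have e3 := congrArg (algebraMap R K) huv
  simp only [map_mul, map_add, map_one] at e3 key ⊢
  linear_combination x * e3 - algebraMap R K u * key - hw

/-- From x z = r ∉ m each y in m satisfies r y = z (x y), so z generates the maximal ideal locally;
the height is at least one because a is a nonzerodivisor. -/
theorem IsInvertibleAt.isRegularLocalRing [IsNoetherianRing R] [IsFractionRing R K] {m : Ideal R}
    [m.IsPrime] {a : R}
    (ha : a ∈ m) (ha' : a ∈ R⁰) (h : IsInvertibleAt K m) :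
    IsRegularLocalRing (Localization.AtPrime m) := by
  obtain ⟨x, hx, z, hz, r, hr, hzr⟩ := h
  set A := Localization.AtPrime m
  have hle : IsLocalRing.maximalIdeal A ≤ Ideal.span {algebraMap R A z} := by
    rw [← Localization.AtPrime.map_eq_maximalIdeal, Ideal.map_le_iff_le_comap]
    intro y hy
    obtain ⟨c, hc⟩ := hx y hy
    have hyz : r * y = z * c := by
      apply IsFractionRing.injective R K
      rw [map_mul, map_mul, hc, ← hzr]
      ring
    have hu := IsLocalization.map_units A (⟨r, hr⟩ : m.primeCompl)
    rw [Ideal.mem_comap, ← Ideal.unit_mul_mem_iff_mem _ hu, ← map_mul, hyz, map_mul]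
    exact Ideal.mul_mem_right _ _ (Ideal.mem_span_singleton_self _)
  have heq : IsLocalRing.maximalIdeal A = Ideal.span {algebraMap R A z} := by
    refine le_antisymm hle ((Ideal.span_singleton_le_iff_mem _).mpr ?_)
    exact (IsLocalization.AtPrime.to_map_mem_maximal_iff A m z).mpr hz
  apply IsRegularLocalRing.of_spanFinrank_maximalIdeal_le
  have h1 : (IsLocalRing.maximalIdeal A).spanFinrank ≤ 1 := by
    rw [heq]
    exact (Submodule.spanFinrank_span_le_ncard_of_finite (Set.finite_singleton _)).trans
      (Set.ncard_singleton _).le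
  have h2 : (1 : ℕ∞) ≤ m.height := by
    rw [Order.one_le_iff_ne_zero, Ne, Ideal.height_eq_zero_iff]
    exact notMem_minimalPrimes_of_mem_nonZeroDivisors ha ha'
  rw [IsLocalization.AtPrime.ringKrullDim_eq_height m A]
  exact le_trans (by exact_mod_cast h1) (WithBot.coe_le_coe.mpr h2)

/-- From x z = r one gets r D ⊆ m D, and r is a unit modulo m, so D = m D. Nakayama yields an
element congruent to 1 modulo m that kills D, impossible since D contains a nonzerodivisor. -/
theorem IsInvertibleAt.false_of_forall_mul_mem [IsNoetherianRing R] [IsFractionRing R K]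
    {m D : Ideal R} [m.IsMaximal]
    {a : R} (ha : a ∈ D) (ha' : a ∈ R⁰) {x : K}
    (hx : ∃ z ∈ m, ∃ r ∉ m, x * algebraMap R K z = algebraMap R K r)
    (hxD : ∀ d ∈ D, ∃ d' ∈ D, x * algebraMap R K d = algebraMap R K d') : False := by
  obtain ⟨z, hz, r, hr, hzr⟩ := hx
  obtain ⟨u, v, hv, huv⟩ := Ideal.IsMaximal.exists_inv ‹_› hr
  have hle : D ≤ m • D := by
    intro d hd
    obtain ⟨d', hd', hdd'⟩ := hxD d hd
    have h1 : r * d = z * d' := by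
      apply IsFractionRing.injective R K
      rw [map_mul, map_mul, ← hdd', ← hzr]
      ring
    have h2 : d = u * (z * d') + v * d := by rw [← h1, ← mul_assoc, ← add_mul, huv, one_mul]
    rw [h2]
    exact add_mem (Ideal.mul_mem_left _ _ (Ideal.mul_mem_mul hz hd')) (Ideal.mul_mem_mul hv hd)
  obtain ⟨s, hs, hsD⟩ := Submodule.exists_sub_one_mem_and_smul_eq_zero_of_fg_of_le_smul m D
    (IsNoetherian.noetherian D) hle
  have hs0 : s = 0 := (mem_nonZeroDivisors_iff_right.mp ha') s (hsD a ha)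
  rw [hs0, zero_sub, neg_mem_iff] at hs
  exact Ideal.IsPrime.ne_top inferInstance ((Ideal.eq_top_iff_one m).mpr hs)

/-- The ideal of all `d` such that `d * y ^ n` lies in the ring for all `n`. -/
def powerDenominators (R : Type*) [CommRing R] {K : Type*} [CommRing K] [Algebra R K] (y : K) :
    Ideal R where
  carrier := {d | ∀ n, algebraMap R K d * y ^ n ∈ (algebraMap R K).range}
  add_mem' ha hb n := by
    rw [map_add, add_mul]
    exact add_mem (ha n) (hb n)
  zero_mem' n := by
    rw [map_zero, zero_mul]
    exact zero_mem _
  smul_mem' c d hd n := by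
    rw [smul_eq_mul, map_mul, mul_assoc]
    exact mul_mem ⟨c, rfl⟩ (hd n)

theorem exists_mem_powerDenominators [IsFractionRing R K] {y : K} (hy : IsIntegral R y) :
    ∃ d ∈ powerDenominators R y, d ∈ R⁰ := by
  obtain ⟨d, hd, h⟩ := hy.isAlmostIntegral
  exact ⟨d, fun n => by rw [← Algebra.smul_def]; exact h n, hd⟩

/-- If a ∉ m then m is regular, so some x has x m ⊆ R but not x m ⊆ m. The ideal D of power
denominators lies in m and is a module over R[y], which makes x D ⊆ D, contradicting
`IsInvertibleAt.false_of_forall_mul_mem`. -/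
theorem mem_of_powerDenominators_le [IsNoetherianRing R] [IsFractionRing R K]
    [Ring.KrullDimLE 1 R] {a : R}
    (ha : ∀ (m : Ideal R) [m.IsPrime], (∃ c ∈ m, c ∈ R⁰) → a ∉ m →
      IsRegularLocalRing (Localization.AtPrime m))
    {y : K} (hy : IsIntegral R y) {m : Ideal R} [m.IsPrime] (hm : powerDenominators R y ≤ m) :
    a ∈ m := by
  by_contra ham
  obtain ⟨d, hd, hd'⟩ := exists_mem_powerDenominators hy
  have hmax := isMaximal_of_mem_nonZeroDivisors (hm hd) hd'
  have hreg := ha m ⟨d, hm hd, hd'⟩ ham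
  obtain ⟨x, hxR, hx⟩ := exists_notMem_range_forall_mul_mem_range (K := K) (hm hd) hd'
  refine IsInvertibleAt.false_of_forall_mul_mem (m := m) hd hd' (x := x) ?_ ?_
  · by_contra! hcon
    refine hxR (mem_range_of_isRegularLocalRing (hm hd) hd' hreg fun z hz => ?_)
    obtain ⟨r, hr⟩ := hx z hz
    by_contra! h
    exact hcon z hz r (fun hrm => h r hrm hr.symm) hr.symm
  · intro c hc
    obtain ⟨c', hc'⟩ := hx c (hm hc)
    refine ⟨c', fun n => ?_, hc'.symm⟩
    obtain ⟨e, he⟩ := hc n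
    have hem : e ∈ powerDenominators R y := by
      intro k
      rw [he, mul_assoc, ← pow_add]
      exact hc _
    obtain ⟨f, hf⟩ := hx e (hm hem)
    exact ⟨f, by rw [hf, he, hc', mul_assoc]⟩

theorem exists_pow_mul_mem_range [IsNoetherianRing R] [IsFractionRing R K] [Ring.KrullDimLE 1 R]
    {a : R}
    (ha : ∀ (m : Ideal R) [m.IsPrime], (∃ c ∈ m, c ∈ R⁰) → a ∉ m →
      IsRegularLocalRing (Localization.AtPrime m))
    {y : K} (hy : IsIntegral R y) : ∃ n, algebraMap R K (a ^ n) * y ∈ (algebraMap R K).range := by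
  have : a ∈ (powerDenominators R y).radical := by
    rw [Ideal.radical_eq_sInf, Submodule.mem_sInf]
    rintro m ⟨hm, hprime⟩
    exact mem_of_powerDenominators_le ha hy hm
  obtain ⟨n, hn⟩ := this
  exact ⟨n, by simpa only [pow_one] using hn 1⟩

theorem mem_range_of_isIntegral [IsNoetherianRing R] [IsFractionRing R K] [Ring.KrullDimLE 1 R]
    (h : ∀ (m : Ideal R) [m.IsPrime], (∃ c ∈ m, c ∈ R⁰) →
      IsRegularLocalRing (Localization.AtPrime m))
    {y : K} (hy : IsIntegral R y) : y ∈ (algebraMap R K).range := by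
  obtain ⟨n, hn⟩ := exists_pow_mul_mem_range (a := 1) (fun m _ hm _ => h m hm) hy
  simpa only [one_pow, map_one, one_mul] using hn

/-- Iterating x m ⊆ m gives a x^n ∈ R for all n: x is almost integral, hence integral over a
Noetherian ring. -/
theorem isIntegral_of_forall_mul_mem [IsNoetherianRing R] [IsFractionRing R K] {m : Ideal R}
    {a : R} (ha : a ∈ m)
    (ha' : a ∈ R⁰) {x : K} (hx : ∀ z ∈ m, ∃ r ∈ m, x * algebraMap R K z = algebraMap R K r) :
    IsIntegral R x := by
  have h : ∀ n, ∃ r ∈ m, x ^ n * algebraMap R K a = algebraMap R K r := by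
    intro n
    induction n with
    | zero => exact ⟨a, ha, by rw [pow_zero, one_mul]⟩
    | succ n ih =>
      obtain ⟨r, hr, hxr⟩ := ih
      obtain ⟨r', hr', h'⟩ := hx r hr
      exact ⟨r', hr', by rw [pow_succ', mul_assoc, hxr, h']⟩
  have halm : IsAlmostIntegral R x := by
    refine ⟨a, ha', fun n => ?_⟩
    obtain ⟨r, -, hr⟩ := h n
    exact ⟨r, by rw [← hr, Algebra.smul_def, mul_comm]⟩
  refine halm.isIntegral_of_nonZeroDivisors_le_comap fun c hc => ?_
  exact (IsLocalization.map_units K (⟨c, hc⟩ : R⁰)).mem_nonZeroDivisors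

theorem isInvertibleAt_of_forall_isIntegral [IsNoetherianRing R] [IsFractionRing R K]
    [Ring.KrullDimLE 1 R]
    (h : ∀ y : K, IsIntegral R y → y ∈ (algebraMap R K).range) {m : Ideal R} [m.IsPrime] {a : R}
    (ha : a ∈ m) (ha' : a ∈ R⁰) : IsInvertibleAt K m := by
  obtain ⟨x, hxR, hx⟩ := exists_notMem_range_forall_mul_mem_range (K := K) ha ha'
  refine ⟨x, hx, ?_⟩
  by_contra! hcon
  refine hxR (h x (isIntegral_of_forall_mul_mem ha ha' fun z hz => ?_))
  obtain ⟨r, hr⟩ := hx z hz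
  by_contra! h'
  exact hcon z hz r (fun hrm => h' r hrm hr.symm) hr.symm

theorem isRegularRing_of_forall_isIntegral [IsNoetherianRing R] [IsReduced R] (K : Type*)
    [CommRing K] [Algebra R K]
    [IsFractionRing R K] [Ring.KrullDimLE 1 R]
    (h : ∀ y : K, IsIntegral R y → y ∈ (algebraMap R K).range) : IsRegularRing R := by
  rw [isRegularRing_iff]
  intro p hp
  by_cases hmin : p ∈ minimalPrimes R
  · exact isRegularLocalRing_of_mem_minimalPrimes hmin
  · obtain ⟨a, ha, ha'⟩ := exists_mem_nonZeroDivisors_of_notMem_minimalPrimes hmin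
    exact (isInvertibleAt_of_forall_isIntegral h ha ha').isRegularLocalRing ha ha'

/-- By Krull's intersection theorem every nonzero element is a unit times a power of π, and
reducedness keeps a nonzero π from being nilpotent. -/
theorem isDomain_of_isPrincipal_maximalIdeal {A : Type*} [CommRing A] [IsNoetherianRing A]
    [IsReduced A] [IsLocalRing A] (h : (IsLocalRing.maximalIdeal A).IsPrincipal) : IsDomain A := by
  obtain ⟨π, hπ⟩ := h
  have hkrull : ∀ x : A, x ≠ 0 → ∃ (n : ℕ) (u : A), IsUnit u ∧ x = u * π ^ n := by
    intro x hx
    by_contra! hcon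
    refine hx ?_
    have hall : ∀ n, x ∈ IsLocalRing.maximalIdeal A ^ n := by
      intro n
      induction n with
      | zero => simp
      | succ n ih =>
        rw [hπ, Ideal.submodule_span_eq, Ideal.span_singleton_pow] at ih ⊢
        obtain ⟨u, hu⟩ := Ideal.mem_span_singleton'.mp ih
        by_cases hun : IsUnit u
        · exact absurd hu.symm (hcon n u hun)
        · have : u ∈ IsLocalRing.maximalIdeal A := hun
          rw [hπ] at this
          obtain ⟨v, rfl⟩ := Submodule.mem_span_singleton.mp this
          rw [Ideal.mem_span_singleton']
          exact ⟨v, by rw [← hu, smul_eq_mul]; ring⟩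
    have := Ideal.iInf_pow_eq_bot_of_isLocalRing (IsLocalRing.maximalIdeal A)
      (Ideal.IsPrime.ne_top inferInstance)
    rw [← Ideal.mem_bot, ← this, Submodule.mem_iInf]
    exact hall
  by_cases hπ0 : π = 0
  · have hf : IsField A := by
      rw [IsLocalRing.isField_iff_maximalIdeal_eq, hπ, hπ0]
      simp
    exact hf.isDomain
  · have : NoZeroDivisors A := by
      refine ⟨fun {x y} hxy => ?_⟩
      by_contra! hcon
      obtain ⟨i, u, hu, rfl⟩ := hkrull x hcon.1
      obtain ⟨j, v, hv, rfl⟩ := hkrull y hcon.2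
      have h0 : u * v * π ^ (i + j) = 0 := by rw [← hxy]; ring
      rw [(hu.mul hv).mul_right_eq_zero] at h0
      exact hπ0 (IsNilpotent.eq_zero ⟨_, h0⟩)
    exact NoZeroDivisors.to_isDomain A

/-- Projectivity is local, and each local ring at a maximal ideal is a principal ideal domain, where
a finite torsion-free module is free. -/
theorem projective_ideal_of_isRegularRing [IsRegularRing R] [IsReduced R] [Ring.KrullDimLE 1 R]
    (I : Ideal R) :
    Module.Projective R I := by
  have : Module.FinitePresentation R I := Module.finitePresentation_of_finite R I
  refine Module.projective_of_localization_maximal fun m hm => ?_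
  set A := Localization.AtPrime m
  have hprin : (IsLocalRing.maximalIdeal A).IsPrincipal := by
    by_cases hmin : m ∈ minimalPrimes R
    · rw [(IsLocalRing.isField_iff_maximalIdeal_eq).mp
        (isField_localization_of_mem_minimalPrimes hmin)]
      infer_instance
    · obtain ⟨a, ha, ha'⟩ := exists_mem_nonZeroDivisors_of_notMem_minimalPrimes hmin
      exact isPrincipal_maximalIdeal_of_isRegularLocalRing ha ha' inferInstance
  have : IsNoetherianRing A := inferInstance
  have : IsDomain A := isDomain_of_isPrincipal_maximalIdeal hprin
  have : IsPrincipalIdealRing A :=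
    ((tfae_of_isNoetherianRing_of_isLocalRing_of_isDomain A).out 0 4).mpr hprin
  let f := LocalizedModule.map m.primeCompl I.subtype
  have hf : Function.Injective f := LocalizedModule.map_injective _ _ I.injective_subtype
  have : Module.IsTorsionFree A (LocalizedModule m.primeCompl I) :=
    hf.moduleIsTorsionFree f (fun c x => f.map_smul c x)
  have : Module.Finite A (LocalizedModule m.primeCompl I) := inferInstance
  have : Module.Free A (LocalizedModule m.primeCompl I) := inferInstance
  infer_instance

end DimensionOne

end Koenig

namespace Koenig

/-! ### Rings between O and its total ring of fractions -/

section Intermediate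

variable {O : Type u} [CommRing O] {S : Subalgebra O (FractionRing O)}

theorem isUnit_of_mem_nonZeroDivisors {s : S} (hs : s ∈ S⁰) : IsUnit (s : FractionRing O) := by
  obtain ⟨⟨b, t⟩, hb⟩ := IsLocalization.surj O⁰ (s : FractionRing O)
  have hb' : b ∈ O⁰ := by
    rw [mem_nonZeroDivisors_iff_right]
    intro c hc
    have h0 : algebraMap O S c * s = 0 := by
      apply Subtype.ext
      apply (IsLocalization.map_units (FractionRing O) t).mul_right_cancel
      have : algebraMap O (FractionRing O) c * algebraMap O (FractionRing O) b = 0 := by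
        rw [← map_mul, hc, map_zero]
      simp only at hb
      change algebraMap O (FractionRing O) c * (s : FractionRing O) * _ = 0 * _
      rw [mul_assoc, hb, this, zero_mul]
    have h1 := mem_nonZeroDivisors_iff_right.mp hs _ h0
    have h2 : algebraMap O (FractionRing O) c = 0 := congrArg Subtype.val h1
    exact (map_eq_zero_iff _ (IsFractionRing.injective O (FractionRing O))).mp h2
  have hu := IsLocalization.map_units (FractionRing O) (⟨b, hb'⟩ : O⁰)
  simp only at hb
  rw [← hb] at hu
  exact isUnit_of_mul_isUnit_left hu

theorem algebraMap_mem_nonZeroDivisors (S : Subalgebra O (FractionRing O)) {t : O} (ht : t ∈ O⁰) :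
    algebraMap O S t ∈ S⁰ := by
  rw [mem_nonZeroDivisors_iff_right]
  intro x hx
  apply Subtype.ext
  apply (IsLocalization.map_units (FractionRing O) (⟨t, ht⟩ : O⁰)).mul_right_cancel
  have := congrArg Subtype.val hx
  exact this.trans (zero_mul _).symm

instance (S : Subalgebra O (FractionRing O)) : IsFractionRing S (FractionRing O) where
  map_units s := isUnit_of_mem_nonZeroDivisors s.2
  surj x := by
    obtain ⟨⟨b, t⟩, hb⟩ := IsLocalization.surj O⁰ x
    exact ⟨⟨algebraMap O S b, ⟨algebraMap O S t, algebraMap_mem_nonZeroDivisors S t.2⟩⟩, hb⟩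
  exists_of_eq {x y} h := ⟨1, by rw [Subtype.ext h]⟩

instance [IsReduced O] (S : Subalgebra O (FractionRing O)) : IsReduced S :=
  isReduced_of_injective S.val Subtype.val_injective

theorem mem_range_algebraMap_iff {x : FractionRing O} :
    x ∈ (algebraMap S (FractionRing O)).range ↔ x ∈ S :=
  ⟨fun ⟨y, hy⟩ => hy ▸ y.2, fun h => ⟨⟨x, h⟩, rfl⟩⟩

theorem krullDimLE_one_of_le_normalization [IsReduced O] [Ring.KrullDimLE 1 O] [IsNoetherianRing S]
    (hS : S ≤ normalization O) : Ring.KrullDimLE 1 S := by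
  have hint : Algebra.IsIntegral O S := ⟨fun x => (isIntegral_algebraMap_iff
    (B := FractionRing O) Subtype.val_injective).mp (hS x.2)⟩
  refine Ring.krullDimLE_one_iff.mpr fun p hp => or_iff_not_imp_left.mpr fun hmin => ?_
  obtain ⟨a, ha, ha'⟩ := exists_mem_nonZeroDivisors_of_notMem_minimalPrimes hmin
  obtain ⟨u, hu⟩ := isUnit_of_mem_nonZeroDivisors ha'
  obtain ⟨⟨x, t⟩, hx⟩ := IsLocalization.surj O⁰ (↑u⁻¹ : FractionRing O)
  -- The denominator t of a⁻¹ is a nonzerodivisor of O and a multiple of a, so p contracts to a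
  -- maximal ideal of O.
  have ht : algebraMap O S t = a * algebraMap O S x := by
    apply Subtype.ext
    change algebraMap O (FractionRing O) t = (a : FractionRing O) * algebraMap O (FractionRing O) x
    simp only at hx
    rw [← hx, ← hu, Units.mul_inv_cancel_left]
  have htp : (t : O) ∈ p.comap (algebraMap O S) := by
    rw [Ideal.mem_comap, ht]
    exact Ideal.mul_mem_right _ _ ha
  exact Ideal.isMaximal_of_isIntegral_of_isMaximal_comap (R := O) p
    (isMaximal_of_mem_nonZeroDivisors htp t.2)

theorem finite_of_le_normalization [IsNoetherianRing O] [Module.Finite O (normalization O)]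
    (hS : S ≤ normalization O) : Module.Finite O S :=
  Module.Finite.of_injective (Subalgebra.inclusion hS).toLinearMap
    (Subalgebra.inclusion_injective hS)

end Intermediate

theorem krullDimLE_zero_quotient_of_mem_nonZeroDivisors {R : Type*} [CommRing R]
    [Ring.KrullDimLE 1 R] {I : Ideal R} {c : R} (hc : c ∈ I) (hc' : c ∈ R⁰) :
    Ring.KrullDimLE 0 (R ⧸ I) := by
  refine Ring.KrullDimLE.mk₀ fun p hp => ?_
  have hcomap : (p.comap (Ideal.Quotient.mk I)).IsMaximal := by
    refine isMaximal_of_mem_nonZeroDivisors (a := c) ?_ hc'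
    rw [Ideal.mem_comap, Ideal.Quotient.eq_zero_iff_mem.mpr hc]
    exact zero_mem _
  exact Ideal.isMaximal_of_isIntegral_of_isMaximal_comap' (Ideal.Quotient.mk _)
    (RingHom.isIntegral_of_surjective _ Ideal.Quotient.mk_surjective) p hcomap

theorem isArtinianRing_quotient_of_mem_nonZeroDivisors {R : Type*} [CommRing R] [IsNoetherianRing R]
    [Ring.KrullDimLE 1 R] {I : Ideal R} {c : R} (hc : c ∈ I) (hc' : c ∈ R⁰) :
    IsArtinianRing (R ⧸ I) :=
  (isArtinianRing_iff_isNoetherianRing_krullDimLE_zero (R := R ⧸ I)).mpr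
    ⟨inferInstance, krullDimLE_zero_quotient_of_mem_nonZeroDivisors hc hc'⟩

/-- The singular locus is closed and contains no minimal prime, since a reduced ring localizes to a
field there. -/
theorem exists_mem_vanishingIdeal_singularLocus {R : Type u} [CommRing R] [IsNoetherianRing R]
    [IsReduced R] (hopen : IsOpen (regularLocus R)) :
    ∃ a ∈ PrimeSpectrum.vanishingIdeal (singularLocus R), a ∈ R⁰ := by
  refine exists_mem_nonZeroDivisors_of_forall_not_le fun p hp hle => ?_
  have hprime := hp.isPrime
  have hclosed : IsClosed (singularLocus R) := by
    rw [← isOpen_compl_iff]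
    convert hopen using 1
    ext x
    simp [singularLocus, regularLocus]
  have hmem : (⟨p, hprime⟩ : PrimeSpectrum R) ∈ singularLocus R := by
    rw [← hclosed.closure_eq, ← PrimeSpectrum.zeroLocus_vanishingIdeal_eq_closure]
    exact hle
  exact hmem (isRegularLocalRing_of_mem_minimalPrimes hp)

/-! ### The endomorphism ring of the singular ideal -/

section Sharp

variable {O : Type u} [CommRing O] {S : Subalgebra O (FractionRing O)} [IsReduced O]
  [IsNoetherianRing S]

theorem exists_mem_singularIdeal (hopen : IsOpen (regularLocus S)) :
    ∃ a ∈ singularIdeal S, a ∈ S⁰ :=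
  exists_mem_vanishingIdeal_singularLocus hopen

omit [IsNoetherianRing S] [IsReduced O] in
theorem mem_sharp_iff {x : FractionRing O} : x ∈ sharp S ↔
    ∀ z ∈ singularIdeal S, ∃ r ∈ singularIdeal S,
      x * algebraMap S (FractionRing O) z = algebraMap S (FractionRing O) r := Iff.rfl

theorem sharp_le_normalization (hopen : IsOpen (regularLocus S)) (hS : S ≤ normalization O) :
    sharp S ≤ normalization O := fun x hx => by
  obtain ⟨a, ha, ha'⟩ := exists_mem_singularIdeal hopen
  have hint : Algebra.IsIntegral O S := ⟨fun x => (isIntegral_algebraMap_iff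
    (B := FractionRing O) Subtype.val_injective).mp (hS x.2)⟩
  exact isIntegral_trans (A := S) x (isIntegral_of_forall_mul_mem ha ha' hx)

omit [IsReduced O] in
-- At a singular m, take x ∉ S with x m ⊆ S. Then x m ⊆ m, as otherwise m would be invertible and so
-- regular. Such an x preserves the whole singular ideal, so it lies in sharp S ≤ S.
theorem isRegularLocalRing_of_sharp_le [Ring.KrullDimLE 1 S] (h : sharp S ≤ S) {m : Ideal S}
    [m.IsPrime] {a : S} (ha : a ∈ m) (ha' : a ∈ S⁰) :
    IsRegularLocalRing (Localization.AtPrime m) := by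
  by_contra hsing
  obtain ⟨x, hxS, hx⟩ := exists_notMem_range_forall_mul_mem_range (K := FractionRing O) ha ha'
  have hmax := isMaximal_of_mem_nonZeroDivisors ha ha'
  have hIm : singularIdeal S ≤ m := fun z hz =>
    (PrimeSpectrum.mem_vanishingIdeal _ _).mp hz ⟨m, inferInstance⟩ hsing
  have hxm : ∀ z ∈ m, ∃ r ∈ m,
      x * algebraMap S (FractionRing O) z = algebraMap S (FractionRing O) r := by
    intro z hz
    obtain ⟨r, hr⟩ := hx z hz
    refine ⟨r, ?_, hr.symm⟩
    by_contra hrm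
    exact hsing (IsInvertibleAt.isRegularLocalRing ha ha' ⟨x, hx, z, hz, r, hrm, hr.symm⟩)
  refine hxS (mem_range_algebraMap_iff.mpr (h (mem_sharp_iff.mpr fun z hz => ?_)))
  obtain ⟨r, hr, hzr⟩ := hxm z (hIm hz)
  refine ⟨r, (PrimeSpectrum.mem_vanishingIdeal _ _).mpr fun m' hm' => ?_, hzr⟩
  -- At a singular m' not containing m, an s in m outside m' gives s r = (x s) z ∈ m', hence r ∈ m'.
  by_cases hmm : m ≤ m'.asIdeal
  · exact hmm hr
  obtain ⟨s, hs, hsm⟩ := SetLike.not_le_iff_exists.mp hmm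
  obtain ⟨s', -, hs'⟩ := hxm s hs
  have hsr : s * r = s' * z := by
    apply IsFractionRing.injective S (FractionRing O)
    rw [map_mul, map_mul, ← hs', ← hzr]
    ring
  have hz' := (PrimeSpectrum.mem_vanishingIdeal _ _).mp hz m' hm'
  exact (m'.2.mem_or_mem (hsr ▸ Ideal.mul_mem_left _ _ hz')).resolve_left hsm

omit [IsReduced O] in
theorem normalization_le_of_sharp_le [Ring.KrullDimLE 1 S] (h : sharp S ≤ S) :
    normalization O ≤ S := fun x hx =>
  mem_range_algebraMap_iff.mp (mem_range_of_isIntegral (R := S)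
    (fun _ _ ⟨_, ha, ha'⟩ => isRegularLocalRing_of_sharp_le h ha ha')
    (IsIntegral.tower_top (show IsIntegral O x from hx)))

theorem isSemisimpleRing_quotient_singularIdeal [Ring.KrullDimLE 1 S]
    (hopen : IsOpen (regularLocus S)) : IsSemisimpleRing (S ⧸ singularIdeal S) := by
  obtain ⟨a, ha, ha'⟩ := exists_mem_singularIdeal hopen
  have : IsReduced (S ⧸ singularIdeal S) :=
    (Ideal.isRadical_iff_quotient_reduced _).mp (PrimeSpectrum.isRadical_vanishingIdeal _)
  have : IsArtinianRing (S ⧸ singularIdeal S) :=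
    isArtinianRing_quotient_of_mem_nonZeroDivisors ha ha'
  exact IsArtinianRing.isSemisimpleRing_of_isReduced (S ⧸ singularIdeal S)

end Sharp

/-! ### Termination and strictness of the chain of overrings; artinian quotients -/

section Chain

variable {O : Type u} [CommRing O]

theorem singularIdeal_le_conductorIdeal (k : ℕ) :
    singularIdeal (overring O k) ≤ conductorIdeal O k := fun r hr x hx => by
  obtain ⟨s, -, hs⟩ := mem_sharp_iff.mp hx r hr
  rw [mul_comm]
  exact hs ▸ s.2

variable [IsReduced O] [IsNoetherianRing O] [Ring.KrullDimLE 1 O]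
  [Module.Finite O (normalization O)]

omit [Ring.KrullDimLE 1 O] in
theorem overring_le_normalization (hreg : ∀ S : Subalgebra O (FractionRing O),
    Algebra.FiniteType O S → IsOpen (regularLocus S)) (k : ℕ) :
    overring O k ≤ normalization O := by
  induction k with
  | zero => exact bot_le
  | succ k ih =>
    have := finite_of_le_normalization ih
    have := IsNoetherianRing.of_finite O (overring O k)
    exact sharp_le_normalization (hreg _ inferInstance) ih

theorem overring_eq_normalization_of_le (hreg : ∀ S : Subalgebra O (FractionRing O),
    Algebra.FiniteType O S → IsOpen (regularLocus S)) {k : ℕ}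
    (h : overring O (k + 1) ≤ overring O k) : overring O k = normalization O := by
  have hle := overring_le_normalization hreg k
  have := finite_of_le_normalization hle
  have := IsNoetherianRing.of_finite O (overring O k)
  have := krullDimLE_one_of_le_normalization hle
  exact le_antisymm hle (normalization_le_of_sharp_le h)

/-- The chain lies in the normalization, a Noetherian O-module, so it becomes stationary, and it can
do so only at the normalization. -/
theorem overring_level (hreg : ∀ S : Subalgebra O (FractionRing O),
    Algebra.FiniteType O S → IsOpen (regularLocus S)) :
    overring O (level O) = normalization O := by
  suffices h : ∃ n, overring O n = normalization O from Nat.sInf_mem h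
  let f : ℕ →o Submodule O (normalization O) :=
    ⟨fun n => (Subalgebra.toSubmodule (overring O n)).comap (normalization O).val.toLinearMap,
      fun _ _ h => Submodule.comap_mono (overring_mono O h)⟩
  obtain ⟨n, hn⟩ := monotone_stabilizes_iff_noetherian.mpr
    (isNoetherian_of_isNoetherianRing_of_finite O (normalization O)) f
  refine ⟨n, overring_eq_normalization_of_le hreg fun x hx => ?_⟩
  have hx' : (⟨x, overring_le_normalization hreg _ hx⟩ : normalization O) ∈ f (n + 1) := hx
  rw [← hn (n + 1) n.le_succ] at hx'
  exact hx'

theorem not_overring_succ_le (hreg : ∀ S : Subalgebra O (FractionRing O),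
    Algebra.FiniteType O S → IsOpen (regularLocus S)) {k : ℕ} (hk : k < level O) :
    ¬ overring O (k + 1) ≤ overring O k := fun h =>
  Nat.notMem_of_lt_sInf hk (overring_eq_normalization_of_le hreg h)

theorem isSemisimpleRing_quotient_conductorIdeal (hreg : ∀ S : Subalgebra O (FractionRing O),
    Algebra.FiniteType O S → IsOpen (regularLocus S)) (k : ℕ) :
    IsSemisimpleRing (overring O k ⧸ conductorIdeal O k) := by
  have hle := overring_le_normalization hreg k
  have := finite_of_le_normalization hle
  have := IsNoetherianRing.of_finite O (overring O k)
  have := krullDimLE_one_of_le_normalization hle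
  have := isSemisimpleRing_quotient_singularIdeal (S := overring O k) (hreg _ inferInstance)
  exact RingHom.isSemisimpleRing_of_surjective
    (Ideal.Quotient.factor (singularIdeal_le_conductorIdeal k))
    (Ideal.Quotient.factor_surjective _)

theorem isRegularRing_normalization : IsRegularRing (normalization O) := by
  have := IsNoetherianRing.of_finite O (normalization O)
  have := krullDimLE_one_of_le_normalization (le_refl (normalization O))
  refine isRegularRing_of_forall_isIntegral (FractionRing O) fun y hy => ?_
  exact mem_range_algebraMap_iff.mpr (isIntegral_trans (A := normalization O) y hy)

theorem projective_ideal_normalization (I : Ideal (normalization O)) :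
    Module.Projective (normalization O) I := by
  have := isRegularRing_normalization (O := O)
  have := krullDimLE_one_of_le_normalization (le_refl (normalization O))
  exact projective_ideal_of_isRegularRing I

theorem level_pos (hreg : ∀ S : Subalgebra O (FractionRing O),
    Algebra.FiniteType O S → IsOpen (regularLocus S)) (hsing : ¬ IsRegularRing O) :
    0 < level O := by
  rw [Nat.pos_iff_ne_zero]
  intro h0
  have h := overring_level hreg
  rw [h0] at h
  have h1 : IsRegularRing (⊥ : Subalgebra O (FractionRing O)) := show IsRegularRing (overring O 0)
      from h ▸ isRegularRing_normalization
  exact hsing (IsRegularRing.of_ringEquiv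
    (Algebra.botEquivOfInjective (IsFractionRing.injective O (FractionRing O))).toRingEquiv)

omit [IsReduced O] [IsNoetherianRing O] [Ring.KrullDimLE 1 O] in
theorem exists_conducts_normalization : ∃ c ∈ O⁰,
    Conducts (normalization O) ⊥ (algebraMap O (FractionRing O) c) := by
  obtain ⟨s, hs⟩ : (Subalgebra.toSubmodule (normalization O)).FG :=
    Module.Finite.iff_fg.mp ‹Module.Finite O (normalization O)›
  obtain ⟨c, hc⟩ := IsLocalization.exist_integer_multiples_of_finset O⁰ s
  refine ⟨c, c.2, fun x hx => ?_⟩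
  have hx' : x ∈ Submodule.span O (s : Set (FractionRing O)) := hs.ge hx
  have hle : Submodule.span O (s : Set (FractionRing O)) ≤
      (Subalgebra.toSubmodule ⊥).comap (LinearMap.lsmul O (FractionRing O) c) := by
    refine Submodule.span_le.mpr fun y hy => ?_
    obtain ⟨z, hz⟩ := hc y hy
    exact Algebra.mem_bot.mpr ⟨z, hz⟩
  rw [← Algebra.smul_def]
  exact hle hx'

theorem isArtinian_of_smul_eq_zero {R M : Type*} [CommRing R] [IsNoetherianRing R]
    [Ring.KrullDimLE 1 R] [AddCommGroup M] [Module R M] [Module.Finite R M] {c : R} (hc : c ∈ R⁰)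
    (h : ∀ x : M, c • x = 0) : IsArtinian R M := by
  have : IsArtinianRing (R ⧸ Ideal.span {c}) :=
    isArtinianRing_quotient_of_mem_nonZeroDivisors (Ideal.mem_span_singleton_self c) hc
  have htors : Module.IsTorsionBySet R M (Ideal.span {c} : Ideal R) := by
    rintro x ⟨d, hd⟩
    obtain ⟨e, rfl⟩ := Ideal.mem_span_singleton'.mp hd
    change (e * c) • x = 0
    rw [mul_smul, h, smul_zero]
  let := htors.module
  have : IsScalarTower R (R ⧸ Ideal.span {c}) M := htors.isScalarTower
  have : Module.Finite (R ⧸ Ideal.span {c}) M := Module.Finite.of_restrictScalars_finite R _ _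
  have : IsArtinian (R ⧸ Ideal.span {c}) M := isArtinian_of_fg_of_artinian'
  exact isArtinian_of_surjective_algebraMap (R := R ⧸ Ideal.span {c}) Ideal.Quotient.mk_surjective

noncomputable instance (n : ℕ) : Algebra O (KoenigOrder O n) :=
  inferInstanceAs (Algebra O (Module.End O ((i : Fin (n + 1)) → overring O i))ᵐᵒᵖ)

omit [IsReduced O] [IsNoetherianRing O] [Ring.KrullDimLE 1 O]
  [Module.Finite O (normalization O)] in
theorem KoenigOrder.entry_smul {n : ℕ} (c : O) (a : KoenigOrder O n) (i j : Fin (n + 1)) :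
    (c • a).entry i j = algebraMap O (FractionRing O) c * a.entry i j :=
  Algebra.smul_def _ _

section Quotient

variable {n : ℕ} (hn : ∀ k ≤ n, overring O k ≤ normalization O)

include hn

omit [IsReduced O] [Ring.KrullDimLE 1 O] in
theorem finite_koenigQuotient : Module.Finite O (KoenigQuotient O n) := by
  have (i : Fin (n + 1)) : Module.Finite O (overring O i) :=
    finite_of_le_normalization (hn i (Nat.lt_succ_iff.mp i.2))
  have : Module.Finite O (Module.End O ((i : Fin (n + 1)) → overring O i)) := inferInstance
  have : Module.Finite O (KoenigOrder O n) :=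
    Module.Finite.equiv (MulOpposite.opLinearEquiv O :
      Module.End O ((i : Fin (n + 1)) → overring O i) ≃ₗ[O] _)
  exact Module.Finite.of_surjective
    ({ (koenigKernel O n).ringCon.mk' with map_smul' := fun c a => rfl } :
      KoenigOrder O n →ₗ[O] KoenigQuotient O n) (mk'_surjective _)

omit [IsReduced O] [IsNoetherianRing O] [Ring.KrullDimLE 1 O] in
-- If c carries the normalization into O, then c a is a matrix whose rows all extend to O_{n+1}, so
-- c A ⊆ J.
theorem exists_smul_koenigQuotient_eq_zero :
    ∃ c ∈ O⁰, ∀ x : KoenigQuotient O n, c • x = 0 := by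
  obtain ⟨c, hc, h⟩ := exists_conducts_normalization (O := O)
  refine ⟨c, hc, fun x => ?_⟩
  obtain ⟨a, rfl⟩ := mk'_surjective _ x
  change (koenigKernel O n).ringCon.mk' (c • a) = 0
  rw [mk'_eq_zero_iff, ← koenigIdeal_self, mem_koenigIdeal le_rfl]
  intro i _ j
  rw [KoenigOrder.entry_smul]
  exact Conducts.mul (S := overring O i)
    (fun x hx => overring_mono O (Nat.zero_le i) (h x (hn n le_rfl hx))) (a.conducts_entry i j)

omit [IsReduced O] in
theorem isArtinian_koenigQuotient : IsArtinian O (KoenigQuotient O n) := by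
  have := finite_koenigQuotient hn
  obtain ⟨c, hc, h⟩ := exists_smul_koenigQuotient_eq_zero hn
  exact isArtinian_of_smul_eq_zero hc h

omit [IsReduced O] in
theorem isArtinianRing_koenigQuotient : IsArtinianRing (KoenigQuotient O n) :=
  have := isArtinian_koenigQuotient hn
  isArtinian_of_tower O this

omit [IsReduced O] in
theorem isArtinianRing_op_koenigQuotient : IsArtinianRing (KoenigQuotient O n)ᵐᵒᵖ :=
  have := isArtinian_koenigQuotient hn
  have : IsArtinian O (KoenigQuotient O n)ᵐᵒᵖ :=
    isArtinian_of_linearEquiv (MulOpposite.opLinearEquiv O)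
  isArtinian_of_tower O this

end Quotient

end Chain

end Koenig

namespace Koenig

/-! ### Rings complete for a principal ideal -/

section Adic

variable {A : Type*} [CommRing A] {a : A}

theorem mem_span_singleton_pow_smul_top {M : Type*} [AddCommGroup M] [Module A M] {n : ℕ} {x : M} :
    x ∈ (Ideal.span {a} ^ n • ⊤ : Submodule A M) ↔ ∃ y, x = a ^ n • y := by
  rw [Ideal.span_singleton_pow, Submodule.ideal_span_singleton_smul,
    Submodule.mem_smul_pointwise_iff_exists]
  simp [eq_comm]

/-- The inclusions I^k ⊆ (a) ⊆ I make the two adic topologies equal. -/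
theorem isAdicComplete_span_singleton {I : Ideal A} [IsAdicComplete I A] (ha : a ∈ I) {k : ℕ}
    (hk : I ^ k ≤ Ideal.span {a}) : IsAdicComplete (Ideal.span {a}) A := by
  have hle (n : ℕ) : Ideal.span {a} ^ n ≤ I ^ n :=
    Ideal.pow_right_mono ((Ideal.span_singleton_le_iff_mem _).mpr ha) n
  have hle' (n : ℕ) : I ^ (k * n) ≤ Ideal.span {a} ^ n := by
    rw [pow_mul]
    exact Ideal.pow_right_mono hk n
  have hhaus : IsHausdorff I A := inferInstance
  have hprec : IsPrecomplete I A := inferInstance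
  refine { haus' := fun x hx => hhaus.haus x fun n => ?_, prec' := fun f hf => ?_ }
  · have h := hx n
    rw [SModEq.zero, smul_eq_mul, Ideal.mul_top] at h ⊢
    exact hle n h
  · simp only [SModEq.sub_mem, smul_eq_mul, Ideal.mul_top] at hf
    obtain ⟨L, hL⟩ := hprec.prec (f := f) fun {m n} hmn => by
      rw [SModEq.sub_mem, smul_eq_mul, Ideal.mul_top]
      exact hle m (hf hmn)
    simp only [SModEq.sub_mem, smul_eq_mul, Ideal.mul_top] at hL
    refine ⟨L, fun n => ?_⟩
    rw [SModEq.sub_mem, smul_eq_mul, Ideal.mul_top]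
    have h1 := hf (m := n) (n := max n (k * n)) (le_max_left _ _)
    have h2 := hle' n (Ideal.pow_le_pow_right (le_max_right n (k * n)) (hL (max n (k * n))))
    rw [← sub_add_sub_cancel]
    exact add_mem h1 h2

theorem isPrecomplete_pi [IsPrecomplete (Ideal.span {a}) A] (ι : Type*) :
    IsPrecomplete (Ideal.span {a}) (ι → A) := by
  refine ⟨fun f hf => ?_⟩
  have h (i : ι) : ∃ L : A, ∀ n, f n i ≡ L [SMOD (Ideal.span {a} ^ n • ⊤ : Submodule A A)] := by
    refine IsPrecomplete.prec ‹_› (f := fun n => f n i) fun {m n} hmn => ?_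
    have := hf hmn
    rw [SModEq.sub_mem, mem_span_singleton_pow_smul_top] at this ⊢
    obtain ⟨y, hy⟩ := this
    exact ⟨y i, congrFun hy i⟩
  choose L hL using h
  refine ⟨L, fun n => ?_⟩
  simp only [SModEq.sub_mem, mem_span_singleton_pow_smul_top] at hL ⊢
  choose y hy using hL
  exact ⟨fun i => y i n, funext fun i => hy i n⟩

theorem isHausdorff_submodule {I : Ideal A} [IsHausdorff I A] (N : Ideal A) : IsHausdorff I N := by
  refine ⟨fun x hx => Subtype.ext (IsHausdorff.haus (I := I) ‹_› _ fun n => ?_)⟩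
  have h := hx n
  rw [SModEq.zero] at h ⊢
  have h' := Submodule.mem_map_of_mem (f := N.subtype) h
  rw [Submodule.map_smul''] at h'
  exact Submodule.smul_mono le_rfl le_top h'

/-- An ideal which contains `x` as soon as it contains `a * x` is generated by any finite subset
that generates it modulo `a`. -/
theorem le_span_of_le_sup_span_singleton [IsAdicComplete (Ideal.span {a}) A] {N : Ideal A}
    (hN : ∀ x, a * x ∈ N → x ∈ N) {s : Finset A} (hs : Ideal.span (s : Set A) ≤ N)
    (h : N ≤ Ideal.span (s : Set A) ⊔ Ideal.span {a}) : N ≤ Ideal.span (s : Set A) := by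
  have := isPrecomplete_pi (a := a) s
  have := isHausdorff_submodule (I := Ideal.span {a}) N
  let f : (s → A) →ₗ[A] N := (Fintype.linearCombination A
    (fun i : s => (⟨i, hs (Ideal.subset_span i.2)⟩ : N)))
  have hf : Function.Surjective f := by
    refine surjective_of_mkQ_comp_surjective (I := Ideal.span {a}) fun y => ?_
    obtain ⟨x, rfl⟩ := Submodule.mkQ_surjective _ y
    obtain ⟨u, hu, v, hv, huv⟩ := Submodule.mem_sup.mp (h x.2)
    obtain ⟨c, hc⟩ := (Submodule.mem_span_finset' ).mp hu
    obtain ⟨w, rfl⟩ := Ideal.mem_span_singleton'.mp hv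
    -- Saturation makes the error a multiple of a inside N, not only inside A, as successive
    -- approximation in N requires.
    have hw : w ∈ N := by
      refine hN w ?_
      rw [mul_comm, ← add_sub_cancel_left u (w * a), huv]
      exact sub_mem x.2 (hs hu)
    refine ⟨c, ?_⟩
    rw [LinearMap.comp_apply, eq_comm, ← sub_eq_zero, ← map_sub, Submodule.mkQ_apply,
      Submodule.Quotient.mk_eq_zero]
    have hx : x - f c = a • (⟨w, hw⟩ : N) := by
      apply Subtype.ext
      have hfc : ((f c : N) : A) = u := by
        rw [← hc, Fintype.linearCombination_apply, AddSubmonoidClass.coe_finsetSum]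
        rfl
      rw [AddSubgroupClass.coe_sub, hfc, ← huv, add_sub_cancel_left]
      exact mul_comm _ _
    rw [hx]
    exact Submodule.smul_mem_smul (Ideal.mem_span_singleton_self a) trivial
  intro x hx
  obtain ⟨c, hc⟩ := hf ⟨x, hx⟩
  rw [← show ((f c : N) : A) = x from congrArg Subtype.val hc, Fintype.linearCombination_apply,
    AddSubmonoidClass.coe_finsetSum]
  exact sum_mem fun i _ => Ideal.mul_mem_left _ _ (Ideal.subset_span i.2)

/-- Says that inverting a leaves a ring of dimension zero. The a-saturations N n of (x^n) decrease,
so they stabilize modulo a; being saturated in a complete ring, they then stabilize themselves, and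
x^n ∈ N (n + 1). -/
theorem exists_pow_mul_pow_eq [IsAdicComplete (Ideal.span {a}) A]
    [IsArtinianRing (A ⧸ Ideal.span {a})] (x : A) :
    ∃ (M n : ℕ) (y : A), a ^ M * x ^ n = x ^ (n + 1) * y := by
  let N (n : ℕ) : Ideal A :=
    { carrier := {t | ∃ M, a ^ M * t ∈ Ideal.span {x ^ n}}
      add_mem' := by
        rintro s t ⟨M, hM⟩ ⟨M', hM'⟩
        refine ⟨M + M', ?_⟩
        have : a ^ (M + M') * (s + t) = a ^ M' * (a ^ M * s) + a ^ M * (a ^ M' * t) := by ring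
        rw [this]
        exact add_mem (Ideal.mul_mem_left _ _ hM) (Ideal.mul_mem_left _ _ hM')
      zero_mem' := ⟨0, by simp⟩
      smul_mem' := by
        rintro c t ⟨M, hM⟩
        refine ⟨M, ?_⟩
        rw [smul_eq_mul, mul_left_comm]
        exact Ideal.mul_mem_left _ _ hM }
  have hanti : Antitone N := antitone_nat_of_succ_le fun n t ⟨M, hM⟩ =>
    ⟨M, (Ideal.span_singleton_le_span_singleton.mpr (pow_dvd_pow x n.le_succ)) hM⟩
  have hsat (n : ℕ) (t : A) (ht : a * t ∈ N n) : t ∈ N n := by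
    obtain ⟨M, hM⟩ := ht
    exact ⟨M + 1, by rwa [pow_succ, mul_assoc]⟩
  obtain ⟨n, hn⟩ := IsArtinian.monotone_stabilizes (R := A ⧸ Ideal.span {a})
    (M := A ⧸ Ideal.span {a})
    ⟨fun n => OrderDual.toDual ((N n).map (Ideal.Quotient.mk (Ideal.span {a}))),
      fun _ _ h => Ideal.map_mono (hanti h)⟩
  have hn' : (N n).map (Ideal.Quotient.mk (Ideal.span {a})) =
    (N (n + 1)).map (Ideal.Quotient.mk (Ideal.span {a})) := hn (n + 1) n.le_succ
  obtain ⟨s, hs, hs'⟩ : ∃ s : Finset A, Ideal.span (s : Set A) ≤ N (n + 1) ∧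
      N (n + 1) ≤ Ideal.span (s : Set A) ⊔ Ideal.span {a} := by
    have hfg : ((N (n + 1)).map (Ideal.Quotient.mk (Ideal.span {a}))).FG :=
      IsNoetherian.noetherian _
    classical
    obtain ⟨t, ht, hspan⟩ := (Submodule.fg_span_iff_fg_span_finset_subset _).mp hfg
    obtain ⟨s, hs, rfl⟩ := Finset.subset_set_image_iff.mp ht
    refine ⟨s, Ideal.span_le.mpr hs, ?_⟩
    rw [← Ideal.mk_ker (I := Ideal.span {a}),
      ← Ideal.comap_map_of_surjective' _ Ideal.Quotient.mk_surjective, ← Ideal.map_le_iff_le_comap,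
      Ideal.map_span, ← Finset.coe_image]
    exact hspan.le
  have key : N n ≤ Ideal.span (s : Set A) := by
    refine le_span_of_le_sup_span_singleton (hsat n) (hs.trans (hanti n.le_succ)) ?_
    have := Ideal.comap_mono (f := Ideal.Quotient.mk (Ideal.span {a})) hn'.le
    rw [Ideal.comap_map_of_surjective' _ Ideal.Quotient.mk_surjective,
      Ideal.comap_map_of_surjective' _ Ideal.Quotient.mk_surjective, Ideal.mk_ker] at this
    exact le_sup_left.trans (this.trans (sup_le hs' le_sup_right))
  have hx : x ^ n ∈ N n := ⟨0, by simp⟩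
  obtain ⟨M, hM⟩ := hs (key hx)
  obtain ⟨y, hy⟩ := Ideal.mem_span_singleton'.mp hM
  exact ⟨M, n, y, by rw [← hy, mul_comm]⟩

/-- A form of Chevalley's theorem. -/
theorem exists_le_of_iInf_eq_bot [IsAdicComplete (Ideal.span {a}) A]
    (hart : ∀ k, IsArtinianRing (A ⧸ Ideal.span {a ^ k})) {N : ℕ → Ideal A} (hN : Antitone N)
    (hpow : ∀ n, a ^ n ∈ N n) (h : ⨅ n, N n = ⊥) : ∃ n, N n ≤ Ideal.span {a} := by
  by_contra! hcon
  -- The Mittag-Leffler condition modulo each power of a.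
  have hstab (k : ℕ) : ∃ n, ∀ m, n ≤ m → N n ⊔ Ideal.span {a ^ k} = N m ⊔ Ideal.span {a ^ k} := by
    have := hart k
    obtain ⟨n, hn⟩ := IsArtinian.monotone_stabilizes (R := A ⧸ Ideal.span {a ^ k})
      (M := A ⧸ Ideal.span {a ^ k})
      ⟨fun n => OrderDual.toDual ((N n).map (Ideal.Quotient.mk (Ideal.span {a ^ k}))),
        fun _ _ h => Ideal.map_mono (hN h)⟩
    refine ⟨n, fun m hm => ?_⟩
    have h1 : (N n).map (Ideal.Quotient.mk (Ideal.span {a ^ k})) =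
      (N m).map (Ideal.Quotient.mk (Ideal.span {a ^ k})) := hn m hm
    have h2 := congrArg (Ideal.comap (Ideal.Quotient.mk (Ideal.span {a ^ k}))) h1
    rwa [Ideal.comap_map_of_surjective' _ Ideal.Quotient.mk_surjective,
      Ideal.comap_map_of_surjective' _ Ideal.Quotient.mk_surjective, Ideal.mk_ker] at h2
  choose n hn using hstab
  have hmem {k : ℕ} {x : A} (m : ℕ) (hm : n k ≤ m) (hx : x ∈ N m) (l : ℕ) :
      x ∈ N l ⊔ Ideal.span {a ^ k} := by
    have h1 : x ∈ N (n k) ⊔ Ideal.span {a ^ k} := Submodule.mem_sup_left (hN hm hx)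
    rw [hn k (max (n k) l) (le_max_left _ _)] at h1
    exact sup_le_sup_right (hN (le_max_right _ _)) _ h1
  -- Elements of the stable images lift from level k to level k + 1, which produces a Cauchy
  -- sequence starting at an x₀ outside (a).
  have hstep (k : ℕ) (x : {x : A // ∀ l, x ∈ N l ⊔ Ideal.span {a ^ k}}) :
      ∃ y : {x : A // ∀ l, x ∈ N l ⊔ Ideal.span {a ^ (k + 1)}},
        (x : A) - y ∈ Ideal.span {a ^ k} := by
    obtain ⟨y, hy, z, hz, hyz⟩ := Submodule.mem_sup.mp (x.2 (n (k + 1)))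
    exact ⟨⟨y, hmem _ le_rfl hy⟩, by rwa [← hyz, add_sub_cancel_left]⟩
  choose g hg using hstep
  obtain ⟨x₀, hx₀, hx₀a⟩ := SetLike.not_le_iff_exists.mp (hcon (n 1))
  let X : (k : ℕ) → {x : A // ∀ l, x ∈ N l ⊔ Ideal.span {a ^ (k + 1)}} := fun k =>
    k.rec ⟨x₀, hmem (k := 1) _ le_rfl hx₀⟩ fun k x => g (k + 1) x
  have hX (k : ℕ) : (X k).1 - (X (k + 1)).1 ∈ Ideal.span {a ^ (k + 1)} := by
    exact hg (k + 1) (X k)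
  have hcauchy {m n : ℕ} (hmn : m ≤ n) : (X m).1 - (X n).1 ∈ Ideal.span {a ^ m} := by
    induction n, hmn using Nat.le_induction with
    | base => rw [sub_self]; exact zero_mem _
    | succ n hmn ih =>
      rw [← sub_add_sub_cancel]
      exact add_mem ih ((Ideal.span_singleton_le_span_singleton.mpr
        (pow_dvd_pow a (hmn.trans n.le_succ))) (hX n))
  obtain ⟨L, hL⟩ := IsPrecomplete.prec (I := Ideal.span {a}) inferInstance (f := fun k => (X k).1)
    fun {m n} hmn => by
      rw [SModEq.sub_mem, smul_eq_mul, Ideal.mul_top, Ideal.span_singleton_pow]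
      exact hcauchy hmn
  simp only [SModEq.sub_mem, smul_eq_mul, Ideal.mul_top, Ideal.span_singleton_pow] at hL
  -- Each N l contains a^l, so it is closed and contains the limit.
  have hL0 : L = 0 := by
    rw [← Ideal.mem_bot, ← h, Submodule.mem_iInf]
    intro l
    have h1 : (X l).1 ∈ N l := by
      have hle : Ideal.span {a ^ (l + 1)} ≤ N l := by
        refine (Ideal.span_singleton_le_iff_mem _).mpr ?_
        rw [pow_succ]
        exact Ideal.mul_mem_right _ _ (hpow l)
      exact sup_le le_rfl hle ((X l).2 l)
    have h2 : (X l).1 - L ∈ N l := (Ideal.span_singleton_le_iff_mem _).mpr (hpow l) (hL l)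
    rw [← sub_sub_cancel (X l).1 L]
    exact sub_mem h1 h2
  refine hx₀a ?_
  have h1 : x₀ - (X 1).1 ∈ Ideal.span {a ^ 1} := hX 0
  have h2 := hL 1
  rw [hL0, sub_zero, pow_one] at h2
  rw [pow_one] at h1
  have h3 := add_mem h1 h2
  rwa [sub_add_cancel] at h3

/-- By `hreg` the image ζ of z has a support idempotent e. Divisibility of ζ by high powers of a
makes e/a integral over A, and its equation becomes e (1 + a t) = 0. So e = 0 and ζ is nilpotent. -/
theorem eq_zero_of_forall_exists_isIntegral {F : Type*} [CommRing F] [IsReduced F] [Algebra A F]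
    (ha : IsUnit (algebraMap A F a)) (hunit : ∀ t, IsUnit (1 + a * t)) {z : A}
    (hreg : ∃ (M n : ℕ) (y : A), a ^ M * z ^ n = z ^ (n + 1) * y)
    (hz : ∀ N : ℕ, ∃ b : F, IsIntegral A b ∧ algebraMap A F z = algebraMap A F a ^ N * b) :
    algebraMap A F z = 0 := by
  obtain ⟨M, n, y, hy⟩ := hreg
  obtain ⟨u, hu⟩ := ha
  set ζ := algebraMap A F z
  have hζ : (u : F) ^ M * ζ ^ (n + 1) = ζ ^ (n + 1) * ζ * algebraMap A F y := by
    have := congrArg (algebraMap A F) hy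
    simp only [map_mul, map_pow, ← hu] at this
    rw [pow_succ, ← mul_assoc, this]
    ring
  obtain ⟨η, hη_def⟩ : ∃ η : F, η = ↑u⁻¹ ^ M * algebraMap A F y := ⟨_, rfl⟩
  have hη : ζ ^ (n + 1) * (ζ * η) = ζ ^ (n + 1) := by
    have h1 : (↑u⁻¹ : F) ^ M * (u : F) ^ M = 1 := by
      rw [← mul_pow, Units.inv_mul, one_pow]
    calc ζ ^ (n + 1) * (ζ * η) = ↑u⁻¹ ^ M * (ζ ^ (n + 1) * ζ * algebraMap A F y) := by
          rw [hη_def]; ring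
      _ = ζ ^ (n + 1) := by rw [← hζ, ← mul_assoc, h1, one_mul]
  have hη' (k : ℕ) : ζ ^ (n + 1) * (ζ * η) ^ k = ζ ^ (n + 1) := by
    induction k with
    | zero => rw [pow_zero, mul_one]
    | succ k ih => rw [pow_succ (ζ * η), ← mul_assoc, ih, hη]
  obtain ⟨e, he_def⟩ : ∃ e, e = (ζ * η) ^ (n + 1) := ⟨_, rfl⟩
  have he : IsIdempotentElem e := by
    change e * e = e
    calc e * e = ζ ^ (n + 1) * (ζ * η) ^ (n + 1) * η ^ (n + 1) := by rw [he_def]; ring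
      _ = e := by rw [hη', he_def, mul_pow]
  suffices h0 : e = 0 by
    have := hη' (n + 1)
    rw [← he_def, h0, mul_zero] at this
    exact IsNilpotent.eq_zero ⟨n + 1, this.symm⟩
  -- The factor η^(n+1) of e has denominator a^(M(n+1)); the extra 1 pays for dividing e by a.
  obtain ⟨b, hb, hzb⟩ := hz (M * (n + 1) + 1)
  have heu : IsIntegral A (e * ↑u⁻¹) := by
    have : e * ↑u⁻¹ = b * (ζ ^ n * algebraMap A F (y ^ (n + 1))) := by
      have h1 : (↑u⁻¹ : F) ^ (M * (n + 1) + 1) * (u : F) ^ (M * (n + 1) + 1) = 1 := by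
        rw [← mul_pow, Units.inv_mul, one_pow]
      calc e * ↑u⁻¹ = ↑u⁻¹ ^ (M * (n + 1) + 1) * ζ * (ζ ^ n * algebraMap A F (y ^ (n + 1))) := by
            rw [he_def, hη_def, map_pow]; ring
        _ = _ := by rw [hzb, ← hu, ← mul_assoc (_ ^ _), h1, one_mul]
    rw [this, ← map_pow, ← map_mul]
    exact hb.mul isIntegral_algebraMap
  obtain ⟨p, hp, hpe⟩ := heu
  rw [← Polynomial.aeval_def, Polynomial.aeval_eq_sum_range] at hpe
  set d := p.natDegree
  have hterm (i : ℕ) (hi : i ∈ Finset.range (d + 1)) :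
      e * (u : F) ^ d * (p.coeff i • (e * ↑u⁻¹) ^ i) = e * algebraMap A F (a ^ (d - i) * p.coeff i) := by
    obtain ⟨j, hj⟩ := Nat.exists_eq_add_of_le (Nat.lt_succ_iff.mp (Finset.mem_range.mp hi))
    have h1 : (u : F) ^ i * ↑u⁻¹ ^ i = 1 := by rw [← mul_pow, Units.mul_inv, one_pow]
    have h2 : e * e ^ i = e := by rw [← pow_succ', he.pow_succ_eq]
    rw [hj, Nat.add_sub_cancel_left, map_mul, map_pow, ← hu, Algebra.smul_def]
    calc _ = (e * e ^ i) * ((u : F) ^ i * ↑u⁻¹ ^ i) * (u : F) ^ j * algebraMap A F (p.coeff i) := by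
          ring
      _ = _ := by rw [h1, h2]; ring
  have hsum := congrArg (fun x => e * (u : F) ^ d * x) hpe
  simp only [mul_zero, Finset.mul_sum] at hsum
  rw [Finset.sum_congr rfl hterm, ← Finset.mul_sum, ← map_sum] at hsum
  obtain ⟨t, ht⟩ : ∃ t, ∑ i ∈ Finset.range (d + 1), a ^ (d - i) * p.coeff i = 1 + a * t := by
    refine ⟨∑ i ∈ Finset.range d, a ^ (d - i - 1) * p.coeff i, ?_⟩
    rw [Finset.sum_range_succ, Nat.sub_self, pow_zero, one_mul, hp.coeff_natDegree, add_comm,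
      Finset.mul_sum]
    congr 1
    refine Finset.sum_congr rfl fun i hi => ?_
    rw [← mul_assoc, ← pow_succ', Nat.sub_add_cancel
      (Nat.le_sub_of_add_le (by rw [add_comm]; exact Finset.mem_range.mp hi))]
  rw [ht] at hsum
  exact ((hunit t).map (algebraMap A F)).mul_left_eq_zero.mp hsum

end Adic

/-! ### Rings of dimension zero -/

section RegularDimensionZero

/-- Each local ring has embedding dimension equal to its dimension 0, so it is a field. -/
theorem isReduced_of_isRegularRing_of_krullDimLE_zero {F : Type*} [CommRing F] [IsRegularRing F]
    [Ring.KrullDimLE 0 F] : IsReduced F := by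
  refine isReduced_ofLocalizationMaximal F fun m hm => ?_
  have hreg : IsRegularLocalRing (Localization.AtPrime m) := inferInstance
  have hdim : ringKrullDim (Localization.AtPrime m) = 0 := by
    rw [IsLocalization.AtPrime.ringKrullDim_eq_height m,
      Ideal.height_eq_zero_iff.mpr (Ideal.mem_minimalPrimes_of_krullDimLE_zero m)]
    rfl
  have h0 := hreg.spanFinrank_maximalIdeal.trans hdim
  have hbot : IsLocalRing.maximalIdeal (Localization.AtPrime m) = ⊥ :=
    (Submodule.spanFinrank_eq_zero_iff_eq_bot (IsNoetherian.noetherian _)).mp (by exact_mod_cast h0)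
  have := (IsLocalRing.isField_iff_maximalIdeal_eq.mpr hbot).isDomain
  infer_instance

theorem krullDimLE_zero_of_forall_exists_pow_eq {F : Type*} [CommRing F]
    (h : ∀ f : F, ∃ (n : ℕ) (g : F), f ^ n = f ^ (n + 1) * g) : Ring.KrullDimLE 0 F := by
  refine Ring.KrullDimLE.mk₀ fun p hp => ?_
  rw [Ideal.isMaximal_iff]
  refine ⟨(Ideal.ne_top_iff_one p).mp hp.ne_top, fun J f hpJ hf hfJ => ?_⟩
  obtain ⟨n, g, hg⟩ := h f
  have h1 : f ^ n * (1 - f * g) ∈ p := by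
    have : f ^ n * (1 - f * g) = 0 := by rw [mul_sub, mul_one, ← mul_assoc, ← pow_succ, ← hg, sub_self]
    rw [this]
    exact zero_mem _
  have h2 := (hp.mem_or_mem h1).resolve_left fun h => hf (hp.mem_of_pow_mem n h)
  rw [← sub_add_cancel 1 (f * g)]
  exact add_mem (hpJ h2) (Ideal.mul_mem_right _ _ hfJ)

end RegularDimensionZero

end Koenig

namespace Koenig

/-! ### Completion of a local ring and its formal fibres -/

section Completion

variable {R : Type u} [CommRing R] [IsLocalRing R] [IsNoetherianRing R] {a : R}

theorem exists_maximalIdeal_pow_le [Ring.KrullDimLE 1 R] (ha : a ∈ R⁰) :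
    ∃ k, IsLocalRing.maximalIdeal R ^ k ≤ Ideal.span {a} := by
  obtain ⟨k, hk⟩ := (Ideal.span {a}).exists_radical_pow_le_of_fg (IsNoetherian.noetherian _)
  refine ⟨k, (Ideal.pow_right_mono ?_ k).trans hk⟩
  rw [Ideal.radical_eq_sInf]
  refine le_sInf fun p ⟨hp, hprime⟩ => ?_
  have := isMaximal_of_mem_nonZeroDivisors ((Ideal.span_singleton_le_iff_mem _).mp hp) ha
  exact (IsLocalRing.eq_maximalIdeal this).ge

theorem exists_sub_mem_span_of_maximalIdeal_pow_le {k : ℕ}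
    (hk : IsLocalRing.maximalIdeal R ^ k ≤ Ideal.span {a}) (t : completion R) :
    ∃ r : R, t - algebraMap R (completion R) r ∈
      Ideal.span {algebraMap R (completion R) a} := by
  obtain ⟨r, hr⟩ := Ideal.Quotient.mk_surjective
    (AdicCompletion.evalₐ (IsLocalRing.maximalIdeal R) k t)
  refine ⟨r, ?_⟩
  have h0 : AdicCompletion.eval (IsLocalRing.maximalIdeal R) R k
      (t - algebraMap R (completion R) r) = 0 := by
    rw [← AdicCompletion.factor_evalₐ_eq_eval _ _ (by simp), map_sub, map_sub, ← hr,
      AdicCompletion.algebraMap_apply, AdicCompletion.evalₐ_of]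
    simp
  have h1 : t - algebraMap R (completion R) r ∈
      (IsLocalRing.maximalIdeal R ^ k • ⊤ : Submodule R (completion R)) := by
    rw [AdicCompletion.pow_smul_top_eq_ker_eval (IsNoetherian.noetherian _)]
    exact h0
  rw [Ideal.smul_top_eq_map, Submodule.restrictScalars_mem] at h1
  have h2 := Ideal.map_mono (f := algebraMap R (completion R)) hk h1
  rwa [Ideal.map_span, Set.image_singleton] at h2

omit [IsNoetherianRing R] in
theorem mem_span_of_algebraMap_mem_span {k : ℕ}
    (hk : IsLocalRing.maximalIdeal R ^ k ≤ Ideal.span {a}) {r : R}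
    (hr : algebraMap R (completion R) r ∈ Ideal.span {algebraMap R (completion R) a}) :
    r ∈ Ideal.span {a} := by
  obtain ⟨t, ht⟩ := Ideal.mem_span_singleton'.mp hr
  obtain ⟨s, hs⟩ := Ideal.Quotient.mk_surjective
    (AdicCompletion.evalₐ (IsLocalRing.maximalIdeal R) k t)
  have h := congrArg (AdicCompletion.evalₐ (IsLocalRing.maximalIdeal R) k) ht
  rw [map_mul, ← hs, AdicCompletion.algebraMap_apply, AdicCompletion.algebraMap_apply,
    AdicCompletion.evalₐ_of, AdicCompletion.evalₐ_of, ← map_mul, eq_comm, Ideal.Quotient.eq] at h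
  have h1 := add_mem (hk h) (Ideal.mul_mem_left _ s (Ideal.mem_span_singleton_self a))
  simpa using h1

theorem isAdicComplete_completion [Ring.KrullDimLE 1 R] (ha : a ∈ IsLocalRing.maximalIdeal R)
    (ha' : a ∈ R⁰) :
    IsAdicComplete (Ideal.span {algebraMap R (completion R) a}) (completion R) := by
  obtain ⟨k, hk⟩ := exists_maximalIdeal_pow_le ha'
  refine isAdicComplete_span_singleton (I := IsLocalRing.maximalIdeal (completion R)) (k := k) ?_ ?_
  · rw [AdicCompletion.maximalIdeal_eq_map]
    exact Ideal.mem_map_of_mem _ ha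
  · rw [AdicCompletion.maximalIdeal_eq_map, ← Ideal.map_pow, ← Set.image_singleton,
      ← Ideal.map_span]
    exact Ideal.map_mono hk

theorem isArtinianRing_completion_quotient [Ring.KrullDimLE 1 R] (ha : a ∈ R⁰) :
    IsArtinianRing (completion R ⧸ Ideal.span {algebraMap R (completion R) a}) := by
  obtain ⟨k, hk⟩ := exists_maximalIdeal_pow_le ha
  have := isArtinianRing_quotient_of_mem_nonZeroDivisors (Ideal.mem_span_singleton_self a) ha
  let f : R ⧸ Ideal.span {a} →+* completion R ⧸ Ideal.span {algebraMap R (completion R) a} :=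
    Ideal.quotientMap _ (algebraMap R (completion R))
      ((Ideal.span_singleton_le_iff_mem _).mpr (Ideal.mem_span_singleton_self _))
  have hf : Function.Surjective f := fun x => by
    obtain ⟨t, rfl⟩ := Ideal.Quotient.mk_surjective x
    obtain ⟨r, hr⟩ := exists_sub_mem_span_of_maximalIdeal_pow_le hk t
    exact ⟨Ideal.Quotient.mk _ r, (Ideal.Quotient.eq.mpr hr).symm⟩
  exact hf.isArtinianRing

theorem isUnit_one_add_algebraMap_mul (ha : a ∈ IsLocalRing.maximalIdeal R) (t : completion R) :
    IsUnit (1 + algebraMap R (completion R) a * t) := by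
  have h : algebraMap R (completion R) a * t ∈ IsLocalRing.maximalIdeal (completion R) := by
    rw [AdicCompletion.maximalIdeal_eq_map]
    exact Ideal.mul_mem_right _ _ (Ideal.mem_map_of_mem _ ha)
  by_contra hcon
  have h1 := sub_mem (show 1 + algebraMap R (completion R) a * t ∈
    IsLocalRing.maximalIdeal (completion R) from hcon) h
  rw [add_sub_cancel_right] at h1
  exact h1 isUnit_one

section Fiber

variable [Ring.KrullDimLE 1 R] {q : Ideal R} [q.IsPrime]

omit [IsLocalRing R] [IsNoetherianRing R] [Ring.KrullDimLE 1 R] in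
theorem isUnit_algebraMap_fiber {T : Type u} [CommRing T] [Algebra R T] {r : R} (hr : r ∉ q) :
    IsUnit (algebraMap R (q.Fiber T) r) := by
  rw [IsScalarTower.algebraMap_apply R q.ResidueField]
  refine IsUnit.map _ (IsUnit.mk0 _ ?_)
  rwa [Ne, Ideal.algebraMap_residueField_eq_zero]

/-- Both a and the denominators r ∉ q are units in the fibre, so the relation a^M s^n = s^(n+1) y in
the completion becomes f^n = f^(n+1) g. -/
theorem krullDimLE_zero_fiber (ha : a ∈ IsLocalRing.maximalIdeal R) (ha' : a ∈ R⁰)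
    (hq : q ∈ minimalPrimes R) : Ring.KrullDimLE 0 (q.Fiber (completion R)) := by
  have := isAdicComplete_completion ha ha'
  have := isArtinianRing_completion_quotient ha'
  refine krullDimLE_zero_of_forall_exists_pow_eq fun f => ?_
  obtain ⟨r, hr, s, hs⟩ := Ideal.Fiber.exists_smul_eq_one_tmul q f
  obtain ⟨M, n, y, hy⟩ := exists_pow_mul_pow_eq (a := algebraMap R (completion R) a) s
  have haq : a ∉ q := fun h => notMem_minimalPrimes_of_mem_nonZeroDivisors h ha' hq
  obtain ⟨u, hu⟩ := isUnit_algebraMap_fiber (T := completion R) haq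
  obtain ⟨v, hv⟩ := isUnit_algebraMap_fiber (T := completion R) hr
  let ι : completion R →ₐ[R] q.Fiber (completion R) := Algebra.TensorProduct.includeRight
  have hs' : (v : q.Fiber (completion R)) * f = ι s := by
    rw [hv, ← Algebra.smul_def, hs]
    rfl
  have hy' := congrArg ι hy
  rw [map_mul, map_mul, map_pow, map_pow, map_pow, AlgHom.commutes, ← hu, ← hs'] at hy'
  refine ⟨n, v * ↑u⁻¹ ^ M * ι y, ?_⟩
  have h1 : (↑u⁻¹ : q.Fiber (completion R)) ^ M * (u : q.Fiber (completion R)) ^ M = 1 := by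
    rw [← mul_pow, Units.inv_mul, one_pow]
  have h2 : (↑v⁻¹ : q.Fiber (completion R)) ^ n * (v : q.Fiber (completion R)) ^ n = 1 := by
    rw [← mul_pow, Units.inv_mul, one_pow]
  calc f ^ n = (↑u⁻¹ ^ M * u ^ M) * (↑v⁻¹ ^ n * v ^ n) * f ^ n := by rw [h1, h2]; ring
    _ = ↑u⁻¹ ^ M * ↑v⁻¹ ^ n * (u ^ M * (v * f) ^ n) := by ring
    _ = ↑u⁻¹ ^ M * (↑v⁻¹ ^ n * v ^ n) * f ^ (n + 1) * v * ι y := by rw [hy']; ring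
    _ = _ := by rw [h2]; ring

end Fiber

omit [IsLocalRing R] in
-- A reduced R embeds in the finite product of the residue fields at its minimal primes; tensoring
-- with the flat T embeds T in the product of its fibres.
theorem eq_zero_of_forall_includeRight_eq_zero [IsReduced R] {T : Type u} [CommRing T] [Algebra R T]
    [Module.Flat R T] {z : T} (hz : ∀ (q : Ideal R) [q.IsPrime], q ∈ minimalPrimes R →
      (Algebra.TensorProduct.includeRight : T →ₐ[R] q.Fiber T) z = 0) : z = 0 := by
  have : Finite (minimalPrimes R) := minimalPrimes.finite_of_isNoetherianRing R
  have (q : minimalPrimes R) : q.1.IsPrime := q.2.isPrime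
  classical
  have := Fintype.ofFinite (minimalPrimes R)
  let f : R →ₗ[R] ((q : minimalPrimes R) → q.1.ResidueField) :=
    LinearMap.pi fun q => Algebra.linearMap R q.1.ResidueField
  have hf : Function.Injective f := by
    rw [← LinearMap.ker_eq_bot, LinearMap.ker_eq_bot']
    intro r hr
    have h0 : r ∈ sInf (minimalPrimes R) := by
      rw [Submodule.mem_sInf]
      intro q hq
      have := hq.isPrime
      have := congrFun hr ⟨q, hq⟩
      exact (Ideal.algebraMap_residueField_eq_zero (I := q)).mp this
    rw [minimalPrimes, Ideal.sInf_minimalPrimes, (Ideal.isRadical_bot (R := R)).radical] at h0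
    exact h0
  have hinj := Module.Flat.lTensor_preserves_injective_linearMap (M := T) f hf
  have h1 : LinearMap.lTensor T f (z ⊗ₜ 1) = 0 := by
    apply (TensorProduct.piRight R R T fun q : minimalPrimes R => q.1.ResidueField).injective
    rw [map_zero (TensorProduct.piRight R R T fun q : minimalPrimes R => q.1.ResidueField)]
    funext q
    have h2 := hz q.1 q.2
    have h3 := congrArg (TensorProduct.comm R q.1.ResidueField T) h2
    rw [map_zero] at h3
    rw [TensorProduct.piRight_apply, LinearMap.lTensor_tmul]
    have h4 : (TensorProduct.comm R q.1.ResidueField T) (1 ⊗ₜ[R] z) = 0 := h3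
    rw [TensorProduct.comm_tmul] at h4
    simpa [f] using! h4
  have h2 : z ⊗ₜ[R] (1 : R) = 0 := hinj (h1.trans (map_zero _).symm)
  have h3 := congrArg (TensorProduct.rid R T) h2
  simpa using h3

/-- The ideal `c S ∩ R`, where `S` is the integral closure of `R` in `K`. -/
def integralMultiples (R : Type*) [CommRing R] (K : Type*) [CommRing K] [Algebra R K] (c : R) :
    Ideal R where
  carrier := {x | ∃ y : K, IsIntegral R y ∧ algebraMap R K x = algebraMap R K c * y}
  add_mem' := by
    rintro x x' ⟨y, hy, hxy⟩ ⟨y', hy', hxy'⟩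
    exact ⟨y + y', hy.add hy', by rw [map_add, hxy, hxy', mul_add]⟩
  zero_mem' := ⟨0, isIntegral_zero, by rw [map_zero, mul_zero]⟩
  smul_mem' := by
    rintro r x ⟨y, hy, hxy⟩
    exact ⟨algebraMap R K r * y, isIntegral_algebraMap.mul hy, by
      rw [smul_eq_mul, map_mul, hxy, mul_left_comm]⟩

omit [IsLocalRing R] [IsNoetherianRing R] in
theorem integralMultiples_antitone (K : Type*) [CommRing K] [Algebra R K] (a : R) :
    Antitone fun n => integralMultiples R K (a ^ n) := antitone_nat_of_succ_le fun n x => by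
  rintro ⟨y, hy, hxy⟩
  exact ⟨algebraMap R K a * y, isIntegral_algebraMap.mul hy, by
    rw [hxy, pow_succ, map_mul, mul_assoc]⟩

omit [IsLocalRing R] [IsNoetherianRing R] in
theorem exists_isIntegral_of_mem_map_integralMultiples {K : Type*} [CommRing K] [Algebra R K]
    {T F : Type*} [CommRing T] [Algebra R T] [CommRing F] [Algebra R F] [Algebra T F]
    [IsScalarTower R T F] (ψ : K →ₐ[R] F) {c : R} {z : T}
    (hz : z ∈ (integralMultiples R K c).map (algebraMap R T)) :
    ∃ b : F, IsIntegral T b ∧ algebraMap T F z = algebraMap T F (algebraMap R T c) * b := by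
  induction hz using Submodule.span_induction with
  | mem z hz =>
    obtain ⟨x, ⟨y, hy, hxy⟩, rfl⟩ := hz
    refine ⟨ψ y, (hy.map ψ).tower_top, ?_⟩
    have := congrArg ψ hxy
    rwa [map_mul, AlgHom.commutes, AlgHom.commutes, IsScalarTower.algebraMap_apply R T F,
      IsScalarTower.algebraMap_apply R T F] at this
  | zero => exact ⟨0, isIntegral_zero, by rw [map_zero, mul_zero]⟩
  | add z z' _ _ hz hz' =>
    obtain ⟨b, hb, hzb⟩ := hz
    obtain ⟨b', hb', hzb'⟩ := hz'
    exact ⟨b + b', hb.add hb', by rw [map_add, hzb, hzb', mul_add]⟩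
  | smul t z _ hz =>
    obtain ⟨b, hb, hzb⟩ := hz
    exact ⟨algebraMap T F t * b, isIntegral_algebraMap.mul hb, by
      rw [smul_eq_mul, map_mul, hzb, mul_left_comm]⟩

attribute [local instance] Algebra.TensorProduct.rightAlgebra in
-- Chevalley's theorem for the extensions of a^n S ∩ R to the completion T. An element of their
-- intersection vanishes in every fibre over a minimal prime, hence is zero; and aT ∩ R = aR brings
-- the inclusion back to R.
theorem exists_integralMultiples_le_of_isLocalRing [IsReduced R] [Ring.KrullDimLE 1 R]
    (ha : a ∈ IsLocalRing.maximalIdeal R) (ha' : a ∈ R⁰) (K : Type*) [CommRing K] [Algebra R K]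
    [IsFractionRing R K]
    (hreg : ∀ (q : Ideal R) [q.IsPrime], IsRegularRing (q.Fiber (completion R))) :
    ∃ n, integralMultiples R K (a ^ n) ≤ Ideal.span {a} := by
  set T := completion R
  have := isAdicComplete_completion ha ha'
  have := isArtinianRing_completion_quotient ha'
  have hart (k : ℕ) : IsArtinianRing (T ⧸ Ideal.span {algebraMap R T a ^ k}) := by
    rw [← map_pow]
    exact isArtinianRing_completion_quotient (pow_mem ha' k)
  obtain ⟨k, hk⟩ := exists_maximalIdeal_pow_le ha'
  obtain ⟨n, hn⟩ := exists_le_of_iInf_eq_bot hart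
    (N := fun n => (integralMultiples R K (a ^ n)).map (algebraMap R T))
    (fun m n hmn => Ideal.map_mono (integralMultiples_antitone K a hmn)) (fun n => by
      rw [← map_pow]
      exact Ideal.mem_map_of_mem _ ⟨1, isIntegral_one, by rw [mul_one]⟩) (by
      rw [eq_bot_iff]
      intro z hz
      rw [Submodule.mem_iInf] at hz
      refine eq_zero_of_forall_includeRight_eq_zero (R := R) fun q _ hq => ?_
      have hq' {c : R} (hc : c ∈ R⁰) : c ∉ q := fun h =>
        notMem_minimalPrimes_of_mem_nonZeroDivisors h hc hq
      have := krullDimLE_zero_fiber ha ha' hq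
      have := hreg q
      have : IsReduced (q.Fiber T) := isReduced_of_isRegularRing_of_krullDimLE_zero
      let ψ : K →ₐ[R] q.Fiber T := IsLocalization.liftAlgHom (M := R⁰)
        (f := Algebra.ofId R (q.Fiber T)) fun c => isUnit_algebraMap_fiber (hq' c.2)
      refine eq_zero_of_forall_exists_isIntegral (F := q.Fiber T) (a := algebraMap R T a) ?_
        (isUnit_one_add_algebraMap_mul ha) (exists_pow_mul_pow_eq z) fun N => ?_
      · rw [← IsScalarTower.algebraMap_apply]
        exact isUnit_algebraMap_fiber (hq' ha')
      · rw [← map_pow, ← map_pow]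
        exact exists_isIntegral_of_mem_map_integralMultiples ψ (hz N))
  exact ⟨n, fun x hx => mem_span_of_algebraMap_mem_span hk (hn (Ideal.mem_map_of_mem _ hx))⟩

end Completion

/-! ### Finiteness of the normalization -/

section Global

variable {O : Type u} [CommRing O] [IsReduced O] [IsNoetherianRing O] [Ring.KrullDimLE 1 O]

omit [IsReduced O] [IsNoetherianRing O] in
theorem krullDimLE_one_localization (p : Ideal O) [p.IsPrime] :
    Ring.KrullDimLE 1 (Localization.AtPrime p) := by
  rw [Ring.krullDimLE_iff, IsLocalization.AtPrime.ringKrullDim_eq_height p]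
  exact (Ideal.height_le_ringKrullDim_of_ne_top (Ideal.IsPrime.ne_top ‹_›)).trans
    (Ring.krullDimLE_iff.mp ‹_›)

omit [IsReduced O] [Ring.KrullDimLE 1 O] [IsNoetherianRing O] in
theorem map_integralMultiples_le {R : Type u} [CommRing R] [Algebra O R] (M : Submonoid O)
    [IsLocalization M R] (c : O) :
    (integralMultiples O (FractionRing O) c).map (algebraMap O R) ≤
      integralMultiples R (FractionRing R) (algebraMap O R c) := by
  rw [Ideal.map_le_iff_le_comap]
  rintro x ⟨y, hy, hxy⟩
  have hM {c : O} (hc : c ∈ O⁰) : algebraMap O R c ∈ R⁰ :=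
    IsLocalization.map_nonZeroDivisors_le M R ⟨c, hc, rfl⟩
  let ψ : FractionRing O →ₐ[O] FractionRing R := IsLocalization.liftAlgHom (M := O⁰)
    (f := Algebra.ofId O (FractionRing R)) fun c => by
      rw [Algebra.ofId_apply, IsScalarTower.algebraMap_apply O R (FractionRing R)]
      exact IsLocalization.map_units (FractionRing R) (⟨_, hM c.2⟩ : R⁰)
  refine ⟨ψ y, (hy.map ψ).tower_top, ?_⟩
  rw [← IsScalarTower.algebraMap_apply, ← IsScalarTower.algebraMap_apply, ← ψ.commutes, hxy,
    map_mul, AlgHom.commutes]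

omit [IsReduced O] [IsNoetherianRing O] [Ring.KrullDimLE 1 O] in
theorem IsExcellentRing.isRegularRing_fiber (hexc : IsExcellentRing O) (p : Ideal O) [p.IsPrime]
    (q : Ideal (Localization.AtPrime p)) [q.IsPrime] :
    IsRegularRing (q.Fiber (completion (Localization.AtPrime p))) := by
  -- Only the trivial extension of the residue field is needed: regular fibres suffice.
  have := hexc.formalFibres p q q.ResidueField inferInstance
  exact IsRegularRing.of_ringEquiv
    (R := q.ResidueField ⊗[q.ResidueField] q.Fiber (completion (Localization.AtPrime p)))
    (Algebra.TensorProduct.lid q.ResidueField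
    (q.Fiber (completion (Localization.AtPrime p)))).toRingEquiv

theorem IsExcellentRing.exists_integralMultiples_le_map_comap (hexc : IsExcellentRing O) {a : O}
    (ha : a ∈ O⁰) (p : Ideal O) [p.IsPrime] (hap : a ∈ p) :
    ∃ n, ∀ x ∈ integralMultiples O (FractionRing O) (a ^ n), ∃ s ∉ p, s * x ∈ Ideal.span {a} := by
  set R := Localization.AtPrime p
  have := krullDimLE_one_localization p
  obtain ⟨n, hn⟩ := exists_integralMultiples_le_of_isLocalRing (a := algebraMap O R a)
    ((IsLocalization.AtPrime.to_map_mem_maximal_iff R p a).mpr hap)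
    (IsLocalization.map_nonZeroDivisors_le p.primeCompl R ⟨a, ha, rfl⟩) (FractionRing R)
    (fun q _ => hexc.isRegularRing_fiber p q)
  refine ⟨n, fun x hx => ?_⟩
  have h1 := map_integralMultiples_le p.primeCompl (a ^ n) (Ideal.mem_map_of_mem (algebraMap O R) hx)
  rw [map_pow] at h1
  have h2 := hn h1
  rw [← Set.image_singleton, ← Ideal.map_span,
    IsLocalization.algebraMap_mem_map_algebraMap_iff p.primeCompl] at h2
  exact h2

/-- Membership in (a) is local, and the primes containing a are the finitely many minimal ones over
(a), so a common bound of the local exponents works. -/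
theorem IsExcellentRing.exists_integralMultiples_le (hexc : IsExcellentRing O) {a : O}
    (ha : a ∈ O⁰) : ∃ n, integralMultiples O (FractionRing O) (a ^ n) ≤ Ideal.span {a} := by
  have hfin : Finite (Ideal.span {a}).minimalPrimes :=
    Ideal.finite_minimalPrimes_of_isNoetherianRing O _
  have h (p : (Ideal.span {a}).minimalPrimes) : ∃ n, ∀ x ∈ integralMultiples O (FractionRing O)
      (a ^ n), ∃ s ∉ p.1, s * x ∈ Ideal.span {a} := by
    have := p.2.isPrime
    exact hexc.exists_integralMultiples_le_map_comap ha p.1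
      ((Ideal.span_singleton_le_iff_mem _).mp p.2.le)
  choose n hn using h
  obtain ⟨N, hN⟩ := Set.Finite.bddAbove (Set.finite_range n)
  refine ⟨N, fun x hx => ?_⟩
  by_contra hxa
  obtain ⟨m, hm, hle⟩ := Ideal.exists_le_maximal ((Ideal.span {a} : Submodule O O).colon {x}) (by
    rw [Ne, Ideal.eq_top_iff_one, Submodule.mem_colon_singleton, one_smul]
    exact hxa)
  have ham : a ∈ m := hle (by
    rw [Submodule.mem_colon_singleton, smul_eq_mul]
    exact Ideal.mul_mem_right _ _ (Ideal.mem_span_singleton_self a))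
  have hmin : m ∈ (Ideal.span {a}).minimalPrimes := mem_minimalPrimes_span_singleton ham ha
  obtain ⟨s, hs, hsx⟩ := hn ⟨m, hmin⟩ x
    (integralMultiples_antitone (FractionRing O) a (hN ⟨_, rfl⟩) hx)
  exact hs (hle (Submodule.mem_colon_singleton.mpr hsx))

/-- The normalization of an excellent reduced ring of dimension one is finite. -/
theorem IsExcellentRing.finite_normalization (hexc : IsExcellentRing O) :
    Module.Finite O (normalization O) := by
  obtain ⟨a, ha, ha'⟩ := exists_mem_vanishingIdeal_singularLocus
    (hexc.isOpen_regularLocus O inferInstance)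
  have hsing : ∀ (m : Ideal O) [m.IsPrime], (∃ c ∈ m, c ∈ O⁰) → a ∉ m →
      IsRegularLocalRing (Localization.AtPrime m) := fun m hm _ ham => by
    by_contra hcon
    exact ham ((PrimeSpectrum.mem_vanishingIdeal _ _).mp ha ⟨m, hm⟩ hcon)
  obtain ⟨n, hn⟩ := hexc.exists_integralMultiples_le ha'
  have hu := IsLocalization.map_units (FractionRing O) (⟨a, ha'⟩ : O⁰)
  -- Any exponent above n can be lowered: a^(n+k+1) y lies in a^n S ∩ O ⊆ aO, so one factor a
  -- cancels.
  have hdesc (k : ℕ) {y : FractionRing O} (hy : IsIntegral O y)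
      (h : algebraMap O (FractionRing O) (a ^ (n + k)) * y ∈ (algebraMap O (FractionRing O)).range) :
      algebraMap O (FractionRing O) (a ^ n) * y ∈ (algebraMap O (FractionRing O)).range := by
    induction k with
    | zero => exact h
    | succ k ih =>
      refine ih ?_
      obtain ⟨x, hx⟩ := h
      have hxn : x ∈ integralMultiples O (FractionRing O) (a ^ n) :=
        ⟨algebraMap O _ (a ^ (k + 1)) * y, isIntegral_algebraMap.mul hy, by
          rw [hx, pow_add, map_mul, mul_assoc]⟩
      obtain ⟨x', rfl⟩ := Ideal.mem_span_singleton'.mp (hn hxn)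
      refine ⟨x', hu.mul_right_cancel ?_⟩
      rw [← map_mul, hx, ← add_assoc, pow_succ, map_mul]
      ring
  -- Some power of a carries y into O because O is regular away from a; the descent makes the
  -- exponent independent of y. Thus S embeds in O as a module.
  have hmul (y : normalization O) : algebraMap O (FractionRing O) (a ^ n) * y ∈
      (algebraMap O (FractionRing O)).range := by
    obtain ⟨k, x, hx⟩ := exists_pow_mul_mem_range hsing y.2
    refine hdesc k y.2 ⟨a ^ n * x, ?_⟩
    rw [map_mul, hx, pow_add, map_mul, mul_assoc]
  let f : normalization O →ₗ[O] FractionRing O :=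
    LinearMap.lsmul O (FractionRing O) (a ^ n) ∘ₗ (normalization O).val.toLinearMap
  have hf : Function.Injective f := fun y y' h => by
    apply Subtype.ext
    have hun := hu.pow n
    rw [← map_pow] at hun
    apply hun.mul_left_cancel
    simpa [f, Algebra.smul_def] using h
  have hrange : LinearMap.range f ≤ LinearMap.range (Algebra.linearMap O (FractionRing O)) := by
    rintro _ ⟨y, rfl⟩
    obtain ⟨x, hx⟩ := hmul y
    exact ⟨x, hx.trans (Algebra.smul_def _ _).symm⟩
  have : IsNoetherian O (LinearMap.range (Algebra.linearMap O (FractionRing O))) := inferInstance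
  exact Module.Finite.of_injective
    (f.codRestrict (LinearMap.range (Algebra.linearMap O (FractionRing O)))
      fun y => hrange ⟨y, rfl⟩) fun y y' h => hf (congrArg Subtype.val h)

end Global

end Koenig

theorem theoremT (O : Type u) [CommRing O] [IsReduced O]
    (hexc : Koenig.IsExcellentRing O) (hdim : ringKrullDim O = 1) (hsing : ¬ IsRegularRing O) :
    Koenig.overring O (Koenig.level O) = Koenig.normalization O ∧
    Koenig.globalDimension (Koenig.KoenigOrder O (Koenig.level O)) ≤
      ((2 * Koenig.level O : ℕ) : WithBot ℕ∞) ∧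
    IsArtinianRing (Koenig.KoenigQuotient O (Koenig.level O)) ∧
    IsArtinianRing (Koenig.KoenigQuotient O (Koenig.level O))ᵐᵒᵖ ∧
    Koenig.IsHeredityChain (fun t : Fin (Koenig.level O + 1) =>
      Koenig.imageInQuotient (Koenig.koenigKernel O (Koenig.level O))
        (Koenig.koenigIdeal O (Koenig.level O) (Koenig.level O - t))) ∧
    Koenig.IsQuasiHereditary (Koenig.KoenigQuotient O (Koenig.level O)) ∧
    Koenig.globalDimension (Koenig.KoenigQuotient O (Koenig.level O)) < ⊤ := by
  have hnoeth : IsNoetherianRing O := hexc.isNoetherianRing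
  have hle : Ring.KrullDimLE 1 O := (Order.krullDimLE_iff _ _).mpr hdim.le
  have hfin : Module.Finite O (Koenig.normalization O) := hexc.finite_normalization
  have hreg : ∀ S : Subalgebra O (FractionRing O), Algebra.FiniteType O S →
      IsOpen (Koenig.regularLocus S) := fun S => hexc.isOpen_regularLocus S
  have hlevel := Koenig.overring_level hreg
  have hpos := Koenig.level_pos hreg hsing
  have hss : ∀ k < Koenig.level O, IsSemisimpleRing (Koenig.overring O k ⧸
      Koenig.conductorIdeal O k) := fun k _ => Koenig.isSemisimpleRing_quotient_conductorIdeal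
          hreg k
  have hproj : ∀ I : Ideal (Koenig.overring O (Koenig.level O)),
      Module.Projective (Koenig.overring O (Koenig.level O)) I := by
    rw [hlevel]
    exact Koenig.projective_ideal_normalization
  have hint : ∀ k ≤ Koenig.level O, Koenig.overring O k ≤ Koenig.normalization O :=
    fun k _ => Koenig.overring_le_normalization hreg k
  have hchain := Koenig.isHeredityChain_koenigIdeal hss
    fun k hk => Koenig.not_overring_succ_le hreg hk
  have hart := Koenig.isArtinianRing_koenigQuotient hint
  refine ⟨hlevel, Koenig.globalDimension_le_of_pdLT fun M _ _ =>
    Koenig.pdLT_koenigOrder hpos hss hproj M, hart, Koenig.isArtinianRing_op_koenigQuotient hint,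
    hchain, ⟨inferInstance, _, _, hchain⟩, ?_⟩
  -- Q is A/J_n, reached from the semisimple A/J_1 in level - 1 steps.
  refine (Koenig.globalDimension_le_of_pdLT (n := 2 * (Koenig.level O - 1)) fun M _ _ =>
    Koenig.pdLT_of_ker hss (Koenig.level O - 1) (Nat.sub_lt hpos one_pos)
      (Koenig.mk'_surjective (Koenig.koenigKernel O (Koenig.level O))) (fun a => ?_) M).trans_lt ?_
  · rw [Koenig.mk'_eq_zero_iff, show Koenig.level O - 1 + 1 = Koenig.level O from
      Nat.sub_add_cancel hpos, Koenig.koenigIdeal_self]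
  · exact WithBot.coe_lt_coe.mpr (ENat.natCast_lt_top _)
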